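/- Let $M$ be a connected, Hausdorff, second countable smooth manifold of finite dimension $n\ge 0$. For $i\ge 0$ let $\mathcal S_i(M)$ be the space of smooth real functions on $T^*M$ that restrict to homogeneous polynomials of degree $i$ on every fibre, and let $\mathcal S(M)=\mathrm{Pol}(T^*M)=\bigoplus_{i\ge 0}\mathcal S_i(M)$. It is closed under the canonical symplectic Poisson bracket of $T^*M$, in canonical coordinates $$\{P,Q\}=\sum_{i}\Big(\frac{\partial P}{\partial p_i}\frac{\partial Q}{\partial q^i}-\frac{\partial P}{\partial q^i}\frac{\partial Q}{\partial p_i}\Big),$$ and is regarded as a Lie algebra with this bracket. A linear map $\Phi:\mathcal S(M)\to\mathcal S(M)$ is an automorphism of the Lie algebra $\mathcal S(M)$ if and only if it can be written in the form $$\Phi(P)=\mathcal U_\kappa(P)\circ\varphi^*\circ \mathrm{Exp}(\omega^v)\qquad(P\in\mathcal S(M)),$$ where $\kappa$ is a non-zero real constant and $\mathcal U_\kappa$ is the linear map with $\mathcal U_\kappa(P)=\kappa^{1-i}P$ for $P\in\mathcal S_i(M)$; $\varphi^*:T^*M\to T^*M$ is the phase lift of a smooth diffeomorphism $\varphi$ of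 $M$, given by $T^*_{\varphi(x)}M\ni\alpha\mapsto\alpha\circ d\varphi_x\in T^*_xM$; and $\mathrm{Exp}(\omega^v):T^*M\to T^*M$, $\alpha_x\mapsto\alpha_x+\omega_x$, is the translation by a smooth closed $1$-form $\omega$ on $M$. For every such $\kappa,\varphi,\omega$ this formula does define a linear map $\mathcal S(M)\to\mathcal S(M)$, and $\kappa,\varphi,\omega$ are uniquely determined by $\Phi$. -/

import Mathlib

open scoped Manifold ContDiff Bundle

noncomputable section

namespace PolyPoisson

/-- The model space `ℝⁿ`. -/
abbrev Model (n : ℕ) : Type := EuclideanSpace ℝ (Fin n)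

section Cotangent

variable (n : ℕ) (M : Type*) [TopologicalSpace M] [ChartedSpace (Model n) M]

/-- The cotangent space `T*ₓM`, the dual of the tangent space at `x`. -/
abbrev Cotangent (x : M) : Type :=
  TangentSpace (𝓡 n) x →L[ℝ] Bundle.Trivial M ℝ x

/-- The total space of the cotangent bundle `T*M`. With the vector bundle structure of Mathlib its
charts are the canonical coordinates `(q, p)` induced by the charts of `M`: the covector `α` at `x`
has as `p` the covector `α` read in the coordinate frame of the chart. -/
abbrev CotangentBundle : Type _ :=
  Bundle.TotalSpace (Model n →L[ℝ] ℝ) (Cotangent n M)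

/-- The model with corners of the manifold `T*M`, with model space `ℝⁿ × (ℝⁿ)*`. -/
abbrev cotModel : ModelWithCorners ℝ (Model n × (Model n →L[ℝ] ℝ))
    (ModelProd (Model n) (Model n →L[ℝ] ℝ)) :=
  (𝓡 n).prod 𝓘(ℝ, Model n →L[ℝ] ℝ)

end Cotangent

section Functions

variable {n : ℕ} {M : Type*} [TopologicalSpace M] [ChartedSpace (Model n) M]

/-- The function `P` on `T*M` is, on each fibre, a homogeneous polynomial of degree `i`, that is,
the restriction to the diagonal of an `i`-linear form. -/
def FibreHomogeneous (i : ℕ) (P : CotangentBundle n M → ℝ) : Prop :=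
  ∀ x : M, ∃ c : MultilinearMap ℝ (fun _ : Fin i => Cotangent n M x) ℝ,
    ∀ α : Cotangent n M x, P ⟨x, α⟩ = c fun _ => α

variable [IsManifold (𝓡 n) ∞ M]

variable (n M) in
/-- `Sᵢ(M)`: the smooth functions on `T*M` that are homogeneous polynomials of degree `i` on the
fibres. -/
def homogeneousPart (i : ℕ) : Submodule ℝ (CotangentBundle n M → ℝ) where
  carrier := {P | ContMDiff (cotModel n) 𝓘(ℝ, ℝ) ∞ P ∧ FibreHomogeneous i P}
  zero_mem' := ⟨contMDiff_const, fun _ => ⟨0, fun _ => rfl⟩⟩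
  add_mem' := by
    rintro P Q ⟨hP, hP'⟩ ⟨hQ, hQ'⟩
    refine ⟨hP.add hQ, fun x => ?_⟩
    obtain ⟨c, hc⟩ := hP' x
    obtain ⟨d, hd⟩ := hQ' x
    exact ⟨c + d, fun α => by simp [hc, hd]⟩
  smul_mem' := by
    rintro r P ⟨hP, hP'⟩
    refine ⟨(contMDiff_const (c := r)).mul hP, fun x => ?_⟩
    obtain ⟨c, hc⟩ := hP' x
    exact ⟨r • c, fun α => by simp [hc]⟩

variable (n M) in
/-- `S(M) = Pol(T*M)`, the sum of the spaces `Sᵢ(M)`, `i ≥ 0`: the smooth functions on `T*M` that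
are polynomial along the fibres. -/
def PolyFun : Submodule ℝ (CotangentBundle n M → ℝ) :=
  ⨆ i : ℕ, homogeneousPart n M i

/-- The differential of a function on `T*M` at `z`, in the canonical coordinates `(q, p)` of the
preferred chart at `z`. -/
def phaseDeriv (P : CotangentBundle n M → ℝ) (z : CotangentBundle n M) :
    Model n × (Model n →L[ℝ] ℝ) →L[ℝ] ℝ :=
  mfderiv (cotModel n) 𝓘(ℝ, ℝ) P z

/-- The partial derivative `∂P/∂qⁱ` at `z`. -/
def dq (P : CotangentBundle n M → ℝ) (i : Fin n) (z : CotangentBundle n M) : ℝ :=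
  phaseDeriv P z (EuclideanSpace.single i 1, 0)

/-- The partial derivative `∂P/∂pᵢ` at `z`. -/
def dp (P : CotangentBundle n M → ℝ) (i : Fin n) (z : CotangentBundle n M) : ℝ :=
  phaseDeriv P z (0, EuclideanSpace.proj i)

/-- The canonical symplectic Poisson bracket of `T*M`,
`{P, Q} = ∑ᵢ (∂P/∂pᵢ ∂Q/∂qⁱ - ∂P/∂qⁱ ∂Q/∂pᵢ)`. The value at `z` is computed in the canonical
coordinates induced by the preferred chart of `M` at the base point of `z`. The sign is such that
`{X, f} = X f` for a vector field `X`, as a function linear on the fibres, and a function `f` on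
`M`. -/
def poisson (P Q : CotangentBundle n M → ℝ) : CotangentBundle n M → ℝ := fun z =>
  ∑ i, (dp P i z * dq Q i z - dq P i z * dp Q i z)

/-- A linear map `S(M) → S(M)` is an automorphism of the Lie algebra `S(M)`: it is bijective, and
it maps the bracket `R = {P, Q}` of `P` and `Q` to the bracket of their images. -/
def IsLieAutomorphism (Φ : PolyFun n M →ₗ[ℝ] PolyFun n M) : Prop :=
  Function.Bijective Φ ∧
    ∀ P Q R : PolyFun n M, (R : CotangentBundle n M → ℝ) = poisson P.1 Q.1 →
      (Φ R : CotangentBundle n M → ℝ) = poisson (Φ P).1 (Φ Q).1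

/-- The map `U_κ`, given on functions of mixed degree by `(U_κ P)(α) = κ P(κ⁻¹ α)`. The next lemma
is the usual description `U_κ P = κ^{1-i} P` for `P` of degree `i`. -/
def rescale (κ : ℝ) : (CotangentBundle n M → ℝ) →ₗ[ℝ] (CotangentBundle n M → ℝ) where
  toFun P z := κ * P ⟨z.1, κ⁻¹ • z.2⟩
  map_add' P Q := by ext z; simp [mul_add]
  map_smul' r P := by ext z; simp [mul_left_comm]

lemma rescale_of_mem {κ : ℝ} (hκ : κ ≠ 0) {i : ℕ} {P : CotangentBundle n M → ℝ}
    (hP : P ∈ homogeneousPart n M i) : rescale κ P = κ ^ (1 - (i : ℤ)) • P := by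
  ext ⟨x, α⟩
  obtain ⟨c, hc⟩ := hP.2 x
  have h := c.map_smul_univ (fun _ : Fin i => κ⁻¹) (fun _ => α)
  simp only [Finset.prod_const, Finset.card_univ, Fintype.card_fin] at h
  change κ * P ⟨x, κ⁻¹ • α⟩ = κ ^ (1 - (i : ℤ)) * P ⟨x, α⟩
  rw [hc, hc, h, zpow_sub₀ hκ, zpow_one, zpow_natCast, smul_eq_mul, inv_pow]
  ring

/-- The fibre translation `Exp(ηᵛ)` by the `1`-form `η`: `αₓ ↦ αₓ + ηₓ`. -/
def translation (η : (x : M) → Cotangent n M x) (z : CotangentBundle n M) :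
    CotangentBundle n M :=
  ⟨z.1, z.2 + η z.1⟩

/-- The phase lift `φ* : T*M → T*M` of a diffeomorphism `φ`: the pullback of covectors
`T*_{φ x}M → T*ₓM`, `α ↦ α ∘ dφₓ`. (With `x = φ⁻¹ y`, a covector at `y` is one at `φ (φ⁻¹ y)`.) -/
def phaseLift (φ : M ≃ₘ^∞⟮𝓡 n, 𝓡 n⟯ M) (z : CotangentBundle n M) : CotangentBundle n M :=
  ⟨φ.symm z.1,
    (show TangentSpace (𝓡 n) (φ (φ.symm z.1)) →L[ℝ] ℝ from z.2).comp
      (mfderiv (𝓡 n) (𝓡 n) φ (φ.symm z.1))⟩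

variable (n M) in
/-- Smooth `1`-forms on `M`: smooth sections of the cotangent bundle. -/
abbrev OneForm : Type _ :=
  ContMDiffSection (𝓡 n) (Model n →L[ℝ] ℝ) ∞ (Cotangent n M)

/-- The local representative of the `1`-form `η` in the preferred chart at `x₀`. -/
def localForm (η : OneForm n M) (x₀ : M) (y : Model n) : Model n →L[ℝ] ℝ :=
  (show TangentSpace (𝓡 n) ((extChartAt (𝓡 n) x₀).symm y) →L[ℝ] ℝ from
    η ((extChartAt (𝓡 n) x₀).symm y)).comp
      (mfderiv 𝓘(ℝ, Model n) (𝓡 n) (extChartAt (𝓡 n) x₀).symm y)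

/-- `dη = 0`: in the charts of `M`, the derivative of the local representative of `η` is symmetric,
i.e. `∂η_j/∂xⁱ = ∂η_i/∂xʲ`. -/
def IsClosedForm (η : OneForm n M) : Prop :=
  ∀ x₀ : M, ∀ y ∈ (extChartAt (𝓡 n) x₀).target, ∀ u v : Model n,
    fderiv ℝ (localForm η x₀) y u v = fderiv ℝ (localForm η x₀) y v u

/-- `Φ` is the map `P ↦ U_κ(P) ∘ φ* ∘ Exp(ηᵛ)`. -/
def HasNormalForm (Φ : PolyFun n M →ₗ[ℝ] PolyFun n M) (κ : ℝ) (φ : M ≃ₘ^∞⟮𝓡 n, 𝓡 n⟯ M)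
    (η : OneForm n M) : Prop :=
  ∀ P : PolyFun n M,
    (Φ P : CotangentBundle n M → ℝ) = rescale κ P.1 ∘ phaseLift φ ∘ translation η

end Functions

end PolyPoisson

end

/-! Maps of the stated form are automorphisms for two reasons: in canonical coordinates `φ* ∘
Exp(ηᵛ)` has a symplectic derivative as soon as `dη = 0`, and `U_κ` is compatible with a bracket of
degree `-1`. The data are unique because `1 ↦ κ` and because `S(M)` separates the points of `T*M`.

For the converse, let `Φ` be an automorphism. The subspace `S₀` is recognised by the Lie structure:
it consists of the `P` for which `{P, ·}` is locally nilpotent. One inclusion holds because a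
bracket with a function lowers the degree. For the other, a locally nilpotent derivation kills
units; applied to `e^f`, the rule `{P, e^f} = e^f {P, f}` gives `{P, f} = 0` for every `f`, so `P`
is constant on the fibres. Hence `Φ` preserves `S₀` (`PoissonGrading.map_mem_part_zero`).

The algebraic core is `PoissonGrading.map_mul_of_derivation`. Suppose a linear map `c` turns every
derivation `{P, ·}` of `S₀`, with `P` in `S_{i+1}`, into another derivation `{P', ·}`. Then `c`
commutes on `S_i` with multiplication by functions. Polarising the Leibniz rule shows that the
defect of this commutation vanishes on multiples of high powers of brackets `{X, f}`, with `X` a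
vector field. Since `1 = {X₁, f₁} + {X₂, f₂}` for suitable fields and functions when `n > 0`, such
powers generate the unit ideal. The presentation of `1` comes from two functions without a common
critical point, found by Baire category and a dimension count (`nonsingular_grading`).

Applied to the conjugate by `Φ` of multiplication by `f`, the core lemma gives `Φ(fg) Φ(1) = Φ(f)
Φ(g)` on `S₀`. Here `Φ(1)` is central, hence a constant `κ`, and `κ⁻¹ Φ` is an automorphism of the
algebra of smooth functions. Multiplicative functionals are evaluations at points, so it is induced
by a diffeomorphism `φ`.

After removing `U_κ` and `φ*`, the automorphism fixes `S₀`, and the core lemma shows that its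
difference `c` from the identity is linear over functions. On `S₁` this difference takes values in
`S₀`, so it is evaluation on a `1`-form, and the cocycle identity of `c` says that the form is
closed. Once the translation is removed as well, `S₁` is fixed too; then local Euler fields `∑ qⱼ
pⱼ` force the automorphism to be the identity in every degree (`eq_id`). -/

open scoped Manifold ContDiff Bundle Topology

noncomputable section

namespace PolyPoisson

set_option linter.unusedSectionVars false

/-! ### Canonical coordinates of the cotangent bundle. -/

section Coordinates

variable {n : ℕ} {M : Type*} [TopologicalSpace M] [ChartedSpace (Model n) M]
  [IsManifold (𝓡 n) ∞ M]

/-- The canonical coordinates `(q, p)` of `T*M` induced by the preferred chart at `x₀`. -/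
def cotChart (x₀ : M) : PartialEquiv (CotangentBundle n M) (Model n × (Model n →L[ℝ] ℝ)) :=
  extChartAt (cotModel n) (⟨x₀, 0⟩ : CotangentBundle n M)

lemma extChartAt_eq_cotChart (z : CotangentBundle n M) :
    extChartAt (cotModel n) z = cotChart z.1 := by
  unfold cotChart
  rw [FiberBundle.extChartAt, FiberBundle.extChartAt]

lemma cotChart_source (x₀ : M) :
    (cotChart x₀ : PartialEquiv (CotangentBundle n M) _).source =
      {z | z.1 ∈ (chartAt (Model n) x₀).source} := by
  unfold cotChart
  rw [FiberBundle.extChartAt]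
  ext z
  have h : (trivializationAt (Model n →L[ℝ] ℝ) (Cotangent n M) x₀ z).1 = z.1 :=
    congrArg Prod.fst (hom_trivializationAt_apply (RingHom.id ℝ) x₀ z)
  simp only [PartialEquiv.trans_source, Bundle.Trivialization.source_eq,
    hom_trivializationAt_baseSet, PartialEquiv.prod_source, Set.mem_inter_iff, Set.mem_preimage,
    Set.mem_prod, PartialEquiv.refl_source, Set.mem_univ, and_true, extChartAt_source]
  change _ ∧ (trivializationAt (Model n →L[ℝ] ℝ) (Cotangent n M) x₀ z).1 ∈ _ ↔ _
  rw [h]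
  exact ⟨fun hz => hz.2, fun hz => ⟨⟨hz, trivial⟩, hz⟩⟩

lemma mem_cotChart_source {x₀ : M} {z : CotangentBundle n M} :
    z ∈ (cotChart x₀).source ↔ z.1 ∈ (chartAt (Model n) x₀).source := by
  rw [cotChart_source]; rfl

lemma cotChart_target (x₀ : M) :
    (cotChart x₀ : PartialEquiv (CotangentBundle n M) _).target =
      (extChartAt (𝓡 n) x₀).target ×ˢ Set.univ := by
  unfold cotChart
  rw [FiberBundle.extChartAt_target]
  congr 1
  refine Set.inter_eq_left.2 fun y hy => ?_
  have := (extChartAt (𝓡 n) x₀).map_target hy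
  simpa [hom_trivializationAt_baseSet] using this

lemma mem_cotChart_target {x₀ : M} {w : Model n × (Model n →L[ℝ] ℝ)} :
    w ∈ (cotChart x₀ : PartialEquiv (CotangentBundle n M) _).target ↔
      w.1 ∈ (extChartAt (𝓡 n) x₀).target := by
  rw [cotChart_target]; simp

lemma isOpen_cotChart_target (x₀ : M) :
    IsOpen (cotChart x₀ : PartialEquiv (CotangentBundle n M) _).target := by
  rw [cotChart_target]
  exact (isOpen_extChartAt_target x₀).prod isOpen_univ

lemma isOpen_cotChart_source (x₀ : M) :
    IsOpen (cotChart x₀ : PartialEquiv (CotangentBundle n M) _).source :=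
  isOpen_extChartAt_source _

/-- The coordinate change of the tangent bundle, from the chart at `x₀` to the chart at `x₁`. -/
abbrev tcc (x₀ x₁ x : M) : Model n →L[ℝ] Model n := tangentCoordChange (𝓡 n) x₀ x₁ x

/-- The fibre over a point is identified with the dual model space through the preferred chart at
that point. Reading a covector in the chart at `x₀` therefore precomposes it with the tangent
coordinate change from `x₀` to that preferred chart. -/
lemma cotChart_apply {x₀ : M} {z : CotangentBundle n M}
    (hz : z.1 ∈ (chartAt (Model n) x₀).source) :
    cotChart x₀ z = (extChartAt (𝓡 n) x₀ z.1,
      (show Model n →L[ℝ] ℝ from z.2).comp (tcc x₀ z.1 z.1)) := by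
  unfold cotChart
  rw [FiberBundle.extChartAt]
  simp only [PartialEquiv.coe_trans, Function.comp_apply, PartialEquiv.prod_coe,
    PartialEquiv.refl_coe, id]
  have h : (trivializationAt (Model n →L[ℝ] ℝ) (Cotangent n M) x₀).toPartialEquiv z =
      (z.1, ContinuousLinearMap.inCoordinates (Model n) (TangentSpace (𝓡 n) : M → Type _) ℝ
        (Bundle.Trivial M ℝ) x₀ z.1 x₀ z.1 z.2) :=
    hom_trivializationAt_apply _ _ _
  rw [h]
  refine Prod.ext rfl ?_
  ext v
  simp only [ContinuousLinearMap.inCoordinates,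
    TangentBundle.symmL_trivializationAt_eq_core hz]
  simp
  rfl

lemma tcc_comp {x₀ x₁ x₂ x : M} (h₀ : x ∈ (chartAt (Model n) x₀).source)
    (h₁ : x ∈ (chartAt (Model n) x₁).source) (h₂ : x ∈ (chartAt (Model n) x₂).source) :
    (tcc x₁ x₂ x).comp (tcc x₀ x₁ x) = (tcc x₀ x₂ x : Model n →L[ℝ] Model n) := by
  ext1 v
  exact tangentCoordChange_comp (by simp only [extChartAt_source]; exact ⟨⟨h₀, h₁⟩, h₂⟩)

lemma tcc_self {x₀ x : M} (h₀ : x ∈ (chartAt (Model n) x₀).source) :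
    tcc x₀ x₀ x = ContinuousLinearMap.id ℝ (Model n) := by
  ext1 v
  exact tangentCoordChange_self (by simpa only [extChartAt_source] using h₀)

lemma cotChart_symm_apply {x₀ : M} {w : Model n × (Model n →L[ℝ] ℝ)}
    (hw : w.1 ∈ (extChartAt (𝓡 n) x₀).target) :
    (cotChart x₀).symm w = (⟨(extChartAt (𝓡 n) x₀).symm w.1,
      w.2.comp (tcc ((extChartAt (𝓡 n) x₀).symm w.1) x₀ ((extChartAt (𝓡 n) x₀).symm w.1))⟩ :
        CotangentBundle n M) := by
  have hs : (extChartAt (𝓡 n) x₀).symm w.1 ∈ (chartAt (Model n) x₀).source := by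
    simpa only [extChartAt_source] using (extChartAt (𝓡 n) x₀).map_target hw
  symm
  rw [PartialEquiv.eq_symm_apply _ (mem_cotChart_source.2 hs) (mem_cotChart_target.2 hw),
    cotChart_apply hs]
  refine Prod.ext ((extChartAt (𝓡 n) x₀).right_inv hw) ?_
  change (w.2.comp _).comp _ = w.2
  rw [ContinuousLinearMap.comp_assoc]
  erw [tcc_comp hs (mem_chart_source _ _) hs, tcc_self hs]
  rw [ContinuousLinearMap.comp_id]

lemma cotChart_symm_proj {x₀ : M} {w : Model n × (Model n →L[ℝ] ℝ)}
    (hw : w.1 ∈ (extChartAt (𝓡 n) x₀).target) :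
    ((cotChart x₀).symm w).1 = (extChartAt (𝓡 n) x₀).symm w.1 := by
  rw [cotChart_symm_apply hw]

lemma cotChart_apply_fst {x₀ : M} {z : CotangentBundle n M}
    (hz : z.1 ∈ (chartAt (Model n) x₀).source) : (cotChart x₀ z).1 = extChartAt (𝓡 n) x₀ z.1 := by
  rw [cotChart_apply hz]

lemma cotChart_self_apply (z : CotangentBundle n M) :
    cotChart z.1 z = (extChartAt (𝓡 n) z.1 z.1, z.2) := by
  rw [cotChart_apply (mem_chart_source _ _), tcc_self (mem_chart_source _ _)]
  rfl

/-- Smoothness of functions on `T*M`. -/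
abbrev Smooth (P : CotangentBundle n M → ℝ) : Prop := ContMDiff (cotModel n) 𝓘(ℝ, ℝ) ∞ P

lemma contMDiffOn_cotChart (x₀ : M) :
    ContMDiffOn (cotModel n) 𝓘(ℝ, Model n × (Model n →L[ℝ] ℝ)) ∞
      (cotChart x₀ : CotangentBundle n M → _) (cotChart x₀).source := by
  have := contMDiffOn_extChartAt (I := cotModel n) (n := ∞) (x := (⟨x₀, 0⟩ : CotangentBundle n M))
  rwa [← extChartAt_source (cotModel n)] at this

lemma contMDiffOn_cotChart_symm (x₀ : M) :
    ContMDiffOn 𝓘(ℝ, Model n × (Model n →L[ℝ] ℝ)) (cotModel n) ∞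
      ((cotChart x₀).symm : _ → CotangentBundle n M) (cotChart x₀).target :=
  contMDiffOn_extChartAt_symm (I := cotModel n) (n := ∞) (⟨x₀, 0⟩ : CotangentBundle n M)

lemma Smooth.contDiffOn_symm {P : CotangentBundle n M → ℝ} (hP : Smooth P) (x₀ : M) :
    ContDiffOn ℝ ∞ (P ∘ (cotChart x₀).symm) (cotChart x₀).target :=
  (hP.comp_contMDiffOn (contMDiffOn_cotChart_symm x₀)).contDiffOn

lemma contMDiffAt_of_contDiffAt_symm {P : CotangentBundle n M → ℝ} {x₀ : M}
    {z : CotangentBundle n M} (hz : z.1 ∈ (chartAt (Model n) x₀).source)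
    (h : ContDiffAt ℝ ∞ (P ∘ (cotChart x₀).symm) (cotChart x₀ z)) :
    ContMDiffAt (cotModel n) 𝓘(ℝ, ℝ) ∞ P z := by
  have hs := mem_cotChart_source.2 hz
  have h1 : ContMDiffAt (cotModel n) 𝓘(ℝ, ℝ) ∞ ((P ∘ (cotChart x₀).symm) ∘ cotChart x₀) z :=
    h.contMDiffAt.comp z ((contMDiffOn_cotChart x₀).contMDiffAt
      ((isOpen_cotChart_source x₀).mem_nhds hs))
  refine h1.congr_of_eventuallyEq ?_
  filter_upwards [(isOpen_cotChart_source x₀).mem_nhds hs] with y hy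
  simp [(cotChart x₀).left_inv hy]

lemma smooth_of_contDiffOn_symm {P : CotangentBundle n M → ℝ}
    (h : ∀ x₀, ContDiffOn ℝ ∞ (P ∘ (cotChart x₀).symm) (cotChart x₀).target) : Smooth P := by
  intro z
  have hz : z ∈ (cotChart z.1).source := mem_cotChart_source.2 (mem_chart_source _ _)
  exact contMDiffAt_of_contDiffAt_symm (mem_chart_source _ _) ((h z.1).contDiffAt
    ((isOpen_cotChart_target _).mem_nhds ((cotChart z.1).map_source hz)))

lemma Smooth.contDiffAt_symm {P : CotangentBundle n M → ℝ} (hP : Smooth P) {x₀ : M}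
    {w : Model n × (Model n →L[ℝ] ℝ)} (hw : w.1 ∈ (extChartAt (𝓡 n) x₀).target) :
    ContDiffAt ℝ ∞ (P ∘ (cotChart x₀).symm) w :=
  (hP.contDiffOn_symm x₀).contDiffAt
    ((isOpen_cotChart_target _).mem_nhds (mem_cotChart_target.2 hw))

lemma Smooth.mdifferentiableAt {P : CotangentBundle n M → ℝ} (hP : Smooth P)
    (z : CotangentBundle n M) : MDifferentiableAt (cotModel n) 𝓘(ℝ, ℝ) P z :=
  hP.mdifferentiable (by simp) z

lemma phaseDeriv_eq_fderiv {P : CotangentBundle n M → ℝ} {z : CotangentBundle n M}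
    (hP : MDifferentiableAt (cotModel n) 𝓘(ℝ, ℝ) P z) :
    phaseDeriv P z = fderiv ℝ (P ∘ (cotChart z.1).symm) (cotChart z.1 z) := by
  refine hP.mfderiv.trans ?_
  simp only [writtenInExtChartAt, extChartAt_eq_cotChart, extChartAt_model_space_eq_id]
  have : Set.range (cotModel n) = Set.univ := (cotModel n).range_eq_univ
  rw [this, fderivWithin_univ]
  rfl

end Coordinates

/-! ### Linear symplectic algebra. -/

section Symplectic

variable {n : ℕ}

/-- The Poisson bracket of two covectors of `ℝⁿ × (ℝⁿ)*`. -/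
def pairing (α β : Model n × (Model n →L[ℝ] ℝ) →L[ℝ] ℝ) : ℝ :=
  ∑ i, (α (0, EuclideanSpace.proj i) * β (EuclideanSpace.single i 1, 0) -
    α (EuclideanSpace.single i 1, 0) * β (0, EuclideanSpace.proj i))

/-- The canonical symplectic form of `ℝⁿ × (ℝⁿ)*`. -/
def symp (w w' : Model n × (Model n →L[ℝ] ℝ)) : ℝ := w.2 w'.1 - w'.2 w.1

/-- The vector of `ℝⁿ × (ℝⁿ)*` dual to the covector `α`. -/
def hamVec (α : Model n × (Model n →L[ℝ] ℝ) →L[ℝ] ℝ) : Model n × (Model n →L[ℝ] ℝ) :=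
  ∑ i, (α (0, EuclideanSpace.proj i) • (EuclideanSpace.single i 1, 0) -
    α (EuclideanSpace.single i 1, 0) • (0, EuclideanSpace.proj i))

lemma pairing_eq_apply_hamVec (α β : Model n × (Model n →L[ℝ] ℝ) →L[ℝ] ℝ) :
    pairing α β = β (hamVec α) := by
  simp only [pairing, hamVec, map_sum, map_sub, map_smul, smul_eq_mul]

lemma model_eq_sum (v : Model n) : v = ∑ i, v i • EuclideanSpace.single i (1 : ℝ) := by
  ext j
  simp [Finset.sum_apply, Pi.single_apply]

lemma dual_eq_sum (p : Model n →L[ℝ] ℝ) :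
    p = ∑ i, p (EuclideanSpace.single i 1) • (EuclideanSpace.proj i : Model n →L[ℝ] ℝ) := by
  ext v
  conv_lhs => rw [model_eq_sum v]
  simp [mul_comm, sum_apply]

/-- Expand `w` in positions and momenta. The identity ties the bracket of covectors to the
symplectic form, so invariance of the form passes to the bracket. -/
lemma symp_hamVec (α : Model n × (Model n →L[ℝ] ℝ) →L[ℝ] ℝ) (w : Model n × (Model n →L[ℝ] ℝ)) :
    symp (hamVec α) w = -α w := by
  obtain ⟨v, p⟩ := w
  have h : ((v, p) : Model n × (Model n →L[ℝ] ℝ)) =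
      ∑ i, (v i • (EuclideanSpace.single i (1 : ℝ), (0 : Model n →L[ℝ] ℝ)) +
        p (EuclideanSpace.single i 1) • ((0 : Model n), (EuclideanSpace.proj i : Model n →L[ℝ] ℝ))) := by
    ext1
    · rw [Prod.fst_sum]; conv_lhs => rw [model_eq_sum v]
      simp
    · rw [Prod.snd_sum]; conv_lhs => rw [dual_eq_sum p]
      simp
  rw [show α (v, p) = _ from congrArg α h]
  rw [map_sum]
  simp only [map_add, map_smul]
  simp only [symp, hamVec, Prod.fst_sum, Prod.snd_sum, map_sum, map_smul, Prod.fst_sub,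
    Prod.snd_sub, Prod.smul_mk, smul_zero, zero_sub, sub_zero, smul_eq_mul, ← Finset.sum_sub_distrib,
    ← Finset.sum_neg_distrib, sum_apply, neg_apply, smul_apply]
  refine Finset.sum_congr rfl fun i _ => ?_
  simp
  ring

lemma symp_left_injective {w w' : Model n × (Model n →L[ℝ] ℝ)}
    (h : ∀ u, symp w u = symp w' u) : w = w' := by
  ext1
  · ext i
    have := h (0, EuclideanSpace.proj i)
    simpa [symp] using this
  · ext v
    have := h (v, 0)
    simpa [symp] using this

/-- A linear map that preserves the symplectic form preserves the bracket of covectors. -/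
lemma pairing_comp {L : Model n × (Model n →L[ℝ] ℝ) →L[ℝ] Model n × (Model n →L[ℝ] ℝ)}
    (hL : ∀ w w', symp (L w) (L w') = symp w w')
    (α β : Model n × (Model n →L[ℝ] ℝ) →L[ℝ] ℝ) :
    pairing (α.comp L) (β.comp L) = pairing α β := by
  have hinj : Function.Injective L := by
    intro w w' h
    refine symp_left_injective fun u => ?_
    rw [← hL, h, hL]
  have hsurj : Function.Surjective L :=
    (LinearMap.injective_iff_surjective (f := L.toLinearMap)).1 hinj
  -- Both sides have the same symplectic product with every `L u`, and these exhaust the space since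
  -- `L` is onto.
  have key : L (hamVec (α.comp L)) = hamVec α := by
    refine symp_left_injective fun u => ?_
    obtain ⟨u, rfl⟩ := hsurj u
    rw [hL, symp_hamVec, symp_hamVec]
    rfl
  rw [pairing_eq_apply_hamVec, pairing_eq_apply_hamVec, ContinuousLinearMap.comp_apply, key]

/-- The coordinate expression `(q, p) ↦ (τ q, (p + η q) ∘ S q)` of a cotangent lift followed by a
translation has a symplectic derivative. -/
lemma hasFDerivAt_lift {τ : Model n → Model n} {S : Model n → Model n →L[ℝ] Model n}
    {η : Model n → Model n →L[ℝ] ℝ} {w : Model n × (Model n →L[ℝ] ℝ)}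
    {τ' : Model n →L[ℝ] Model n} {S' : Model n →L[ℝ] Model n →L[ℝ] Model n}
    {η' : Model n →L[ℝ] Model n →L[ℝ] ℝ} (hτ : HasFDerivAt τ τ' w.1) (hS : HasFDerivAt S S' w.1)
    (hη : HasFDerivAt η η' w.1) (hinv : (S w.1).comp τ' = ContinuousLinearMap.id ℝ _)
    (hS' : ∀ u v, S' u (τ' v) = S' v (τ' u)) (hη' : ∀ u v, η' u v = η' v u) :
    ∃ L : Model n × (Model n →L[ℝ] ℝ) →L[ℝ] Model n × (Model n →L[ℝ] ℝ),
      HasFDerivAt (fun w : Model n × (Model n →L[ℝ] ℝ) => (τ w.1, (w.2 + η w.1).comp (S w.1))) L w ∧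
        ∀ u u', symp (L u) (L u') = symp u u' := by
  have h1 := hτ.comp w hasFDerivAt_fst
  have h2 := (hasFDerivAt_snd (p := w)).add (hη.comp w hasFDerivAt_fst)
  have h3 := h2.clm_comp (hS.comp w hasFDerivAt_fst)
  refine ⟨_, h1.prodMk h3, ?_⟩
  intro u v
  have hv : ∀ v, S w.1 (τ' v) = v := fun v => by
    simpa using congrArg (fun f => f v) hinv
  change ((w.2 + η w.1) (S' u.1 (τ' v.1)) + (u.2 (S w.1 (τ' v.1)) + η' u.1 (S w.1 (τ' v.1)))) -
    ((w.2 + η w.1) (S' v.1 (τ' u.1)) + (v.2 (S w.1 (τ' u.1)) + η' v.1 (S w.1 (τ' u.1)))) =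
      u.2 v.1 - v.2 u.1
  -- The terms `u.2` and `v.2` reproduce the form because `S` inverts `τ'`; the terms in `S'` and
  -- `η'` cancel by symmetry.
  rw [hv, hv, hη' u.1 v.1, hS' u.1 v.1]
  ring

end Symplectic

/-! ### Invariance of the bracket under phase lifts and closed translations. -/

section PhaseLift

variable {n : ℕ} {M : Type*} [TopologicalSpace M] [ChartedSpace (Model n) M]
  [IsManifold (𝓡 n) ∞ M]

lemma hasFDerivAt_tcc {x₀ x₁ x : M} (h₀ : x ∈ (chartAt (Model n) x₀).source)
    (h₁ : x ∈ (chartAt (Model n) x₁).source) :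
    HasFDerivAt (extChartAt (𝓡 n) x₁ ∘ (extChartAt (𝓡 n) x₀).symm) (tcc x₀ x₁ x)
      (extChartAt (𝓡 n) x₀ x) := by
  have h := hasFDerivWithinAt_tangentCoordChange (I := 𝓡 n) (x := x₀) (y := x₁) (z := x)
    (by simp only [extChartAt_source]; exact ⟨h₀, h₁⟩)
  have hr : Set.range (𝓡 n) = Set.univ := (𝓡 n).range_eq_univ
  rwa [hr, hasFDerivWithinAt_univ] at h

/-- The local representative of a map between charts. -/
abbrev localMap (f : M → M) (x₀ x₁ : M) : Model n → Model n :=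
  extChartAt (𝓡 n) x₁ ∘ f ∘ (extChartAt (𝓡 n) x₀).symm

lemma mem_target_of_mem_source {x₀ x : M} (h : x ∈ (chartAt (Model n) x₀).source) :
    extChartAt (𝓡 n) x₀ x ∈ (extChartAt (𝓡 n) x₀).target :=
  (extChartAt (𝓡 n) x₀).map_source (by simpa only [extChartAt_source] using h)

lemma symm_mem_source {x₀ : M} {q : Model n} (h : q ∈ (extChartAt (𝓡 n) x₀).target) :
    (extChartAt (𝓡 n) x₀).symm q ∈ (chartAt (Model n) x₀).source := by
  simpa only [extChartAt_source] using (extChartAt (𝓡 n) x₀).map_target h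

lemma chart_left_inv {x₀ x : M} (h : x ∈ (chartAt (Model n) x₀).source) :
    (extChartAt (𝓡 n) x₀).symm (extChartAt (𝓡 n) x₀ x) = x :=
  (extChartAt (𝓡 n) x₀).left_inv (by simpa only [extChartAt_source] using h)

lemma eventually_symm_mem {x₀ x : M} (h : x ∈ (chartAt (Model n) x₀).source) {U : Set M}
    (hU : U ∈ 𝓝 x) : ∀ᶠ q in 𝓝 (extChartAt (𝓡 n) x₀ x), (extChartAt (𝓡 n) x₀).symm q ∈ U := by
  have := continuousAt_extChartAt_symm' (I := 𝓡 n) (x := x₀) (x' := x)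
    (by simpa only [extChartAt_source] using h)
  refine this.eventually ?_
  rwa [chart_left_inv h]

lemma eventually_mem_target {x₀ x : M} (h : x ∈ (chartAt (Model n) x₀).source) :
    ∀ᶠ q in 𝓝 (extChartAt (𝓡 n) x₀ x), q ∈ (extChartAt (𝓡 n) x₀).target :=
  (isOpen_extChartAt_target x₀).mem_nhds (mem_target_of_mem_source h)

lemma contDiffAt_localMap {f : M → M} {x₀ x₁ x : M} (hf : ContMDiff (𝓡 n) (𝓡 n) ∞ f)
    (h₀ : x ∈ (chartAt (Model n) x₀).source) (h₁ : f x ∈ (chartAt (Model n) x₁).source) :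
    ContDiffAt ℝ ∞ (localMap f x₀ x₁) (extChartAt (𝓡 n) x₀ x) := by
  rw [← contMDiffAt_iff_contDiffAt]
  have hs : ContMDiffAt 𝓘(ℝ, Model n) (𝓡 n) ∞ (extChartAt (𝓡 n) x₀).symm
      (extChartAt (𝓡 n) x₀ x) :=
    (contMDiffOn_extChartAt_symm x₀).contMDiffAt
      ((isOpen_extChartAt_target x₀).mem_nhds (mem_target_of_mem_source h₀))
  refine ContMDiffAt.comp _ ?_ (hf.contMDiffAt.comp _ hs)
  simp only [Function.comp_apply, chart_left_inv h₀]
  exact contMDiffAt_extChartAt' h₁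

/-- `mfderiv` is read in the preferred charts at `x` and `f x`; the chain rule inserts a tangent
coordinate change on each side. -/
lemma fderiv_localMap {f : M → M} {x₀ x₁ x : M} (hf : ContMDiff (𝓡 n) (𝓡 n) ∞ f)
    (h₀ : x ∈ (chartAt (Model n) x₀).source) (h₁ : f x ∈ (chartAt (Model n) x₁).source) :
    fderiv ℝ (localMap f x₀ x₁) (extChartAt (𝓡 n) x₀ x) =
      (tcc (f x) x₁ (f x)).comp ((show Model n →L[ℝ] Model n from mfderiv (𝓡 n) (𝓡 n) f x).comp
        (tcc x₀ x x)) := by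
  have h2 : HasFDerivAt (localMap f x (f x))
      (show Model n →L[ℝ] Model n from mfderiv (𝓡 n) (𝓡 n) f x) (extChartAt (𝓡 n) x x) := by
    have h := (hf.mdifferentiable (by simp) x).hasMFDerivAt.2
    have hr : Set.range (𝓡 n) = Set.univ := (𝓡 n).range_eq_univ
    rw [hr] at h
    exact h.hasFDerivAt_of_univ
  have h1 := hasFDerivAt_tcc h₀ (mem_chart_source _ x)
  have h3 := hasFDerivAt_tcc (mem_chart_source _ (f x)) h₁
  have e1 : (extChartAt (𝓡 n) x ∘ (extChartAt (𝓡 n) x₀).symm) (extChartAt (𝓡 n) x₀ x) =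
      extChartAt (𝓡 n) x x := by simp only [Function.comp_apply, chart_left_inv h₀]
  rw [← e1] at h2
  have h21 := h2.comp _ h1
  have e2 : (localMap f x (f x) ∘ extChartAt (𝓡 n) x ∘ (extChartAt (𝓡 n) x₀).symm)
      (extChartAt (𝓡 n) x₀ x) = extChartAt (𝓡 n) (f x) (f x) := by
    simp only [Function.comp_apply, chart_left_inv h₀, chart_left_inv (mem_chart_source _ x)]
  rw [← e2] at h3
  refine ((h3.comp _ h21).congr_of_eventuallyEq ?_).fderiv
  have hU : (chartAt (Model n) x).source ∩ f ⁻¹' (chartAt (Model n) (f x)).source ∈ 𝓝 x :=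
    Filter.inter_mem ((chartAt (Model n) x).open_source.mem_nhds (mem_chart_source _ x))
      (hf.continuous.continuousAt.preimage_mem_nhds
        ((chartAt (Model n) (f x)).open_source.mem_nhds (mem_chart_source _ _)))
  filter_upwards [eventually_symm_mem h₀ hU] with q hq
  simp only [Function.comp_apply, chart_left_inv hq.1, chart_left_inv hq.2]

/-- The `1`-form `η` in the chart at `x₀`. -/
def formRep (η : (x : M) → Cotangent n M x) (x₀ : M) (q : Model n) : Model n →L[ℝ] ℝ :=
  (show Model n →L[ℝ] ℝ from η ((extChartAt (𝓡 n) x₀).symm q)).comp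
    (tcc x₀ ((extChartAt (𝓡 n) x₀).symm q) ((extChartAt (𝓡 n) x₀).symm q))

lemma formRep_eq {η : (x : M) → Cotangent n M x} {x₀ : M} {q : Model n}
    (hq : q ∈ (extChartAt (𝓡 n) x₀).target) :
    formRep η x₀ q = (cotChart x₀ (⟨(extChartAt (𝓡 n) x₀).symm q,
      η ((extChartAt (𝓡 n) x₀).symm q)⟩ : CotangentBundle n M)).2 := by
  rw [cotChart_apply (symm_mem_source hq)]
  rfl

/-- The derivative of the inverse chart is the tangent coordinate change. So the representative that
defines closedness is the momentum of the section in `cotChart`. -/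
lemma localForm_eq (η : OneForm n M) {x₀ : M} {q : Model n}
    (hq : q ∈ (extChartAt (𝓡 n) x₀).target) : localForm η x₀ q = formRep η x₀ q := by
  unfold localForm formRep
  have h := TangentBundle.symmL_trivializationAt (I := 𝓡 n) (symm_mem_source hq)
  rw [TangentBundle.symmL_trivializationAt_eq_core (symm_mem_source hq)] at h
  have hr : Set.range (𝓡 n) = Set.univ := (𝓡 n).range_eq_univ
  rw [hr, mfderivWithin_univ, (extChartAt (𝓡 n) x₀).right_inv hq] at h
  rw [← h]
  rfl

lemma contDiffOn_formRep (η : OneForm n M) (x₀ : M) :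
    ContDiffOn ℝ ∞ (formRep η x₀) (extChartAt (𝓡 n) x₀).target := by
  have h1 : ContMDiffOn 𝓘(ℝ, Model n) (𝓡 n) ∞ (extChartAt (𝓡 n) x₀).symm
    (extChartAt (𝓡 n) x₀).target := contMDiffOn_extChartAt_symm x₀
  have h2 := η.contMDiff.comp_contMDiffOn h1
  have h3 := (contMDiffOn_cotChart x₀).comp h2 fun q hq => mem_cotChart_source.2 (symm_mem_source hq)
  have h4 := h3.contDiffOn.snd
  exact h4.congr fun q hq => formRep_eq hq

lemma IsClosedForm.symm_formRep {η : OneForm n M} (hη : IsClosedForm η) {x₀ : M} {q : Model n}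
    (hq : q ∈ (extChartAt (𝓡 n) x₀).target) (u v : Model n) :
    fderiv ℝ (formRep η x₀) q u v = fderiv ℝ (formRep η x₀) q v u := by
  have : formRep η x₀ =ᶠ[𝓝 q] localForm η x₀ := by
    filter_upwards [(isOpen_extChartAt_target x₀).mem_nhds hq] with y hy
    exact (localForm_eq η hy).symm
  rw [this.fderiv_eq]
  exact hη x₀ q hq u v

/-- The map `φ* ∘ Exp(ηᵛ)`. -/
def liftMap (φ : M ≃ₘ^∞⟮𝓡 n, 𝓡 n⟯ M) (η : (x : M) → Cotangent n M x) :
    CotangentBundle n M → CotangentBundle n M :=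
  phaseLift φ ∘ translation η

lemma liftMap_proj (φ : M ≃ₘ^∞⟮𝓡 n, 𝓡 n⟯ M) (η : (x : M) → Cotangent n M x)
    (z : CotangentBundle n M) : (liftMap φ η z).1 = φ.symm z.1 := rfl

/-- The coordinate expression of `φ* ∘ Exp(ηᵛ)`. -/
lemma cotChart_liftMap (φ : M ≃ₘ^∞⟮𝓡 n, 𝓡 n⟯ M) (η : (x : M) → Cotangent n M x) {x₀ x₁ : M}
    {w : Model n × (Model n →L[ℝ] ℝ)} (hw : w.1 ∈ (extChartAt (𝓡 n) x₀).target)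
    (hw' : φ.symm ((extChartAt (𝓡 n) x₀).symm w.1) ∈ (chartAt (Model n) x₁).source) :
    cotChart x₁ (liftMap φ η ((cotChart x₀).symm w)) =
      (localMap φ.symm x₀ x₁ w.1,
        (w.2 + formRep η x₀ w.1).comp
          (fderiv ℝ (localMap φ x₁ x₀) (localMap φ.symm x₀ x₁ w.1))) := by
  have hs := symm_mem_source hw
  set y := (extChartAt (𝓡 n) x₀).symm w.1 with hy
  have hφ : φ (φ.symm y) = y := φ.apply_symm_apply y
  have e : localMap φ.symm x₀ x₁ w.1 = extChartAt (𝓡 n) x₁ (φ.symm y) := rfl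
  rw [e, fderiv_localMap φ.contMDiff hw' (by rwa [hφ]), cotChart_symm_apply hw, cotChart_apply hw']
  refine Prod.ext rfl ?_
  rw [← hy]
  -- `k1` moves the base point from `φ (φ.symm y)` to `y`; `k2` cancels the change of frame
  -- contained in `formRep` against the one in the derivative of `φ`.
  have k1 : ∀ u : Model n, tcc (φ (φ.symm y)) x₀ (φ (φ.symm y)) u = tcc y x₀ y u := fun u => by
    rw [hφ]
  have k2 : ∀ u : Model n, tcc x₀ y y (tcc y x₀ y u) = u := fun u => by
    have h := tcc_comp (mem_chart_source (Model n) y) hs (mem_chart_source (Model n) y)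
    rw [tcc_self (mem_chart_source (Model n) y)] at h
    exact congrArg (fun f : Model n →L[ℝ] Model n => f u) h
  ext v
  obtain ⟨u, hu⟩ : ∃ u : Model n, u = (show Model n →L[ℝ] Model n from
    mfderiv (𝓡 n) (𝓡 n) φ (φ.symm y)) (tcc x₁ (φ.symm y) (φ.symm y) v) := ⟨_, rfl⟩
  obtain ⟨a, ha⟩ : ∃ a : Model n →L[ℝ] ℝ, a = η y := ⟨_, rfl⟩
  trans w.2 (tcc y x₀ y u) + a u
  · rw [hu, ha]; rfl
  trans w.2 (tcc (φ (φ.symm y)) x₀ (φ (φ.symm y)) u) +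
    a (tcc x₀ y y (tcc (φ (φ.symm y)) x₀ (φ (φ.symm y)) u))
  · rw [k1, k2]
  · rw [hu, ha]; rfl

lemma mem_source_of_liftMap {φ : M ≃ₘ^∞⟮𝓡 n, 𝓡 n⟯ M} {x₀ x₁ : M} {w : Model n × (Model n →L[ℝ] ℝ)}
    (hw : w.1 ∈ (extChartAt (𝓡 n) x₀).target)
    (hw' : φ.symm ((extChartAt (𝓡 n) x₀).symm w.1) ∈ (chartAt (Model n) x₁).source) :
    ∀ᶠ w' in 𝓝 w, w'.1 ∈ (extChartAt (𝓡 n) x₀).target ∧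
      φ.symm ((extChartAt (𝓡 n) x₀).symm w'.1) ∈ (chartAt (Model n) x₁).source := by
  have hs := symm_mem_source hw
  have h1 := eventually_symm_mem hs (φ.symm.continuous.continuousAt.preimage_mem_nhds
    ((chartAt (Model n) x₁).open_source.mem_nhds hw'))
  have h2 := eventually_mem_target hs
  rw [(extChartAt (𝓡 n) x₀).right_inv hw] at h1 h2
  exact continuousAt_fst.eventually (h2.and h1)

lemma contDiffAt_coord_aux (φ : M ≃ₘ^∞⟮𝓡 n, 𝓡 n⟯ M) {x₀ x₁ : M} {q : Model n}
    (hq : q ∈ (extChartAt (𝓡 n) x₀).target)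
    (hq' : φ.symm ((extChartAt (𝓡 n) x₀).symm q) ∈ (chartAt (Model n) x₁).source) :
    ContDiffAt ℝ ∞ (localMap φ.symm x₀ x₁) q ∧
      ContDiffAt ℝ ∞ (localMap φ x₁ x₀) (localMap φ.symm x₀ x₁ q) := by
  have hs := symm_mem_source hq
  constructor
  · have := contDiffAt_localMap φ.symm.contMDiff hs hq'
    rwa [(extChartAt (𝓡 n) x₀).right_inv hq] at this
  · exact contDiffAt_localMap φ.contMDiff hq' (by
      simpa only [Function.comp_apply, φ.apply_symm_apply] using hs)

lemma contDiffAt_liftMap (φ : M ≃ₘ^∞⟮𝓡 n, 𝓡 n⟯ M) (η : OneForm n M) {x₀ x₁ : M}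
    {w : Model n × (Model n →L[ℝ] ℝ)} (hw : w.1 ∈ (extChartAt (𝓡 n) x₀).target)
    (hw' : φ.symm ((extChartAt (𝓡 n) x₀).symm w.1) ∈ (chartAt (Model n) x₁).source) :
    ContDiffAt ℝ ∞ (cotChart x₁ ∘ liftMap φ η ∘ (cotChart x₀).symm) w := by
  obtain ⟨hτ, hσ⟩ := contDiffAt_coord_aux φ hw hw'
  have hη : ContDiffAt ℝ ∞ (formRep η x₀) w.1 :=
    (contDiffOn_formRep η x₀).contDiffAt ((isOpen_extChartAt_target x₀).mem_nhds hw)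
  have hdσ : ContDiffAt ℝ ∞ (fderiv ℝ (localMap φ x₁ x₀)) (localMap φ.symm x₀ x₁ w.1) :=
    hσ.fderiv_right (by simp)
  have h : ContDiffAt ℝ ∞ (fun w : Model n × (Model n →L[ℝ] ℝ) =>
      (localMap φ.symm x₀ x₁ w.1, (w.2 + formRep η x₀ w.1).comp
          (fderiv ℝ (localMap φ x₁ x₀) (localMap φ.symm x₀ x₁ w.1)))) w :=
    (hτ.comp w contDiffAt_fst).prodMk
      ((contDiffAt_snd.add (hη.comp w contDiffAt_fst)).clm_comp
        (hdσ.comp w (hτ.comp w contDiffAt_fst)))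
  refine h.congr_of_eventuallyEq ?_
  filter_upwards [mem_source_of_liftMap hw hw'] with w' hw'
  exact cotChart_liftMap φ η hw'.1 hw'.2

/-- The coordinate expression has the shape treated in `hasFDerivAt_lift`: the derivatives of `φ`
and its inverse are mutually inverse by the chain rule, the second derivative of `φ` is symmetric,
and `dη = 0` is the remaining symmetry. -/
lemma symp_fderiv_liftMap (φ : M ≃ₘ^∞⟮𝓡 n, 𝓡 n⟯ M) {η : OneForm n M} (hcl : IsClosedForm η)
    {x₀ x₁ : M} {w : Model n × (Model n →L[ℝ] ℝ)} (hw : w.1 ∈ (extChartAt (𝓡 n) x₀).target)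
    (hw' : φ.symm ((extChartAt (𝓡 n) x₀).symm w.1) ∈ (chartAt (Model n) x₁).source)
    (u u' : Model n × (Model n →L[ℝ] ℝ)) :
    symp (fderiv ℝ (cotChart x₁ ∘ liftMap φ η ∘ (cotChart x₀).symm) w u)
      (fderiv ℝ (cotChart x₁ ∘ liftMap φ η ∘ (cotChart x₀).symm) w u') = symp u u' := by
  obtain ⟨hτ, hσ⟩ := contDiffAt_coord_aux φ hw hw'
  have hη : ContDiffAt ℝ ∞ (formRep η x₀) w.1 :=
    (contDiffOn_formRep η x₀).contDiffAt ((isOpen_extChartAt_target x₀).mem_nhds hw)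
  have hdσ : ContDiffAt ℝ ∞ (fderiv ℝ (localMap φ x₁ x₀)) (localMap φ.symm x₀ x₁ w.1) :=
    hσ.fderiv_right (by simp)
  have hτ' := (hτ.differentiableAt (by simp)).hasFDerivAt
  have hσ' := (hσ.differentiableAt (by simp)).hasFDerivAt
  have hS := (hdσ.differentiableAt (by simp)).hasFDerivAt.comp w.1 hτ'
  have hinv : (fderiv ℝ (localMap φ x₁ x₀) (localMap φ.symm x₀ x₁ w.1)).comp
      (fderiv ℝ (localMap φ.symm x₀ x₁) w.1) = ContinuousLinearMap.id ℝ _ := by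
    refine (hσ'.comp w.1 hτ').unique ((hasFDerivAt_id w.1).congr_of_eventuallyEq ?_)
    have h := mem_source_of_liftMap (w := (w.1, 0)) hw hw'
    have hc : ContinuousAt (fun q : Model n => (q, (0 : Model n →L[ℝ] ℝ))) w.1 := by fun_prop
    filter_upwards [hc.eventually h] with q hq
    simp only [Function.comp_apply, chart_left_inv hq.2, id]
    rw [φ.apply_symm_apply, (extChartAt (𝓡 n) x₀).right_inv hq.1]
  obtain ⟨L, hL, hsymp⟩ := hasFDerivAt_lift hτ' hS (hη.differentiableAt (by simp)).hasFDerivAt hinv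
    (fun u v => by
      have hsym : IsSymmSndFDerivAt ℝ (localMap φ x₁ x₀) (localMap φ.symm x₀ x₁ w.1) :=
        hσ.isSymmSndFDerivAt (by simpa using ENat.LEInfty.out)
      exact hsym _ _)
    (hcl.symm_formRep hw)
  have h : HasFDerivAt (cotChart x₁ ∘ liftMap φ η ∘ (cotChart x₀).symm) L w := by
    refine hL.congr_of_eventuallyEq ?_
    filter_upwards [mem_source_of_liftMap hw hw'] with w' hw'
    exact cotChart_liftMap φ η hw'.1 hw'.2
  rw [h.fderiv]
  exact hsymp u u'

/-- `φ* ∘ Exp(ηᵛ)` is smooth. -/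
lemma Smooth.comp_liftMap {P : CotangentBundle n M → ℝ} (hP : Smooth P)
    (φ : M ≃ₘ^∞⟮𝓡 n, 𝓡 n⟯ M) (η : OneForm n M) : Smooth (P ∘ liftMap φ η) := by
  intro z
  have hs := mem_chart_source (Model n) z.1
  refine contMDiffAt_of_contDiffAt_symm hs ?_
  have hzt := mem_target_of_mem_source hs
  have hfst := cotChart_apply_fst hs
  have hsym : (extChartAt (𝓡 n) z.1).symm (cotChart z.1 z).1 = z.1 := by
    rw [hfst, chart_left_inv hs]
  have hw : (cotChart z.1 z).1 ∈ (extChartAt (𝓡 n) z.1).target := by rwa [hfst]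
  have hw' : φ.symm ((extChartAt (𝓡 n) z.1).symm (cotChart z.1 z).1) ∈
      (chartAt (Model n) (φ.symm z.1)).source := by
    rw [hsym]; exact mem_chart_source _ _
  have h1 := contDiffAt_liftMap φ η hw hw'
  have h2 : ContDiffAt ℝ ∞ (P ∘ (cotChart (φ.symm z.1)).symm)
      ((cotChart (φ.symm z.1) ∘ liftMap φ η ∘ (cotChart z.1).symm) (cotChart z.1 z)) := by
    refine hP.contDiffAt_symm ?_
    simp only [Function.comp_apply]
    rw [cotChart_liftMap φ η hw hw']
    exact mem_target_of_mem_source hw'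
  refine (h2.comp _ h1).congr_of_eventuallyEq ?_
  filter_upwards [mem_source_of_liftMap hw hw'] with w' hw'
  simp only [Function.comp_apply]
  rw [(cotChart (φ.symm z.1)).left_inv]
  rw [mem_cotChart_source, liftMap_proj, cotChart_symm_proj hw'.1]
  exact hw'.2

/-- The bracket of the local representatives is transformed by `φ* ∘ Exp(ηᵛ)`. -/
lemma pairing_liftMap {P Q : CotangentBundle n M → ℝ} (hP : Smooth P) (hQ : Smooth Q)
    (φ : M ≃ₘ^∞⟮𝓡 n, 𝓡 n⟯ M) {η : OneForm n M} (hcl : IsClosedForm η)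
    {x₀ x₁ : M} {w : Model n × (Model n →L[ℝ] ℝ)} (hw : w.1 ∈ (extChartAt (𝓡 n) x₀).target)
    (hw' : φ.symm ((extChartAt (𝓡 n) x₀).symm w.1) ∈ (chartAt (Model n) x₁).source) :
    pairing (fderiv ℝ ((P ∘ liftMap φ η) ∘ (cotChart x₀).symm) w)
      (fderiv ℝ ((Q ∘ liftMap φ η) ∘ (cotChart x₀).symm) w) =
    pairing (fderiv ℝ (P ∘ (cotChart x₁).symm) (cotChart x₁ (liftMap φ η ((cotChart x₀).symm w))))
      (fderiv ℝ (Q ∘ (cotChart x₁).symm) (cotChart x₁ (liftMap φ η ((cotChart x₀).symm w)))) := by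
  have key : ∀ R : CotangentBundle n M → ℝ, Smooth R →
      fderiv ℝ ((R ∘ liftMap φ η) ∘ (cotChart x₀).symm) w =
      (fderiv ℝ (R ∘ (cotChart x₁).symm) (cotChart x₁ (liftMap φ η ((cotChart x₀).symm w)))).comp
        (fderiv ℝ (cotChart x₁ ∘ liftMap φ η ∘ (cotChart x₀).symm) w) := by
    intro R hR
    have h1 := ((contDiffAt_liftMap φ η hw hw').differentiableAt (by simp)).hasFDerivAt
    have h2 : ContDiffAt ℝ ∞ (R ∘ (cotChart x₁).symm)
        ((cotChart x₁ ∘ liftMap φ η ∘ (cotChart x₀).symm) w) := by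
      refine hR.contDiffAt_symm ?_
      simp only [Function.comp_apply]
      rw [cotChart_liftMap φ η hw hw']
      exact mem_target_of_mem_source hw'
    have h3 := (h2.differentiableAt (by simp)).hasFDerivAt.comp w h1
    refine (h3.congr_of_eventuallyEq ?_).fderiv
    filter_upwards [mem_source_of_liftMap hw hw'] with w' hw'
    simp only [Function.comp_apply]
    rw [(cotChart x₁).left_inv]
    rw [mem_cotChart_source, liftMap_proj, cotChart_symm_proj hw'.1]
    exact hw'.2
  rw [key P hP, key Q hQ, pairing_comp (symp_fderiv_liftMap φ hcl hw hw')]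

lemma poisson_eq_pairing {P Q : CotangentBundle n M → ℝ} (hP : Smooth P) (hQ : Smooth Q)
    (z : CotangentBundle n M) :
    poisson P Q z = pairing (fderiv ℝ (P ∘ (cotChart z.1).symm) (cotChart z.1 z))
      (fderiv ℝ (Q ∘ (cotChart z.1).symm) (cotChart z.1 z)) := by
  rw [← phaseDeriv_eq_fderiv (hP.mdifferentiableAt z), ← phaseDeriv_eq_fderiv (hQ.mdifferentiableAt z)]
  rfl

lemma isClosedForm_zero : IsClosedForm (0 : OneForm n M) := by
  intro x₀ y hy u v
  have : localForm (0 : OneForm n M) x₀ = 0 := by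
    ext y v
    rfl
  rw [this]
  simp

lemma liftMap_refl_zero : liftMap (Diffeomorph.refl (𝓡 n) M ∞) ((0 : OneForm n M) : (x : M) → _) =
    id := by
  funext z
  obtain ⟨x, α⟩ := z
  have h : (mfderiv (𝓡 n) (𝓡 n) (Diffeomorph.refl (𝓡 n) M ∞) x) =
      ContinuousLinearMap.id ℝ (TangentSpace (𝓡 n) x) := mfderiv_id
  have h2 : (show Model n →L[ℝ] ℝ from α + (0 : Cotangent n M x)).comp
      (show Model n →L[ℝ] Model n from
        mfderiv (𝓡 n) (𝓡 n) (Diffeomorph.refl (𝓡 n) M ∞) x) = α := by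
    rw [add_zero]
    exact (congrArg (fun f : Model n →L[ℝ] Model n =>
      (show Model n →L[ℝ] ℝ from α).comp f) h).trans (ContinuousLinearMap.comp_id _)
  exact congrArg (fun a : Cotangent n M x => (⟨x, a⟩ : CotangentBundle n M)) h2

/-- The Poisson bracket can be computed in every chart. -/
lemma poisson_eq_pairing_of_mem {P Q : CotangentBundle n M → ℝ} (hP : Smooth P) (hQ : Smooth Q)
    {x₀ : M} {z : CotangentBundle n M} (hz : z.1 ∈ (chartAt (Model n) x₀).source) :
    poisson P Q z = pairing (fderiv ℝ (P ∘ (cotChart x₀).symm) (cotChart x₀ z))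
      (fderiv ℝ (Q ∘ (cotChart x₀).symm) (cotChart x₀ z)) := by
  have hfst := cotChart_apply_fst hz
  -- A change of chart is the identity of `T*M` read in two charts, that is, the case `φ = id`, `η =
  -- 0` of invariance.
  have h := pairing_liftMap hP hQ (Diffeomorph.refl (𝓡 n) M ∞) isClosedForm_zero (x₀ := x₀)
    (x₁ := z.1) (w := cotChart x₀ z) (by rw [hfst]; exact mem_target_of_mem_source hz) (by
      rw [hfst, chart_left_inv hz]
      exact mem_chart_source _ _)
  rw [liftMap_refl_zero, (cotChart x₀).left_inv (mem_cotChart_source.2 hz)] at h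
  rw [poisson_eq_pairing hP hQ]
  exact h.symm

/-- `φ* ∘ Exp(ηᵛ)` preserves the Poisson bracket. -/
lemma poisson_comp_liftMap {P Q : CotangentBundle n M → ℝ} (hP : Smooth P) (hQ : Smooth Q)
    (φ : M ≃ₘ^∞⟮𝓡 n, 𝓡 n⟯ M) {η : OneForm n M} (hcl : IsClosedForm η) :
    poisson (P ∘ liftMap φ η) (Q ∘ liftMap φ η) = poisson P Q ∘ liftMap φ η := by
  funext z
  have hs := mem_chart_source (Model n) z.1
  have hfst := cotChart_apply_fst hs
  have h := pairing_liftMap hP hQ φ hcl (x₀ := z.1) (x₁ := φ.symm z.1) (w := cotChart z.1 z)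
    (by rw [hfst]; exact mem_target_of_mem_source hs) (by
      rw [hfst, chart_left_inv hs]
      exact mem_chart_source _ _)
  rw [(cotChart z.1).left_inv (mem_cotChart_source.2 hs)] at h
  rw [poisson_eq_pairing (hP.comp_liftMap φ η) (hQ.comp_liftMap φ η), h, Function.comp_apply,
    poisson_eq_pairing hP hQ, liftMap_proj]

end PhaseLift

/-! ### Homogeneous functions and polynomials along rays. -/

section Homogeneous

/-- A smooth homogeneous function of degree `i` on a vector space is a polynomial. -/
lemma iteratedFDeriv_zero_of_homogeneous {V : Type*} [NormedAddCommGroup V] [NormedSpace ℝ V]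
    {g : V → ℝ} (hg : ContDiff ℝ ∞ g) {i : ℕ} (h : ∀ (t : ℝ) (v : V), g (t • v) = t ^ i * g v)
    (v : V) : iteratedFDeriv ℝ i g 0 (fun _ => v) = i.factorial * g v := by
  -- Along the line through `v` the function is `t ^ i * g v`, whose `i`-th derivative at `0` is `i!
  -- * g v`; the chain rule identifies it with the value of the `i`-th derivative form on the
  -- diagonal.
  have h1 := (ContinuousLinearMap.toSpanSingleton ℝ v).iteratedFDeriv_comp_right (hg.of_le
    (m := (i : ℕ∞)) (by exact_mod_cast le_top)) 0 (i := i) le_rfl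
  have h2 : iteratedDeriv i (g ∘ ContinuousLinearMap.toSpanSingleton ℝ v) 0 =
      iteratedFDeriv ℝ i g 0 (fun _ => v) := by
    rw [iteratedDeriv_eq_iteratedFDeriv, h1]
    simp
  rw [← h2]
  have h3 : g ∘ ContinuousLinearMap.toSpanSingleton ℝ v = fun t : ℝ => t ^ i * g v := by
    funext t
    simp [h]
  rw [h3]
  simp [mul_comm, Nat.descFactorial_self]

/-- A multilinear form restricted to an affine line is a polynomial function. -/
lemma exists_polynomial_multilinear {V : Type*} [AddCommGroup V] [Module ℝ V] {i : ℕ}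
    (c : MultilinearMap ℝ (fun _ : Fin i => V) ℝ) (a b : V) :
    ∃ p : Polynomial ℝ, p.natDegree ≤ i ∧ ∀ t : ℝ, c (fun _ => t • a + b) = p.eval t := by
  classical
  refine ⟨∑ s : Finset (Fin i), Polynomial.C (c (s.piecewise (fun _ => a) (fun _ => b))) *
    Polynomial.X ^ s.card, ?_, fun t => ?_⟩
  · refine Polynomial.natDegree_sum_le_of_forall_le _ _ fun s _ => ?_
    refine (Polynomial.natDegree_C_mul_X_pow_le _ _).trans ?_
    simpa using Finset.card_le_univ s
  · have h := c.map_add_univ (fun _ => t • a) (fun _ => b)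
    rw [show (fun _ : Fin i => t • a + b) = (fun _ => t • a) + fun _ => b from rfl, h,
      Polynomial.eval_finsetSum]
    refine Finset.sum_congr rfl fun s _ => ?_
    have h2 := c.map_piecewise_smul (fun _ => t) (s.piecewise (fun _ => a) (fun _ => b)) s
    have h3 : (s.piecewise (fun j => t • (s.piecewise (fun _ => a) (fun _ => b) : Fin i → V) j)
        (s.piecewise (fun _ => a) (fun _ => b)) : Fin i → V) =
        s.piecewise (fun _ => t • a) (fun _ => b) := by
      funext j
      by_cases hj : j ∈ s <;> simp [hj]
    rw [h3] at h2
    rw [h2]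
    simp only [Finset.prod_const, smul_eq_mul, Polynomial.eval_mul, Polynomial.eval_C,
      Polynomial.eval_pow, Polynomial.eval_X]
    ring

variable {n : ℕ} {M : Type*} [TopologicalSpace M] [ChartedSpace (Model n) M]
  [IsManifold (𝓡 n) ∞ M]

/-- Homogeneity of degree `i` along the fibres of `T*M`. -/
def Homog (i : ℕ) (P : CotangentBundle n M → ℝ) : Prop :=
  ∀ (z : CotangentBundle n M) (t : ℝ), P ⟨z.1, t • z.2⟩ = t ^ i * P z

lemma contDiff_fibre {P : CotangentBundle n M → ℝ} (hP : Smooth P) (x : M) :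
    ContDiff ℝ ∞ (fun α : Model n →L[ℝ] ℝ => P (⟨x, α⟩ : CotangentBundle n M)) := by
  have hx := mem_chart_source (Model n) x
  rw [contDiff_iff_contDiffAt]
  intro α
  have h1 : ContDiffAt ℝ ∞ (P ∘ (cotChart x).symm) (extChartAt (𝓡 n) x x, α) :=
    hP.contDiffAt_symm (mem_target_of_mem_source hx)
  have h2 := h1.comp α (contDiffAt_const.prodMk contDiffAt_id)
  refine h2.congr_of_eventuallyEq (Filter.Eventually.of_forall fun β => ?_)
  have h3 := cotChart_self_apply (⟨x, β⟩ : CotangentBundle n M)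
  have h4 := (cotChart x).left_inv (x := (⟨x, β⟩ : CotangentBundle n M)) (mem_cotChart_source.2 hx)
  exact congrArg P (h4.symm.trans (congrArg (cotChart x).symm h3))

/-- A smooth function with `P (t α) = t ^ i P α` coincides on each fibre with its Taylor term of
order `i` at the zero covector. Scaling thus replaces the multilinear forms. -/
lemma mem_homogeneousPart_iff {i : ℕ} {P : CotangentBundle n M → ℝ} :
    P ∈ homogeneousPart n M i ↔ Smooth P ∧ Homog i P := by
  constructor
  · rintro ⟨hs, hP⟩
    refine ⟨hs, fun z t => ?_⟩
    obtain ⟨x, α⟩ := z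
    obtain ⟨c, hc⟩ := hP x
    have h := c.map_smul_univ (fun _ : Fin i => t) (fun _ => α)
    simp only [Finset.prod_const, Finset.card_univ, Fintype.card_fin] at h
    rw [hc, hc, h, smul_eq_mul]
  · rintro ⟨hs, hP⟩
    refine ⟨hs, fun x => ?_⟩
    have h := iteratedFDeriv_zero_of_homogeneous (contDiff_fibre hs x) (i := i)
      fun t v => hP ⟨x, v⟩ t
    refine ⟨(i.factorial : ℝ)⁻¹ • (iteratedFDeriv ℝ i (fun α : Model n →L[ℝ] ℝ =>
      P (⟨x, α⟩ : CotangentBundle n M)) 0).toMultilinearMap, fun α => ?_⟩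
    have h' := h α
    change _ = (i.factorial : ℝ)⁻¹ * _
    have h0 : (i.factorial : ℝ) ≠ 0 := by exact_mod_cast i.factorial_ne_zero
    exact (eq_inv_mul_iff_mul_eq₀ h0).2 h'.symm

lemma smooth_smul_fibre {P : CotangentBundle n M → ℝ} (hP : Smooth P) (t : ℝ) :
    Smooth (fun z : CotangentBundle n M => P ⟨z.1, t • z.2⟩) := by
  refine smooth_of_contDiffOn_symm fun x₀ => ?_
  have h1 : ContDiffOn ℝ ∞ (fun w : Model n × (Model n →L[ℝ] ℝ) => (w.1, t • w.2))
      (cotChart x₀ : PartialEquiv (CotangentBundle n M) _).target :=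
    ContDiff.contDiffOn (by fun_prop)
  refine ((hP.contDiffOn_symm x₀).comp h1 fun w hw => ?_).congr fun w hw => ?_
  · exact mem_cotChart_target.2 (mem_cotChart_target.1 hw)
  · rw [mem_cotChart_target] at hw
    simp only [Function.comp_apply]
    rw [cotChart_symm_apply hw, cotChart_symm_apply (w := (w.1, t • w.2)) hw]
    rfl

/-- `P` is a polynomial of degree at most `d` along every ray of every fibre. -/
def RayPoly (d : ℕ) (P : CotangentBundle n M → ℝ) : Prop :=
  ∀ z : CotangentBundle n M, ∃ p : Polynomial ℝ, p.natDegree ≤ d ∧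
    ∀ t : ℝ, P ⟨z.1, t • z.2⟩ = p.eval t

lemma RayPoly.mono {d d' : ℕ} (h : d ≤ d') {P : CotangentBundle n M → ℝ} (hP : RayPoly d P) :
    RayPoly d' P := fun z => by
  obtain ⟨p, hp, h'⟩ := hP z
  exact ⟨p, hp.trans h, h'⟩

lemma RayPoly.add {d : ℕ} {P Q : CotangentBundle n M → ℝ} (hP : RayPoly d P) (hQ : RayPoly d Q) :
    RayPoly d (P + Q) := fun z => by
  obtain ⟨p, hp, h⟩ := hP z
  obtain ⟨q, hq, h'⟩ := hQ z
  exact ⟨p + q, Polynomial.natDegree_add_le_of_degree_le hp hq, fun t => by simp [h, h']⟩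

lemma RayPoly.mul {d d' : ℕ} {P Q : CotangentBundle n M → ℝ} (hP : RayPoly d P)
    (hQ : RayPoly d' Q) : RayPoly (d + d') (P * Q) := fun z => by
  obtain ⟨p, hp, h⟩ := hP z
  obtain ⟨q, hq, h'⟩ := hQ z
  exact ⟨p * q, Polynomial.natDegree_mul_le_of_le hp hq, fun t => by simp [h, h']⟩

lemma Homog.rayPoly {i : ℕ} {P : CotangentBundle n M → ℝ} (hP : Homog i P) : RayPoly i P :=
  fun z => ⟨Polynomial.C (P z) * Polynomial.X ^ i, Polynomial.natDegree_C_mul_X_pow_le _ _,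
    fun t => by
      rw [hP z t, Polynomial.eval_mul, Polynomial.eval_C, Polynomial.eval_pow, Polynomial.eval_X,
        mul_comm]⟩

variable (n M) in
/-- The smooth functions on `T*M` that are polynomial along the rays, as an algebra. -/
def rayAlg : Subalgebra ℝ (CotangentBundle n M → ℝ) where
  carrier := {P | Smooth P ∧ ∃ d, RayPoly d P}
  mul_mem' := by
    rintro P Q ⟨hP, d, hd⟩ ⟨hQ, d', hd'⟩
    exact ⟨hP.mul hQ, _, hd.mul hd'⟩
  add_mem' := by
    rintro P Q ⟨hP, d, hd⟩ ⟨hQ, d', hd'⟩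
    exact ⟨hP.add hQ, max d d', (hd.mono (le_max_left _ _)).add (hd'.mono (le_max_right _ _))⟩
  algebraMap_mem' r := ⟨contMDiff_const, 0, fun _ => ⟨Polynomial.C r, by simp, fun t => by simp⟩⟩

/-- A smooth function that is polynomial along the rays is a sum of homogeneous ones. -/
lemma RayPoly.exists_sum {d : ℕ} {P : CotangentBundle n M → ℝ} (hs : Smooth P)
    (hP : RayPoly d P) : ∃ H : Fin (d + 1) → CotangentBundle n M → ℝ,
      (∀ j : Fin (d + 1), H j ∈ homogeneousPart n M (j : ℕ)) ∧ P = ∑ j, H j := by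
  choose p hp hpe using hP
  -- With the nodes `0, …, d`, the homogeneous components are recovered from the dilates `P (k α)`
  -- by inverting a Vandermonde matrix. Being combinations of dilates of `P`, they are smooth.
  let V : Matrix (Fin (d + 1)) (Fin (d + 1)) ℝ := Matrix.vandermonde fun k => (k : ℝ)
  have hV : IsUnit V.det := by
    rw [isUnit_iff_ne_zero, Matrix.det_vandermonde_ne_zero_iff]
    intro a b h
    exact Fin.ext (Nat.cast_injective (R := ℝ) h)
  have hinv : V⁻¹ * V = 1 := Matrix.nonsing_inv_mul V hV
  have hsum : ∀ z t, P ⟨z.1, t • z.2⟩ = ∑ l : Fin (d + 1), (p z).coeff l * t ^ (l : ℕ) := by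
    intro z t
    rw [hpe, Polynomial.eval_eq_sum_range' (Nat.lt_succ_of_le (hp z)), Finset.sum_range]
  have hH : ∀ (j : Fin (d + 1)) (z : CotangentBundle n M) (s : ℝ),
      ∑ k : Fin (d + 1), V⁻¹ j k * P ⟨z.1, (k : ℝ) • s • z.2⟩ = s ^ (j : ℕ) * (p z).coeff j := by
    intro j z s
    simp_rw [smul_smul, hsum, Finset.mul_sum]
    rw [Finset.sum_comm]
    have : ∀ l : Fin (d + 1), ∑ k : Fin (d + 1),
        V⁻¹ j k * ((p z).coeff l * ((k : ℝ) * s) ^ (l : ℕ)) =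
        (V⁻¹ * V) j l * ((p z).coeff l * s ^ (l : ℕ)) := by
      intro l
      rw [Matrix.mul_apply, Finset.sum_mul]
      refine Finset.sum_congr rfl fun k _ => ?_
      simp only [V, Matrix.vandermonde_apply, mul_pow]
      ring
    simp_rw [this, hinv, Matrix.one_apply, ite_mul, one_mul, zero_mul]
    simp [mul_comm]
  have hH1 : ∀ (j : Fin (d + 1)) (z : CotangentBundle n M),
      ∑ k : Fin (d + 1), V⁻¹ j k * P ⟨z.1, (k : ℝ) • z.2⟩ = (p z).coeff j := by
    intro j z
    have := hH j z 1
    simpa using this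
  refine ⟨fun (j : Fin (d + 1)) z => ∑ k : Fin (d + 1), V⁻¹ j k * P ⟨z.1, (k : ℝ) • z.2⟩, fun j => ?_, ?_⟩
  · rw [mem_homogeneousPart_iff]
    constructor
    · have h : ∀ k : Fin (d + 1), Smooth fun z : CotangentBundle n M =>
          V⁻¹ j k * P ⟨z.1, (k : ℝ) • z.2⟩ := fun k =>
        contMDiff_const.mul (smooth_smul_fibre hs _)
      exact contMDiff_finsetSum fun k _ => h k
    · intro z t
      exact (hH j z t).trans (congrArg (t ^ (j : ℕ) * ·) (hH1 j z).symm)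
  · funext z
    have h := hsum z 1
    rw [Finset.sum_apply]
    simp only [one_smul, one_pow, mul_one] at h
    simp only [hH1]
    exact h

/-- Polynomiality along rays, with a uniform degree bound, is stable under products and testable one
ray at a time; this makes `S(M)` an algebra. `RayPoly.exists_sum` recovers the decomposition. -/
lemma mem_polyFun_iff {P : CotangentBundle n M → ℝ} : P ∈ PolyFun n M ↔ P ∈ rayAlg n M := by
  constructor
  · have : PolyFun n M ≤ Subalgebra.toSubmodule (rayAlg n M) := by
      refine iSup_le fun i P hP => ?_
      rw [mem_homogeneousPart_iff] at hP
      exact ⟨hP.1, i, hP.2.rayPoly⟩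
    exact fun h => this h
  · rintro ⟨hs, d, hd⟩
    obtain ⟨H, hH, rfl⟩ := hd.exists_sum hs
    exact Submodule.sum_mem _ fun j _ => Submodule.mem_iSup_of_mem (j : ℕ) (hH j)

lemma smooth_rescale {P : CotangentBundle n M → ℝ} (hP : Smooth P) (κ : ℝ) :
    Smooth (rescale κ P) :=
  contMDiff_const.mul (smooth_smul_fibre hP κ⁻¹)

/-- The maps `P ↦ U_κ(P) ∘ φ* ∘ Exp(ηᵛ)` preserve `S(M)`. -/
lemma rescale_comp_mem {P : CotangentBundle n M → ℝ} (hP : P ∈ PolyFun n M) (κ : ℝ)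
    (φ : M ≃ₘ^∞⟮𝓡 n, 𝓡 n⟯ M) (η : OneForm n M) : rescale κ P ∘ liftMap φ η ∈ PolyFun n M := by
  induction hP using Submodule.iSup_induction' with
  | mem i P hP =>
    rw [mem_polyFun_iff]
    refine ⟨(smooth_rescale hP.1 κ).comp_liftMap φ η, i, fun z => ?_⟩
    obtain ⟨y, α⟩ := z
    obtain ⟨c, hc⟩ := hP.2 (φ.symm y)
    have hlin : ∃ A : Cotangent n M y →ₗ[ℝ] Cotangent n M (φ.symm y), ∀ β : Cotangent n M y,
        liftMap φ η ⟨y, β⟩ = ⟨φ.symm y, A (β + η y)⟩ := by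
      refine ⟨{ toFun := fun β => (show TangentSpace (𝓡 n) (φ (φ.symm y)) →L[ℝ] ℝ from β).comp
                  (mfderiv (𝓡 n) (𝓡 n) φ (φ.symm y))
                map_add' := fun a b => rfl
                map_smul' := fun r a => rfl }, fun β => rfl⟩
    obtain ⟨A, hA⟩ := hlin
    -- On a fibre the map is affine: a ray goes to an affine line, where a form of degree `i` is a
    -- polynomial of degree at most `i`. The translation produces the lower degrees.
    obtain ⟨p, hp, hpe⟩ := exists_polynomial_multilinear c (κ⁻¹ • A α) (κ⁻¹ • A (η y))
    refine ⟨Polynomial.C κ * p, (Polynomial.natDegree_C_mul_le _ _).trans hp, fun t => ?_⟩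
    rw [Polynomial.eval_mul, Polynomial.eval_C, ← hpe]
    simp only [Function.comp_apply]
    rw [hA]
    change κ * P ⟨φ.symm y, κ⁻¹ • A (t • α + η y)⟩ = _
    rw [hc, map_add, map_smul, smul_add, smul_comm]
  | zero =>
    have : rescale κ (0 : CotangentBundle n M → ℝ) ∘ liftMap φ η = 0 := by
      rw [map_zero]; rfl
    rw [this]
    exact zero_mem _
  | add P Q _ _ h1 h2 =>
    rw [map_add]
    exact add_mem h1 h2

end Homogeneous

/-! ### Bilinearity, the Leibniz rule and the degree of the Poisson bracket. -/

section Pairing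

variable {n : ℕ} (α α' β β' : Model n × (Model n →L[ℝ] ℝ) →L[ℝ] ℝ) (r : ℝ)

lemma pairing_add_left : pairing (α + α') β = pairing α β + pairing α' β := by
  simp only [pairing, ← Finset.sum_add_distrib]
  refine Finset.sum_congr rfl fun i _ => ?_
  simp only [add_apply]
  ring

lemma pairing_swap : pairing α β = -pairing β α := by
  simp only [pairing, ← Finset.sum_neg_distrib]
  refine Finset.sum_congr rfl fun i _ => ?_
  ring

lemma pairing_add_right : pairing α (β + β') = pairing α β + pairing α β' := by
  rw [pairing_swap, pairing_add_left, neg_add, ← pairing_swap, ← pairing_swap]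

lemma pairing_smul_right : pairing α (r • β) = r * pairing α β := by
  rw [pairing_eq_apply_hamVec, pairing_eq_apply_hamVec]; rfl

end Pairing

section Bracket

variable {n : ℕ} {M : Type*} [TopologicalSpace M] [ChartedSpace (Model n) M]
  [IsManifold (𝓡 n) ∞ M]

lemma poisson_apply (P Q : CotangentBundle n M → ℝ) (z : CotangentBundle n M) :
    poisson P Q z = pairing (phaseDeriv P z) (phaseDeriv Q z) := rfl

lemma poisson_swap (P Q : CotangentBundle n M → ℝ) : poisson P Q = -poisson Q P := by
  funext z
  exact pairing_swap _ _

lemma Smooth.differentiableAt {P : CotangentBundle n M → ℝ} (hP : Smooth P)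
    (z : CotangentBundle n M) :
    DifferentiableAt ℝ (P ∘ (cotChart z.1).symm) (cotChart z.1 z) := by
  refine (hP.contDiffAt_symm ?_).differentiableAt (by simp)
  rw [cotChart_apply_fst (mem_chart_source _ _)]
  exact mem_target_of_mem_source (mem_chart_source _ _)

lemma Smooth.phaseDeriv_eq {P : CotangentBundle n M → ℝ} (hP : Smooth P)
    (z : CotangentBundle n M) :
    phaseDeriv P z = fderiv ℝ (P ∘ (cotChart z.1).symm) (cotChart z.1 z) :=
  phaseDeriv_eq_fderiv (hP.mdifferentiableAt z)

lemma cotChart_symm_self (z : CotangentBundle n M) : (cotChart z.1).symm (cotChart z.1 z) = z :=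
  (cotChart z.1).left_inv (mem_cotChart_source.2 (mem_chart_source _ _))

lemma phaseDeriv_add {P Q : CotangentBundle n M → ℝ} (hP : Smooth P) (hQ : Smooth Q)
    (z : CotangentBundle n M) : phaseDeriv (P + Q) z = phaseDeriv P z + phaseDeriv Q z := by
  have h : Smooth (P + Q) := hP.add hQ
  rw [h.phaseDeriv_eq, hP.phaseDeriv_eq, hQ.phaseDeriv_eq,
    ← fderiv_add (hP.differentiableAt z) (hQ.differentiableAt z)]
  rfl

lemma phaseDeriv_mul {P Q : CotangentBundle n M → ℝ} (hP : Smooth P) (hQ : Smooth Q)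
    (z : CotangentBundle n M) :
    phaseDeriv (P * Q) z = P z • phaseDeriv Q z + Q z • phaseDeriv P z := by
  have h : Smooth (P * Q) := hP.mul hQ
  have h2 := fderiv_mul (hP.differentiableAt z) (hQ.differentiableAt z)
  simp only [Function.comp_apply, cotChart_symm_self] at h2
  rw [h.phaseDeriv_eq, hP.phaseDeriv_eq, hQ.phaseDeriv_eq, ← h2]
  rfl

lemma phaseDeriv_smul {P : CotangentBundle n M → ℝ} (hP : Smooth P) (r : ℝ)
    (z : CotangentBundle n M) : phaseDeriv (r • P) z = r • phaseDeriv P z := by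
  have h : Smooth (r • P) := (contMDiff_const (c := r)).mul hP
  rw [h.phaseDeriv_eq, hP.phaseDeriv_eq, ← fderiv_const_smul (hP.differentiableAt z)]
  rfl

lemma poisson_add_right {P Q R : CotangentBundle n M → ℝ} (hQ : Smooth Q) (hR : Smooth R) :
    poisson P (Q + R) = poisson P Q + poisson P R := by
  funext z
  simp only [poisson_apply, phaseDeriv_add hQ hR, pairing_add_right, Pi.add_apply]

lemma poisson_smul_right {P Q : CotangentBundle n M → ℝ} (hQ : Smooth Q) (r : ℝ) :
    poisson P (r • Q) = r • poisson P Q := by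
  funext z
  simp only [poisson_apply, phaseDeriv_smul hQ, pairing_smul_right, Pi.smul_apply, smul_eq_mul]

lemma poisson_add_left {P Q R : CotangentBundle n M → ℝ} (hP : Smooth P) (hQ : Smooth Q) :
    poisson (P + Q) R = poisson P R + poisson Q R := by
  rw [poisson_swap, poisson_add_right hP hQ, neg_add, ← poisson_swap, ← poisson_swap]

lemma poisson_smul_left {P Q : CotangentBundle n M → ℝ} (hP : Smooth P) (r : ℝ) :
    poisson (r • P) Q = r • poisson P Q := by
  rw [poisson_swap, poisson_smul_right hP, ← smul_neg, ← poisson_swap]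

lemma poisson_mul_right {P Q R : CotangentBundle n M → ℝ} (hQ : Smooth Q) (hR : Smooth R) :
    poisson P (Q * R) = poisson P Q * R + Q * poisson P R := by
  funext z
  simp only [poisson_apply, phaseDeriv_mul hQ hR, pairing_add_right, pairing_smul_right,
    Pi.add_apply, Pi.mul_apply]
  ring

/-- The definition uses the preferred chart at the base point, which may jump from point to point.
Smoothness becomes visible in a fixed chart, by `poisson_eq_pairing_of_mem`. -/
lemma Smooth.poisson {P Q : CotangentBundle n M → ℝ} (hP : Smooth P) (hQ : Smooth Q) :
    Smooth (poisson P Q) := by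
  refine smooth_of_contDiffOn_symm fun x₀ => ?_
  have hd : ∀ R : CotangentBundle n M → ℝ, Smooth R →
      ContDiffOn ℝ ∞ (fderiv ℝ (R ∘ (cotChart x₀).symm)) (cotChart x₀).target := fun R hR =>
    (hR.contDiffOn_symm x₀).fderiv_of_isOpen (isOpen_cotChart_target x₀) (by simp)
  have h : ContDiffOn ℝ ∞ (fun w => pairing (fderiv ℝ (P ∘ (cotChart x₀).symm) w)
      (fderiv ℝ (Q ∘ (cotChart x₀).symm) w))
      (cotChart x₀ : PartialEquiv (CotangentBundle n M) _).target := by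
    unfold pairing
    refine ContDiffOn.sum fun i _ => ?_
    exact (((hd P hP).clm_apply contDiffOn_const).mul ((hd Q hQ).clm_apply contDiffOn_const)).sub
      (((hd P hP).clm_apply contDiffOn_const).mul ((hd Q hQ).clm_apply contDiffOn_const))
  refine h.congr fun w hw => ?_
  have hw' := mem_cotChart_target.1 hw
  have hs : ((cotChart x₀).symm w).1 ∈ (chartAt (Model n) x₀).source := by
    rw [cotChart_symm_proj hw']; exact symm_mem_source hw'
  simp only [Function.comp_apply]
  rw [poisson_eq_pairing_of_mem hP hQ hs, (cotChart x₀).right_inv hw]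

/-- The derivative of a homogeneous function at rescaled covectors. -/
lemma Homog.phaseDeriv {i : ℕ} {P : CotangentBundle n M → ℝ} (hs : Smooth P) (hP : Homog i P)
    (z : CotangentBundle n M) (t : ℝ) (u : Model n) (p : Model n →L[ℝ] ℝ) :
    phaseDeriv P ⟨z.1, t • z.2⟩ (u, t • p) = t ^ i * PolyPoisson.phaseDeriv P z (u, p) := by
  have hx := mem_chart_source (Model n) z.1
  let m : Model n × (Model n →L[ℝ] ℝ) →L[ℝ] Model n × (Model n →L[ℝ] ℝ) :=
    (ContinuousLinearMap.fst ℝ _ _).prod (t • ContinuousLinearMap.snd ℝ _ _)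
  have hz : cotChart z.1 (⟨z.1, t • z.2⟩ : CotangentBundle n M) = m (cotChart z.1 z) := by
    have h1 := cotChart_self_apply (⟨z.1, t • z.2⟩ : CotangentBundle n M)
    have h2 := cotChart_self_apply z
    rw [h2]
    exact h1
  have h1 := (hs.differentiableAt ⟨z.1, t • z.2⟩).hasFDerivAt
  simp only at h1
  rw [hz] at h1
  have h2 := h1.comp (cotChart z.1 z) m.hasFDerivAt
  have h3 : ((P ∘ (cotChart z.1).symm) ∘ m) =ᶠ[𝓝 (cotChart z.1 z)]
      fun w => t ^ i * (P ∘ (cotChart z.1).symm) w := by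
    have : ∀ᶠ w in 𝓝 (cotChart z.1 z), w ∈ (cotChart z.1 : PartialEquiv (CotangentBundle n M) _).target :=
      (isOpen_cotChart_target z.1).mem_nhds
        ((cotChart z.1).map_source (mem_cotChart_source.2 hx))
    filter_upwards [this] with w hw
    rw [mem_cotChart_target] at hw
    simp only [Function.comp_apply]
    rw [← hP, cotChart_symm_apply hw, cotChart_symm_apply (w := m w) hw]
    rfl
  have h4 := ((hs.differentiableAt z).hasFDerivAt.const_mul (t ^ i)).congr_of_eventuallyEq h3
  have h5 := congrArg (fun f => f (u, p)) (h2.unique h4)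
  rw [hs.phaseDeriv_eq, hs.phaseDeriv_eq]
  simp only at h5 ⊢
  rw [hz]
  exact h5

/-- Position derivatives scale by `t ^ i`, and so do momentum derivatives multiplied by `t`. Keeping
the factor `t` on the left avoids the exponent `i + j - 1` and keeps `t = 0` meaningful. -/
lemma Homog.mul_poisson {i j : ℕ} {P Q : CotangentBundle n M → ℝ} (hs : Smooth P) (hP : Homog i P)
    (hs' : Smooth Q) (hQ : Homog j Q) (z : CotangentBundle n M) (t : ℝ) :
    t * poisson P Q ⟨z.1, t • z.2⟩ = t ^ (i + j) * poisson P Q z := by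
  simp only [poisson, dp, dq, Finset.mul_sum]
  refine Finset.sum_congr rfl fun k _ => ?_
  have e1 := hP.phaseDeriv hs z t (EuclideanSpace.single k 1) 0
  have e2 := hP.phaseDeriv hs z t 0 (EuclideanSpace.proj k)
  have e3 := hQ.phaseDeriv hs' z t (EuclideanSpace.single k 1) 0
  have e4 := hQ.phaseDeriv hs' z t 0 (EuclideanSpace.proj k)
  have hsm : ((0 : Model n), t • (EuclideanSpace.proj k : Model n →L[ℝ] ℝ)) =
      t • ((0 : Model n), (EuclideanSpace.proj k : Model n →L[ℝ] ℝ)) := by simp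
  rw [hsm, map_smul, smul_eq_mul] at e2 e4
  rw [smul_zero] at e1 e3
  rw [pow_add]
  linear_combination (t * PolyPoisson.phaseDeriv P ⟨z.1, t • z.2⟩ (0, EuclideanSpace.proj k)) * e3 +
    (t ^ j * PolyPoisson.phaseDeriv Q z (EuclideanSpace.single k 1, 0)) * e2 -
    (t * PolyPoisson.phaseDeriv Q ⟨z.1, t • z.2⟩ (0, EuclideanSpace.proj k)) * e1 -
    (t ^ i * PolyPoisson.phaseDeriv P z (EuclideanSpace.single k 1, 0)) * e4

lemma poisson_zero_zero {P Q : CotangentBundle n M → ℝ} (hP : P ∈ homogeneousPart n M 0)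
    (hQ : Q ∈ homogeneousPart n M 0) : poisson P Q = 0 := by
  rw [mem_homogeneousPart_iff] at hP hQ
  funext z
  -- At `t = 0` the left side vanishes, while the factor `0 ^ (0 + 0)` on the right is `1`.
  have := hP.2.mul_poisson hP.1 hQ.1 hQ.2 z 0
  simpa using this.symm

lemma poisson_mem_homogeneousPart {i j k : ℕ} (hk : i + j = k + 1) {P Q : CotangentBundle n M → ℝ}
    (hP : P ∈ homogeneousPart n M i) (hQ : Q ∈ homogeneousPart n M j) :
    poisson P Q ∈ homogeneousPart n M k := by
  rw [mem_homogeneousPart_iff] at hP hQ ⊢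
  refine ⟨hP.1.poisson hQ.1, fun z t => ?_⟩
  have hc1 : Continuous fun t : ℝ => poisson P Q ⟨z.1, t • z.2⟩ := by
    have h := (contDiff_fibre (hP.1.poisson hQ.1) z.1).continuous
    have h2 : Continuous fun t : ℝ => t • (show Model n →L[ℝ] ℝ from z.2) := by fun_prop
    exact h.comp h2
  have hc2 : Continuous fun t : ℝ => t ^ k * poisson P Q z := by fun_prop
  -- The factor `t` cancels only for `t ≠ 0`; continuity supplies the remaining value.
  have hd : Dense ({0}ᶜ : Set ℝ) := dense_compl_singleton 0
  refine congrFun (hc1.ext_on hd hc2 fun t ht => ?_) t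
  have ht : t ≠ 0 := ht
  have h := hP.2.mul_poisson hP.1 hQ.1 hQ.2 z t
  rw [hk, pow_succ'] at h
  refine mul_left_cancel₀ ht ?_
  simp only
  rw [h]
  ring

lemma poisson_mem_polyFun_of_mem {i j : ℕ} {P Q : CotangentBundle n M → ℝ}
    (hP : P ∈ homogeneousPart n M i) (hQ : Q ∈ homogeneousPart n M j) :
    poisson P Q ∈ PolyFun n M := by
  rcases Nat.eq_zero_or_pos (i + j) with h | h
  · obtain ⟨rfl, rfl⟩ : i = 0 ∧ j = 0 := by omega
    rw [poisson_zero_zero hP hQ]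
    exact zero_mem _
  · exact Submodule.mem_iSup_of_mem (i + j - 1)
      (poisson_mem_homogeneousPart (by omega) hP hQ)

lemma PolyFun.smooth {P : CotangentBundle n M → ℝ} (hP : P ∈ PolyFun n M) : Smooth P :=
  (mem_polyFun_iff.1 hP).1

lemma poisson_mem_polyFun {P Q : CotangentBundle n M → ℝ} (hP : P ∈ PolyFun n M)
    (hQ : Q ∈ PolyFun n M) : poisson P Q ∈ PolyFun n M := by
  have hz : ∀ R : CotangentBundle n M → ℝ, poisson R 0 = 0 := fun R => by
    have h0 : Smooth (0 : CotangentBundle n M → ℝ) := contMDiff_const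
    have := poisson_smul_right (P := R) h0 0
    simpa using this
  have h1 : ∀ i, ∀ P ∈ homogeneousPart n M i, poisson P Q ∈ PolyFun n M := by
    intro i P hP
    induction hQ using Submodule.iSup_induction' with
    | mem j Q hQ => exact poisson_mem_polyFun_of_mem hP hQ
    | zero => rw [hz]; exact zero_mem _
    | add Q Q' hQ hQ' h h' =>
      rw [poisson_add_right (PolyFun.smooth hQ) (PolyFun.smooth hQ')]
      exact add_mem h h'
  induction hP using Submodule.iSup_induction' with
  | mem i P hP => exact h1 i P hP
  | zero => rw [poisson_swap, hz, neg_zero]; exact zero_mem _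
  | add P P' hP hP' h h' =>
    rw [poisson_add_left (PolyFun.smooth hP) (PolyFun.smooth hP')]
    exact add_mem h h'

end Bracket

/-! ### Abstract graded Poisson algebras. -/

/-- A commutative algebra with a graded antisymmetric biderivation of degree `-1`. -/
structure PoissonGrading (R : Type*) [CommRing R] [Algebra ℝ R] where
  br : R →ₗ[ℝ] R →ₗ[ℝ] R
  part : ℕ → Submodule ℝ R
  br_swap : ∀ P Q, br P Q = -br Q P
  br_mul : ∀ P Q Q', br P (Q * Q') = br P Q * Q' + Q * br P Q'
  one_mem : (1 : R) ∈ part 0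
  mul_mem : ∀ {i j P Q}, P ∈ part i → Q ∈ part j → P * Q ∈ part (i + j)
  -- Degree `-1` is expressed without subtraction; the excluded case `i = j = 0` is `br_zero`.
  br_mem : ∀ {i j k P Q}, P ∈ part i → Q ∈ part j → i + j = k + 1 → br P Q ∈ part k
  br_zero : ∀ {P Q}, P ∈ part 0 → Q ∈ part 0 → br P Q = 0
  iSup_part : ⨆ i, part i = ⊤

namespace PoissonGrading

variable {R : Type*} [CommRing R] [Algebra ℝ R] (G : PoissonGrading R)

lemma mul_br (P P' Q : R) : G.br (P * P') Q = G.br P Q * P' + P * G.br P' Q := by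
  rw [G.br_swap, G.br_mul, G.br_swap Q P, G.br_swap Q P']
  ring

lemma br_one (P : R) : G.br P 1 = 0 := by
  have h := G.br_mul P 1 1
  simp only [mul_one, one_mul] at h
  exact left_eq_add.1 h

lemma zero_mul_mem {i : ℕ} {f Q : R} (hf : f ∈ G.part 0) (hQ : Q ∈ G.part i) :
    f * Q ∈ G.part i := by
  have := G.mul_mem hf hQ
  rwa [zero_add] at this

lemma pow_mem {X : R} (hX : X ∈ G.part 1) : ∀ j : ℕ, X ^ j ∈ G.part j
  | 0 => by rw [pow_zero]; exact G.one_mem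
  | j + 1 => by rw [pow_succ]; exact G.mul_mem (pow_mem hX j) hX

lemma pow_zero_mem {a : R} (ha : a ∈ G.part 0) : ∀ j : ℕ, a ^ j ∈ G.part 0
  | 0 => by rw [pow_zero]; exact G.one_mem
  | j + 1 => by rw [pow_succ]; exact G.mul_mem (pow_zero_mem ha j) ha

/-- The extra factor `P` on the left removes the exponent `j - 1`. -/
lemma br_pow (P Q : R) (j : ℕ) : G.br (P ^ j) Q * P = j * (P ^ j * G.br P Q) := by
  induction j with
  | zero =>
    rw [pow_zero, G.br_swap, G.br_one]; simp
  | succ j ih =>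
    rw [pow_succ, mul_br, add_mul]
    push_cast
    linear_combination P * ih

/-- The degree zero part as a subalgebra. -/
def base : Subalgebra ℝ R where
  carrier := G.part 0
  mul_mem' := fun ha hb => G.mul_mem ha hb
  add_mem' := fun ha hb => (G.part 0).add_mem ha hb
  algebraMap_mem' r := by
    rw [Algebra.algebraMap_eq_smul_one]
    exact (G.part 0).smul_mem r G.one_mem

lemma iterate_mem {f : R} (hf : f ∈ G.part 0) {i : ℕ} {Q : R} (hQ : Q ∈ G.part i) {j : ℕ}
    (hj : j ≤ i) : (fun P => G.br P f)^[j] Q ∈ G.part (i - j) := by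
  induction j with
  | zero => simpa using hQ
  | succ j ih =>
    rw [Function.iterate_succ_apply']
    exact G.br_mem (ih (by omega)) hf (by omega)

lemma iterate_eq_zero {f : R} (hf : f ∈ G.part 0) {i : ℕ} {Q : R} (hQ : Q ∈ G.part i) :
    (fun P => G.br P f)^[i + 1] Q = 0 := by
  rw [Function.iterate_succ_apply']
  have := G.iterate_mem hf hQ le_rfl
  rw [Nat.sub_self] at this
  exact G.br_zero this hf

/-- If a linear map kills all `{XQ, f}` with `Q` of degree `i`, it kills all `{X, f}^{i+1} Q`. -/
lemma map_pow_mul_eq_zero {X f : R} (hX : X ∈ G.part 1) (hf : f ∈ G.part 0) {i : ℕ}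
    (l : R →ₗ[ℝ] R) (hl : ∀ Q ∈ G.part i, l (G.br (X * Q) f) = 0) {Q : R} (hQ : Q ∈ G.part i) :
    l (G.br X f ^ (i + 1) * Q) = 0 := by
  have ha : G.br X f ∈ G.part 0 := G.br_mem hX hf (by norm_num)
  -- Put `a = {X, f}` and let `Qⱼ` be `Q` bracketed `j` times with `f`. Since `{a, f} = 0`, the
  -- bracket `{X a^m X^j Qⱼ, f}` equals `a^m X^(j+1) Qⱼ₊₁ + (j+1) a^(m+1) X^j Qⱼ`. Thus powers of
  -- `X` are traded for powers of `a`, starting from `Qᵢ₊₁ = 0`.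
  have key : ∀ m j : ℕ, j + m = i + 1 →
      l (G.br X f ^ m * (X ^ j * (fun P => G.br P f)^[j] Q)) = 0 := by
    intro m
    induction m with
    | zero =>
      intro j hj
      obtain rfl : j = i + 1 := by omega
      rw [G.iterate_eq_zero hf hQ]
      simp
    | succ m ih =>
      intro j hj
      set a := G.br X f
      set Qj := (fun P => G.br P f)^[j] Q with hQj
      have hQjm : Qj ∈ G.part (i - j) := G.iterate_mem hf hQ (by omega)
      have hmem : a ^ m * (X ^ j * Qj) ∈ G.part i := by
        refine G.zero_mul_mem (G.pow_zero_mem ha m) ?_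
        have := G.mul_mem (G.pow_mem hX j) hQjm
        rwa [show j + (i - j) = i by omega] at this
      have h1 := hl _ hmem
      have h2 := ih (j + 1) (by omega)
      rw [Function.iterate_succ_apply', ← hQj] at h2
      have h0 : G.br (a ^ m) f = 0 := G.br_zero (G.pow_zero_mem ha m) hf
      have h3 : G.br (X * (a ^ m * (X ^ j * Qj))) f =
          a ^ m * (X ^ (j + 1) * G.br Qj f) + ((j : ℝ) + 1) • (a ^ (m + 1) * (X ^ j * Qj)) := by
        rw [G.mul_br, G.mul_br, h0, G.mul_br, Algebra.smul_def]
        simp only [map_add, map_natCast, map_one]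
        linear_combination (a ^ m * Qj) * G.br_pow X f j
      rw [h3, map_add, h2, zero_add, map_smul] at h1
      exact (smul_eq_zero.1 h1).resolve_left (by positivity)
  have := key (i + 1) 0 (by omega)
  simpa using this

/-- The grading is nonsingular: the unit is a sum of two brackets `{X, f}`, or the algebra is
trivial. -/
def Nonsingular : Prop :=
  (∃ X₁ ∈ G.part 1, ∃ X₂ ∈ G.part 1, ∃ f₁ ∈ G.part 0, ∃ f₂ ∈ G.part 0,
      G.br X₁ f₁ + G.br X₂ f₂ = 1) ∨
    (∀ i, G.part (i + 1) = ⊥) ∧ ∀ f ∈ G.part 0, ∃ r : ℝ, f = algebraMap ℝ R r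

/-- The failure of `c` to commute with multiplication by `g`. -/
def defect (c : R →ₗ[ℝ] R) (g : R) : R →ₗ[ℝ] R :=
  c ∘ₗ LinearMap.mulLeft ℝ g - LinearMap.mulLeft ℝ g ∘ₗ c

lemma defect_apply (c : R →ₗ[ℝ] R) (g Q : R) : defect c g Q = c (g * Q) - g * c Q := rfl

/-- If `f ↦ c {P, f}` is an inner derivation for all `P` of degree `i + 1`, then `c` is linear over
the degree zero part on the degree `i` part. -/
theorem map_mul_of_derivation (hns : G.Nonsingular) (c : R →ₗ[ℝ] R) (i : ℕ)
    (hc : ∀ P ∈ G.part (i + 1), ∃ P', ∀ f ∈ G.part 0, c (G.br P f) = G.br P' f) {g Q : R}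
    (hg : g ∈ G.part 0) (hQ : Q ∈ G.part i) : c (g * Q) = g * c Q := by
  -- Apply `c` to `{P, f g}` and compare the Leibniz rules of `{P, ·}` and `{P', ·}`.
  have hA : ∀ P ∈ G.part (i + 1), ∀ f ∈ G.part 0, ∀ g ∈ G.part 0,
      defect c g (G.br P f) + defect c f (G.br P g) = 0 := by
    intro P hP f hf g hg
    obtain ⟨P', hP'⟩ := hc P hP
    have h := hP' (f * g) (G.zero_mul_mem hf hg)
    rw [G.br_mul, G.br_mul, map_add, mul_comm (G.br P f) g] at h
    rw [defect_apply, defect_apply, hP' f hf, hP' g hg]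
    linear_combination h
  -- The case `f = g` of `hA`, with `P = X Q`: the defect along `f` kills every `{X Q, f}`.
  have hC : ∀ X ∈ G.part 1, ∀ f ∈ G.part 0, ∀ Q ∈ G.part i,
      defect c f (G.br X f ^ (i + 1) * Q) = 0 := by
    intro X hX f hf Q hQ
    refine G.map_pow_mul_eq_zero hX hf _ (fun Q hQ => ?_) hQ
    have hm := G.mul_mem hX hQ
    rw [add_comm] at hm
    have h := hA _ hm f hf f hf
    rw [← two_smul ℝ] at h
    exact (smul_eq_zero.1 h).resolve_left (by norm_num)
  -- Pass from the defect along `f` to the one along an arbitrary `g`. In `hA` take `P = a^(i+1) X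
  -- Q` with `a = {X, f}`: the term along `f` vanishes by `hC`, so the trading argument applies once
  -- more and doubles the exponent.
  have hD : ∀ X ∈ G.part 1, ∀ f ∈ G.part 0, ∀ Q ∈ G.part i,
      defect c g (G.br X f ^ (2 * (i + 1)) * Q) = 0 := by
    intro X hX f hf Q hQ
    have ha : G.br X f ∈ G.part 0 := G.br_mem hX hf (by norm_num)
    have ha' := G.pow_zero_mem ha (i + 1)
    have := G.map_pow_mul_eq_zero hX hf
      (defect c g ∘ₗ LinearMap.mulLeft ℝ (G.br X f ^ (i + 1))) (fun Q hQ => ?_) hQ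
    · simp only [LinearMap.comp_apply, LinearMap.mulLeft_apply] at this
      rw [← this]
      congr 1
      ring
    · have hm := G.mul_mem hX hQ
      rw [add_comm] at hm
      have h := hA _ (G.zero_mul_mem ha' hm) f hf g hg
      rw [G.mul_br (G.br X f ^ (i + 1)) (X * Q) f, G.br_zero ha' hf, zero_mul, zero_add,
        G.mul_br (G.br X f ^ (i + 1)) (X * Q) g, G.br_zero ha' hg, zero_mul, zero_add, hC X hX f hf _ (G.br_mem hm hg (by omega)), add_zero] at h
      exact h
  suffices h : defect c g Q = 0 by
    rw [defect_apply] at h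
    exact sub_eq_zero.1 h
  rcases hns with ⟨X₁, hX₁, X₂, hX₂, f₁, hf₁, f₂, hf₂, h1⟩ | ⟨h0, hconst⟩
  · have ha₁ : G.br X₁ f₁ ∈ G.part 0 := G.br_mem hX₁ hf₁ (by norm_num)
    have ha₂ : G.br X₂ f₂ ∈ G.part 0 := G.br_mem hX₂ hf₂ (by norm_num)
    -- Because `{X₁, f₁} + {X₂, f₂} = 1`, equal powers of the two brackets remain coprime in degree
    -- zero, and `Q` is a combination of multiples of these powers.
    have hco : IsCoprime (⟨_, ha₁⟩ : G.base) ⟨_, ha₂⟩ := ⟨1, 1, by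
      rw [one_mul, one_mul]; exact Subtype.ext h1⟩
    obtain ⟨u, v, huv⟩ := hco.pow (m := 2 * (i + 1)) (n := 2 * (i + 1))
    have huv : u.1 * G.br X₁ f₁ ^ (2 * (i + 1)) + v.1 * G.br X₂ f₂ ^ (2 * (i + 1)) = 1 :=
      congrArg Subtype.val huv
    have hu := hD X₁ hX₁ f₁ hf₁ _ (G.zero_mul_mem u.2 hQ)
    have hv := hD X₂ hX₂ f₂ hf₂ _ (G.zero_mul_mem v.2 hQ)
    have : Q = G.br X₁ f₁ ^ (2 * (i + 1)) * (u.1 * Q) + G.br X₂ f₂ ^ (2 * (i + 1)) * (v.1 * Q) := by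
      linear_combination (-Q) * huv
    rw [this, map_add, hu, hv, add_zero]
  · obtain ⟨r, rfl⟩ := hconst g hg
    rw [defect_apply, ← Algebra.smul_def, ← Algebra.smul_def, map_smul, sub_self]

/-- An automorphism of the bracket that preserves the degree zero part is multiplicative there,
up to a factor. -/
theorem map_mul_of_lieEquiv (hns : G.Nonsingular) (Φ : R ≃ₗ[ℝ] R)
    (hΦ : ∀ P Q, Φ (G.br P Q) = G.br (Φ P) (Φ Q))
    (h0 : ∀ f, f ∈ G.part 0 ↔ Φ f ∈ G.part 0) {f g : R} (hf : f ∈ G.part 0) (hg : g ∈ G.part 0) :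
    Φ (f * g) * Φ 1 = Φ f * Φ g := by
  have hsymm : ∀ f ∈ G.part 0, Φ.symm f ∈ G.part 0 := fun f hf => by
    rw [h0]; simpa using hf
  -- The conjugate `Φ ∘ f ∘ Φ⁻¹` sends `{P, k}` to `{Φ (f Φ⁻¹ P), k}` for `k` of degree zero,
  -- because `{f, Φ⁻¹ k} = 0`. It is therefore linear over the degree zero part.
  have hT : ∀ h ∈ G.part 0, Φ (f * h) = Φ h * Φ (f * Φ.symm 1) := by
    intro h hh
    have := G.map_mul_of_derivation hns
      (Φ.toLinearMap ∘ₗ LinearMap.mulLeft ℝ f ∘ₗ Φ.symm.toLinearMap) 0 (fun P _ =>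
        ⟨Φ (f * Φ.symm P), fun k hk => ?_⟩) (g := Φ h) (Q := 1) ((h0 h).1 hh) G.one_mem
    · simpa using this
    · have e : Φ.symm (G.br P k) = G.br (Φ.symm P) (Φ.symm k) := by
        rw [LinearEquiv.symm_apply_eq, hΦ]; simp
      simp only [LinearMap.comp_apply, LinearEquiv.coe_coe, LinearMap.mulLeft_apply]
      rw [e, ← Φ.apply_symm_apply k, ← hΦ, G.mul_br, G.br_zero hf (hsymm k hk)]
      simp
  have h1 := hT 1 G.one_mem
  rw [mul_one] at h1
  rw [hT g hg, h1]
  ring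

/-- Local nilpotency of `{P, ·}`. -/
def LocNilp (P : R) : Prop := ∀ Q, ∃ k, ((G.br P) ^ k) Q = 0

/-- Each bracket with an element of degree zero lowers the degree by one, and every element is a
finite sum of homogeneous ones. -/
lemma locNilp_of_mem {f : R} (hf : f ∈ G.part 0) : G.LocNilp f := by
  intro Q
  have hQ : Q ∈ ⨆ i, G.part i := by rw [G.iSup_part]; trivial
  have hmono : ∀ {Q : R} {k l : ℕ}, k ≤ l → ((G.br f) ^ k) Q = 0 → ((G.br f) ^ l) Q = 0 := by
    intro Q k l hkl h
    rw [← Nat.sub_add_cancel hkl, pow_add, Module.End.mul_apply, h, map_zero]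
  induction hQ using Submodule.iSup_induction' with
  | mem i Q hQ =>
    refine ⟨i + 1, ?_⟩
    have h := G.iterate_eq_zero hf hQ
    have h2 : ∀ j, ((G.br f) ^ j) Q = (-1 : ℝ) ^ j • (fun P => G.br P f)^[j] Q := by
      intro j
      induction j with
      | zero => simp
      | succ j ih =>
        rw [pow_succ', Module.End.mul_apply, ih, Function.iterate_succ_apply', map_smul,
          G.br_swap, pow_succ]
        simp
    rw [h2, h, smul_zero]
  | zero => exact ⟨0, by simp⟩
  | add P Q _ _ h1 h2 =>
    obtain ⟨k, hk⟩ := h1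
    obtain ⟨l, hl⟩ := h2
    exact ⟨max k l, by rw [map_add, hmono (le_max_left _ _) hk, hmono (le_max_right _ _) hl,
      add_zero]⟩

lemma leibniz_pow (D : R →ₗ[ℝ] R) (hD : ∀ u v, D (u * v) = D u * v + u * D v) (N : ℕ) (u v : R) :
    (D ^ N) (u * v) = ∑ p ∈ Finset.HasAntidiagonal.antidiagonal N, (N.choose p.1) • ((D ^ p.1) u * (D ^ p.2) v) := by
  induction N with
  | zero => simp
  | succ N ih =>
    rw [Finset.sum_antidiagonal_choose_succ_nsmul (M := R) (fun i j => (D ^ i) u * (D ^ j) v) N,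
      pow_succ', Module.End.mul_apply, ih, map_sum, ← Finset.sum_add_distrib]
    refine Finset.sum_congr rfl fun p hp => ?_
    have hc : N.choose p.2 = N.choose p.1 := by
      rw [Finset.HasAntidiagonal.mem_antidiagonal] at hp
      exact Nat.choose_symm_of_eq_add (by omega)
    rw [map_nsmul, hD, ← Module.End.mul_apply, ← pow_succ', ← Module.End.mul_apply D, ← pow_succ',
      hc, ← smul_add, add_comm]

/-- A locally nilpotent derivation kills units, pointwise. -/
lemma eval_derivation_unit (D : R →ₗ[ℝ] R) (hD : ∀ u v, D (u * v) = D u * v + u * D v)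
    (ev : R →+* ℝ) {u v : R} (huv : u * v = 1) {k l : ℕ} (hu : (D ^ k) u = 0)
    (hv : (D ^ l) v = 0) : ev (D u) = 0 := by
  classical
  have hmono : ∀ {Q : R} {k l : ℕ}, k ≤ l → (D ^ k) Q = 0 → (D ^ l) Q = 0 := by
    intro Q k l hkl h
    rw [← Nat.sub_add_cancel hkl, pow_add, Module.End.mul_apply, h, map_zero]
  have ev0 : ev u ≠ 0 ∧ ev v ≠ 0 := by
    have h := congrArg ev huv
    rw [map_mul, map_one] at h
    exact ⟨left_ne_zero_of_mul_eq_one h, right_ne_zero_of_mul_eq_one h⟩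
  -- Let `m` and `m'` be the last orders for which the iterates of `u` and `v` are nonzero under
  -- `ev`. In the Leibniz formula for `D^(m + m') (u v)` only the term `(m, m')` survives; as `D 1 =
  -- 0`, this is possible only if `m = 0`.
  have hmax : ∀ {w : R} {k : ℕ}, (D ^ k) w = 0 → ev w ≠ 0 →
      ∃ m, ev ((D ^ m) w) ≠ 0 ∧ ∀ j, m < j → ev ((D ^ j) w) = 0 := by
    intro w k hw h0
    have hb : ∀ j, ev ((D ^ j) w) ≠ 0 → j ≤ k := fun j hj => by
      by_contra hlt
      exact hj (by rw [hmono (by omega) hw, map_zero])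
    refine ⟨Nat.findGreatest (fun j => ev ((D ^ j) w) ≠ 0) k, ?_, fun j hj => ?_⟩
    · exact Nat.findGreatest_spec (P := fun j => ev ((D ^ j) w) ≠ 0) (Nat.zero_le k)
        (by simpa using h0)
    · by_contra h
      exact absurd (Nat.le_findGreatest (P := fun j => ev ((D ^ j) w) ≠ 0) (hb j h) h) (by omega)
  obtain ⟨m, hm, hm'⟩ := hmax hu ev0.1
  obtain ⟨m', hn, hn'⟩ := hmax hv ev0.2
  have h1 : D 1 = 0 := by
    have h := hD 1 1
    simp only [mul_one, one_mul] at h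
    exact left_eq_add.1 h
  by_cases h0 : m = 0
  · exact by simpa using hm' 1 (by omega)
  exfalso
  have h2 := leibniz_pow D hD (m + m') u v
  have hz : (D ^ (m + m')) (u * v) = 0 := by
    obtain ⟨s, hs⟩ : ∃ s, m + m' = s + 1 := ⟨m + m' - 1, by omega⟩
    rw [huv, hs, pow_succ, Module.End.mul_apply, h1, map_zero]
  rw [hz] at h2
  have h3 := congrArg ev h2
  rw [map_zero, map_sum, Finset.sum_eq_single (m, m')] at h3
  · rw [map_nsmul, map_mul, nsmul_eq_mul] at h3
    have : ((m + m').choose m : ℝ) ≠ 0 := by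
      exact_mod_cast (Nat.choose_pos (by omega)).ne'
    exact mul_ne_zero this (mul_ne_zero hm hn) h3.symm
  · rintro ⟨a, b⟩ hab hne
    rw [Finset.HasAntidiagonal.mem_antidiagonal] at hab
    simp only at hab
    rw [map_nsmul, map_mul]
    rcases lt_trichotomy a m with h | h | h
    · rw [hn' b (by omega)]; simp
    · exact absurd (Prod.ext h (by simp only; omega)) hne
    · rw [hm' a h]; simp
  · intro h
    exact absurd (by simp) h

/-- The elements of degree zero are those with a locally nilpotent adjoint action. -/
theorem locNilp_iff (hcent : ∀ P, (∀ f ∈ G.part 0, G.br P f = 0) → P ∈ G.part 0)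
    (hexp : ∀ f ∈ G.part 0, ∃ u v, u * v = 1 ∧ ∀ P, G.br P u = u * G.br P f)
    (hsep : ∀ P : R, (∀ ev : R →+* ℝ, ev P = 0) → P = 0) (P : R) :
    G.LocNilp P ↔ P ∈ G.part 0 := by
  refine ⟨fun h => hcent P fun f hf => ?_, G.locNilp_of_mem⟩
  obtain ⟨u, v, huv, hu⟩ := hexp f hf
  obtain ⟨k, hk⟩ := h u
  obtain ⟨l, hl⟩ := h v
  -- The unit `u` plays the role of `e^f`: once `{P, u}` vanishes, dividing by `u` gives `{P, f} =
  -- 0`.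
  have h0 : G.br P u = 0 := hsep _ fun ev =>
    eval_derivation_unit (G.br P) (G.br_mul P) ev huv hk hl
  rw [hu P] at h0
  calc G.br P f = v * (u * G.br P f) := by rw [← mul_assoc, mul_comm v, huv, one_mul]
    _ = 0 := by rw [h0, mul_zero]

/-- Automorphisms of the bracket preserve the degree zero part. -/
theorem map_mem_part_zero (hcent : ∀ P, (∀ f ∈ G.part 0, G.br P f = 0) → P ∈ G.part 0)
    (hexp : ∀ f ∈ G.part 0, ∃ u v, u * v = 1 ∧ ∀ P, G.br P u = u * G.br P f)
    (hsep : ∀ P : R, (∀ ev : R →+* ℝ, ev P = 0) → P = 0) (Φ : R ≃ₗ[ℝ] R)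
    (hΦ : ∀ P Q, Φ (G.br P Q) = G.br (Φ P) (Φ Q)) (f : R) :
    f ∈ G.part 0 ↔ Φ f ∈ G.part 0 := by
  have hit : ∀ P Q k, Φ (((G.br P) ^ k) Q) = ((G.br (Φ P)) ^ k) (Φ Q) := by
    intro P Q k
    induction k with
    | zero => simp
    | succ k ih => rw [pow_succ', Module.End.mul_apply, hΦ, ih, pow_succ', Module.End.mul_apply]
  -- Local nilpotency of the adjoint action involves the bracket alone, so `Φ` transports it.
  rw [← G.locNilp_iff hcent hexp hsep, ← G.locNilp_iff hcent hexp hsep]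
  constructor
  · intro h Q
    obtain ⟨k, hk⟩ := h (Φ.symm Q)
    refine ⟨k, ?_⟩
    have := hit f (Φ.symm Q) k
    rw [hk, map_zero, Φ.apply_symm_apply] at this
    exact this.symm
  · intro h Q
    obtain ⟨k, hk⟩ := h (Φ Q)
    refine ⟨k, Φ.injective ?_⟩
    rw [hit, hk, map_zero]

end PoissonGrading

/-! ### The graded Poisson algebra of `T*M` and its local coordinate elements. -/

section Grading

variable {n : ℕ} {M : Type*} [TopologicalSpace M] [ChartedSpace (Model n) M]
  [IsManifold (𝓡 n) ∞ M]

lemma mem_rayAlg_of_mem {i : ℕ} {P : CotangentBundle n M → ℝ} (hP : P ∈ homogeneousPart n M i) :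
    P ∈ rayAlg n M :=
  mem_polyFun_iff.1 (Submodule.mem_iSup_of_mem i hP)

lemma poisson_mem_rayAlg {P Q : CotangentBundle n M → ℝ} (hP : P ∈ rayAlg n M)
    (hQ : Q ∈ rayAlg n M) : poisson P Q ∈ rayAlg n M :=
  mem_polyFun_iff.1 (poisson_mem_polyFun (mem_polyFun_iff.2 hP) (mem_polyFun_iff.2 hQ))

variable (n M) in
/-- The Poisson algebra `S(M)` with its grading. -/
def grading : PoissonGrading (rayAlg n M) where
  br := LinearMap.mk₂ ℝ (fun P Q => ⟨poisson P.1 Q.1, poisson_mem_rayAlg P.2 Q.2⟩)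
    (fun P P' _ => Subtype.ext (poisson_add_left P.2.1 P'.2.1))
    (fun r P _ => Subtype.ext (poisson_smul_left P.2.1 r))
    (fun _ Q Q' => Subtype.ext (poisson_add_right Q.2.1 Q'.2.1))
    (fun r _ Q => Subtype.ext (poisson_smul_right Q.2.1 r))
  part i := (homogeneousPart n M i).comap (rayAlg n M).val.toLinearMap
  br_swap P Q := Subtype.ext (poisson_swap P.1 Q.1)
  br_mul P Q Q' := Subtype.ext (poisson_mul_right Q.2.1 Q'.2.1)
  one_mem := mem_homogeneousPart_iff.2 ⟨contMDiff_const, fun _ _ => by simp⟩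
  mul_mem {i j P Q} hP hQ := by
    have h1 := mem_homogeneousPart_iff.1 (Submodule.mem_comap.1 hP)
    have h2 := mem_homogeneousPart_iff.1 (Submodule.mem_comap.1 hQ)
    refine mem_homogeneousPart_iff.2 ⟨h1.1.mul h2.1, fun z t => ?_⟩
    change P.1 _ * Q.1 _ = _ * (P.1 _ * Q.1 _)
    have e1 := h1.2 z t
    have e2 := h2.2 z t
    simp only [AlgHom.toLinearMap_apply, Subalgebra.coe_val] at e1 e2
    rw [e1, e2, pow_add]
    ring
  br_mem hP hQ hk := poisson_mem_homogeneousPart hk hP hQ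
  br_zero hP hQ := Subtype.ext (poisson_zero_zero hP hQ)
  iSup_part := by
    refine eq_top_iff.2 fun P _ => ?_
    obtain ⟨d, hd⟩ := P.2.2
    obtain ⟨H, hH, hP⟩ := hd.exists_sum P.2.1
    have : P = ∑ j, (⟨H j, mem_rayAlg_of_mem (hH j)⟩ : rayAlg n M) := by
      refine Subtype.ext (hP.trans ?_)
      simp
    rw [this]
    exact Submodule.sum_mem _ fun j _ => Submodule.mem_iSup_of_mem (j : ℕ) (hH j)

lemma br_apply (P Q : rayAlg n M) (z : CotangentBundle n M) :
    ((grading n M).br P Q).1 z = poisson P.1 Q.1 z := rfl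

lemma mem_part {i : ℕ} {P : rayAlg n M} :
    P ∈ (grading n M).part i ↔ Smooth P.1 ∧ Homog i P.1 := mem_homogeneousPart_iff

lemma smooth_comp_proj {f : M → ℝ} (hf : ContMDiff (𝓡 n) 𝓘(ℝ, ℝ) ∞ f) :
    Smooth (fun z : CotangentBundle n M => f z.1) :=
  hf.comp (Bundle.contMDiff_proj (Cotangent n M))

/-- A smooth function on `M` as an element of `S₀(M)`. -/
def pull (f : M → ℝ) (hf : ContMDiff (𝓡 n) 𝓘(ℝ, ℝ) ∞ f) : rayAlg n M :=
  ⟨fun z => f z.1, smooth_comp_proj hf, 0, fun z => ⟨Polynomial.C (f z.1), by simp, fun t => by simp⟩⟩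

lemma pull_mem (f : M → ℝ) (hf : ContMDiff (𝓡 n) 𝓘(ℝ, ℝ) ∞ f) :
    pull f hf ∈ (grading n M).part 0 :=
  mem_part.2 ⟨smooth_comp_proj hf, fun z t => by simp [pull]⟩

/-- The restriction of an element of `S(M)` to the zero section. -/
def onBase (P : rayAlg n M) (x : M) : ℝ := P.1 ⟨x, 0⟩

lemma contMDiff_onBase (P : rayAlg n M) : ContMDiff (𝓡 n) 𝓘(ℝ, ℝ) ∞ (onBase P) :=
  P.2.1.comp (Bundle.contMDiff_zeroSection ℝ (Cotangent n M))

lemma apply_of_mem_zero {P : rayAlg n M} (hP : P ∈ (grading n M).part 0)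
    (z : CotangentBundle n M) : P.1 z = onBase P z.1 := by
  have := (mem_part.1 hP).2 z 0
  simp only [zero_smul, pow_zero, one_mul] at this
  exact this.symm

lemma eq_pull_onBase {P : rayAlg n M} (hP : P ∈ (grading n M).part 0) :
    P = pull (onBase P) (contMDiff_onBase P) :=
  Subtype.ext (funext fun z => apply_of_mem_zero hP z)

lemma smooth_cutoff {χ : M → ℝ} (hχ : ContMDiff (𝓡 n) 𝓘(ℝ, ℝ) ∞ χ) {x₀ : M}
    (hs : tsupport χ ⊆ (chartAt (Model n) x₀).source) {g : CotangentBundle n M → ℝ}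
    (hg : ContMDiffOn (cotModel n) 𝓘(ℝ, ℝ) ∞ g (cotChart x₀).source) :
    Smooth (fun z : CotangentBundle n M => χ z.1 * g z) := by
  intro z
  by_cases hz : z.1 ∈ tsupport χ
  · exact (smooth_comp_proj hχ z).mul (hg.contMDiffAt
      ((isOpen_cotChart_source x₀).mem_nhds (mem_cotChart_source.2 (hs hz))))
  · refine (contMDiffAt_const (c := (0 : ℝ))).congr_of_eventuallyEq ?_
    have h1 : χ =ᶠ[𝓝 z.1] 0 := notMem_tsupport_iff_eventuallyEq.1 hz
    have hc : ContinuousAt (fun z : CotangentBundle n M => z.1) z :=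
      (FiberBundle.continuous_proj _ _).continuousAt
    filter_upwards [hc.eventually h1] with y hy
    rw [hy]
    simp

lemma contMDiffOn_coord (x₀ : M) {L : Model n × (Model n →L[ℝ] ℝ) → ℝ} (hL : ContDiff ℝ ∞ L) :
    ContMDiffOn (cotModel n) 𝓘(ℝ, ℝ) ∞ (fun z : CotangentBundle n M => L (cotChart x₀ z))
      (cotChart x₀).source :=
  hL.contMDiff.comp_contMDiffOn (contMDiffOn_cotChart x₀)

/-- Elements of `S₀(M)` and `S₁(M)` that coincide near `x₁` with the canonical coordinates of the
chart at `x₀`, the positions being normalized to vanish at `x₁`. -/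
structure CoordFrame (x₀ x₁ : M) where
  q : Fin n → rayAlg n M
  p : Fin n → rayAlg n M
  nhd : Set M
  isOpen_nhd : IsOpen nhd
  mem_nhd : x₁ ∈ nhd
  nhd_subset : nhd ⊆ (chartAt (Model n) x₀).source
  q_mem : ∀ j, q j ∈ (grading n M).part 0
  p_mem : ∀ j, p j ∈ (grading n M).part 1
  q_eq : ∀ j (z : CotangentBundle n M), z.1 ∈ nhd →
    (q j).1 z = (cotChart x₀ z).1 j - extChartAt (𝓡 n) x₀ x₁ j
  p_eq : ∀ j (z : CotangentBundle n M), z.1 ∈ nhd →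
    (p j).1 z = (cotChart x₀ z).2 (EuclideanSpace.single j 1)

lemma exists_bump [T2Space M] {x₁ : M} {U : Set M} (hU : U ∈ 𝓝 x₁) :
    ∃ χ : M → ℝ, ContMDiff (𝓡 n) 𝓘(ℝ, ℝ) ∞ χ ∧ tsupport χ ⊆ U ∧ χ =ᶠ[𝓝 x₁] 1 := by
  obtain ⟨f, -, hf⟩ := (SmoothBumpFunction.nhds_basis_tsupport (I := 𝓡 n) x₁).mem_iff.1 hU
  exact ⟨f, f.contMDiff, hf, f.eventuallyEq_one⟩

lemma cotChart_smul {x₀ : M} {z : CotangentBundle n M} (hz : z.1 ∈ (chartAt (Model n) x₀).source)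
    (t : ℝ) : cotChart x₀ (⟨z.1, t • z.2⟩ : CotangentBundle n M) =
      ((cotChart x₀ z).1, t • (cotChart x₀ z).2) := by
  rw [cotChart_apply (z := ⟨z.1, t • z.2⟩) hz, cotChart_apply hz]
  rfl

/-- The element of `S(M)` given by cutting off a function of the coordinates. -/
lemma cutoff_mem {χ : M → ℝ} (hχ : ContMDiff (𝓡 n) 𝓘(ℝ, ℝ) ∞ χ) {x₀ : M}
    (hs : tsupport χ ⊆ (chartAt (Model n) x₀).source) {i : ℕ}
    {L : Model n × (Model n →L[ℝ] ℝ) → ℝ} (hL : ContDiff ℝ ∞ L)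
    (hi : ∀ q p (t : ℝ), L (q, t • p) = t ^ i * L (q, p)) :
    (fun z : CotangentBundle n M => χ z.1 * L (cotChart x₀ z)) ∈ homogeneousPart n M i := by
  refine mem_homogeneousPart_iff.2 ⟨smooth_cutoff hχ hs (contMDiffOn_coord x₀ hL), fun z t => ?_⟩
  by_cases hz : z.1 ∈ (chartAt (Model n) x₀).source
  · simp only
    rw [cotChart_smul hz, hi]
    ring
  · have : χ z.1 = 0 := image_eq_zero_of_notMem_tsupport fun h => hz (hs h)
    simp [this]

lemma exists_coordFrame [T2Space M] {x₀ x₁ : M} (h : x₁ ∈ (chartAt (Model n) x₀).source) :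
    Nonempty (CoordFrame (n := n) x₀ x₁) := by
  obtain ⟨χ, hχ, hs, h1⟩ := exists_bump (n := n) ((chartAt (Model n) x₀).open_source.mem_nhds h)
  have hq : ∀ j, (fun z : CotangentBundle n M => χ z.1 *
      ((cotChart x₀ z).1 j - extChartAt (𝓡 n) x₀ x₁ j)) ∈ homogeneousPart n M 0 := fun j =>
    cutoff_mem hχ hs (L := fun w => w.1 j - extChartAt (𝓡 n) x₀ x₁ j) (by fun_prop) (by simp)
  have hp : ∀ j, (fun z : CotangentBundle n M => χ z.1 *
      ((cotChart x₀ z).2 (EuclideanSpace.single j 1))) ∈ homogeneousPart n M 1 := fun j =>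
    cutoff_mem hχ hs (L := fun w => w.2 (EuclideanSpace.single j 1)) (by fun_prop) (by simp)
  obtain ⟨U, hU, hUo, hxU⟩ := mem_nhds_iff.1
    (Filter.inter_mem h1 ((chartAt (Model n) x₀).open_source.mem_nhds h))
  exact ⟨{
    q := fun j => ⟨_, mem_rayAlg_of_mem (hq j)⟩
    p := fun j => ⟨_, mem_rayAlg_of_mem (hp j)⟩
    nhd := U
    isOpen_nhd := hUo
    mem_nhd := hxU
    nhd_subset := fun x hx => (hU hx).2
    q_mem := hq
    p_mem := hp
    q_eq := fun j z hz => by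
      have : χ z.1 = 1 := (hU hz).1
      simp [this]
    p_eq := fun j z hz => by
      have : χ z.1 = 1 := (hU hz).1
      simp [this] }⟩

/-- The derivative of `P` at `z` in the coordinates of the chart at `x₀`. -/
def chartDeriv (x₀ : M) (P : CotangentBundle n M → ℝ) (z : CotangentBundle n M) :
    Model n × (Model n →L[ℝ] ℝ) →L[ℝ] ℝ :=
  fderiv ℝ (P ∘ (cotChart x₀).symm) (cotChart x₀ z)

lemma Smooth.hasFDerivAt_chart {P : CotangentBundle n M → ℝ} (hP : Smooth P) {x₀ : M}
    {z : CotangentBundle n M} (hz : z.1 ∈ (chartAt (Model n) x₀).source) :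
    HasFDerivAt (P ∘ (cotChart x₀).symm) (chartDeriv x₀ P z) (cotChart x₀ z) := by
  refine ((hP.contDiffAt_symm ?_).differentiableAt (by simp)).hasFDerivAt
  rw [cotChart_apply_fst hz]
  exact mem_target_of_mem_source hz

lemma chartDeriv_eq_of_eventuallyEq {P : CotangentBundle n M → ℝ} {x₀ : M} {U : Set M}
    (hU : IsOpen U) {z : CotangentBundle n M} (hzU : z.1 ∈ U)
    (hz : z.1 ∈ (chartAt (Model n) x₀).source) {L : Model n × (Model n →L[ℝ] ℝ) → ℝ}
    {L' : Model n × (Model n →L[ℝ] ℝ) →L[ℝ] ℝ} (hL : HasFDerivAt L L' (cotChart x₀ z))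
    (h : ∀ z : CotangentBundle n M, z.1 ∈ U → P z = L (cotChart x₀ z)) :
    chartDeriv x₀ P z = L' := by
  refine (hL.congr_of_eventuallyEq ?_).fderiv
  have hfst := cotChart_apply_fst hz
  have h1 := eventually_symm_mem hz (hU.mem_nhds hzU)
  have h2 := eventually_mem_target hz
  rw [← hfst] at h1 h2
  filter_upwards [continuousAt_fst.eventually (h1.and h2)] with w hw
  simp only [Function.comp_apply]
  rw [h, (cotChart x₀).right_inv (mem_cotChart_target.2 hw.2)]
  rw [cotChart_symm_proj hw.2]
  exact hw.1

/-- Euler's identity along the fibres. -/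
lemma Homog.euler {i : ℕ} {P : CotangentBundle n M → ℝ} (hs : Smooth P) (hP : Homog i P) {x₀ : M}
    {z : CotangentBundle n M} (hz : z.1 ∈ (chartAt (Model n) x₀).source) :
    chartDeriv x₀ P z (0, (cotChart x₀ z).2) = i * P z := by
  have h1 := hs.hasFDerivAt_chart hz
  -- Differentiate `P (t α) = t ^ i P α` at `t = 1`.
  have hc : HasDerivAt (fun t : ℝ => ((cotChart x₀ z).1, t • (cotChart x₀ z).2))
      ((0 : Model n), (cotChart x₀ z).2) 1 := by
    have h2 := (hasDerivAt_id (1 : ℝ)).smul_const (cotChart x₀ z).2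
    simp only [id, one_smul] at h2
    exact (hasDerivAt_const _ _).prodMk h2
  have h1' : HasFDerivAt (P ∘ (cotChart x₀).symm) (chartDeriv x₀ P z)
      ((fun t : ℝ => ((cotChart x₀ z).1, t • (cotChart x₀ z).2)) 1) := by
    simpa using h1
  have h3 := h1'.comp_hasDerivAt 1 hc
  have h4 : ((P ∘ (cotChart x₀).symm) ∘ fun t : ℝ => ((cotChart x₀ z).1, t • (cotChart x₀ z).2)) =
      fun t => t ^ i * P z := by
    funext t
    simp only [Function.comp_apply]
    rw [← cotChart_smul hz, (cotChart x₀).left_inv (x := (⟨z.1, t • z.2⟩ : CotangentBundle n M))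
      (mem_cotChart_source.2 hz), hP]
  rw [h4] at h3
  have h5 := (hasDerivAt_pow i (1 : ℝ)).mul_const (P z)
  have := h3.unique h5
  simpa using this

namespace CoordFrame

variable {x₀ x₁ : M} (F : CoordFrame (n := n) x₀ x₁) {z : CotangentBundle n M}

lemma chartDeriv_q (hz : z.1 ∈ F.nhd) (j : Fin n) : chartDeriv x₀ (F.q j).1 z =
    (EuclideanSpace.proj j : Model n →L[ℝ] ℝ).comp (ContinuousLinearMap.fst ℝ _ _) := by
  refine chartDeriv_eq_of_eventuallyEq F.isOpen_nhd hz (F.nhd_subset hz)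
    (L := fun w => w.1 j - extChartAt (𝓡 n) x₀ x₁ j) ?_ (F.q_eq j)
  exact (((EuclideanSpace.proj j : Model n →L[ℝ] ℝ).comp
    (ContinuousLinearMap.fst ℝ _ (Model n →L[ℝ] ℝ))).hasFDerivAt).sub_const _

lemma chartDeriv_p (hz : z.1 ∈ F.nhd) (j : Fin n) : chartDeriv x₀ (F.p j).1 z =
    (ContinuousLinearMap.apply ℝ ℝ (EuclideanSpace.single j (1 : ℝ) : Model n)).comp
      (ContinuousLinearMap.snd ℝ (Model n) (Model n →L[ℝ] ℝ)) := by
  refine chartDeriv_eq_of_eventuallyEq F.isOpen_nhd hz (F.nhd_subset hz)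
    (L := fun w => w.2 (EuclideanSpace.single j 1)) ?_ (F.p_eq j)
  exact ContinuousLinearMap.hasFDerivAt ((ContinuousLinearMap.apply ℝ ℝ
    (EuclideanSpace.single j (1 : ℝ) : Model n)).comp
      (ContinuousLinearMap.snd ℝ (Model n) (Model n →L[ℝ] ℝ)))

lemma br_q (P : rayAlg n M) (hz : z.1 ∈ F.nhd) (j : Fin n) :
    ((grading n M).br P (F.q j)).1 z = chartDeriv x₀ P.1 z (0, EuclideanSpace.proj j) := by
  rw [br_apply, poisson_eq_pairing_of_mem P.2.1 (F.q j).2.1 (F.nhd_subset hz)]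
  change pairing (chartDeriv x₀ P.1 z) (chartDeriv x₀ (F.q j).1 z) = _
  rw [F.chartDeriv_q hz, pairing, Finset.sum_eq_single j]
  · simp
  · intro i _ hij
    simp [hij]
  · simp

lemma br_p (P : rayAlg n M) (hz : z.1 ∈ F.nhd) (j : Fin n) :
    ((grading n M).br P (F.p j)).1 z =
      -chartDeriv x₀ P.1 z (EuclideanSpace.single j 1, 0) := by
  rw [br_apply, poisson_eq_pairing_of_mem P.2.1 (F.p j).2.1 (F.nhd_subset hz)]
  change pairing (chartDeriv x₀ P.1 z) (chartDeriv x₀ (F.p j).1 z) = _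
  rw [F.chartDeriv_p hz, pairing, Finset.sum_eq_single j]
  · simp
  · intro i _ hij
    simp [hij]
  · simp

lemma br_p_p (hz : z.1 ∈ F.nhd) (i j : Fin n) :
    ((grading n M).br (F.p i) (F.p j)).1 z = 0 := by
  rw [F.br_p _ hz, F.chartDeriv_p hz]
  simp

/-- Euler's identity with the momentum derivatives written as brackets with the positions. In degree
one it expands a vector field in the local frame `p j`. -/
lemma euler {i : ℕ} {P : rayAlg n M} (hP : P ∈ (grading n M).part i) (hz : z.1 ∈ F.nhd) :
    ∑ j, (F.p j).1 z * ((grading n M).br P (F.q j)).1 z = i * P.1 z := by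
  rw [← (mem_part.1 hP).2.euler P.2.1 (F.nhd_subset hz), dual_eq_sum (cotChart x₀ z).2]
  have : ((0 : Model n), ∑ j, (cotChart x₀ z).2 (EuclideanSpace.single j 1) •
      (EuclideanSpace.proj j : Model n →L[ℝ] ℝ)) = ∑ j, (cotChart x₀ z).2 (EuclideanSpace.single j 1) •
      ((0 : Model n), (EuclideanSpace.proj j : Model n →L[ℝ] ℝ)) := by
    ext1
    · rw [Prod.fst_sum]; simp
    · rw [Prod.snd_sum]; rfl
  rw [this, map_sum]
  refine Finset.sum_congr rfl fun j _ => ?_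
  rw [F.p_eq j z hz, F.br_q P hz, map_smul, smul_eq_mul]

end CoordFrame

end Grading

/-! ### Centralizers, exponentials and locality. -/

section Center

variable {n : ℕ} {M : Type*} [TopologicalSpace M] [ChartedSpace (Model n) M]
  [IsManifold (𝓡 n) ∞ M]

lemma chartDeriv_fibre {P : CotangentBundle n M → ℝ} (hP : Smooth P) (x : M)
    (α : Model n →L[ℝ] ℝ) :
    HasFDerivAt (fun α : Model n →L[ℝ] ℝ => P (⟨x, α⟩ : CotangentBundle n M))
      ((chartDeriv x P ⟨x, α⟩).comp (ContinuousLinearMap.inr ℝ _ _)) α := by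
  have hx := mem_chart_source (Model n) x
  have h1 := hP.hasFDerivAt_chart (x₀ := x) (z := ⟨x, α⟩) hx
  have h2 : HasFDerivAt (fun β : Model n →L[ℝ] ℝ => (extChartAt (𝓡 n) x x, β))
      (ContinuousLinearMap.inr ℝ (Model n) (Model n →L[ℝ] ℝ)) α :=
    (hasFDerivAt_const _ _).prodMk (hasFDerivAt_id α)
  have e : cotChart x (⟨x, α⟩ : CotangentBundle n M) = (extChartAt (𝓡 n) x x, α) :=
    cotChart_self_apply (⟨x, α⟩ : CotangentBundle n M)
  rw [e] at h1
  refine (h1.comp α h2).congr_of_eventuallyEq (Filter.Eventually.of_forall fun β => ?_)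
  have h3 := cotChart_self_apply (⟨x, β⟩ : CotangentBundle n M)
  have h4 := (cotChart x).left_inv (x := (⟨x, β⟩ : CotangentBundle n M)) (mem_cotChart_source.2 hx)
  exact congrArg P (h4.symm.trans (congrArg (cotChart x).symm h3))

/-- The centralizer of `S₀(M)` is `S₀(M)`. -/
theorem mem_part_zero_of_br_eq_zero [T2Space M] (P : rayAlg n M)
    (h : ∀ f ∈ (grading n M).part 0, (grading n M).br P f = 0) : P ∈ (grading n M).part 0 := by
  refine mem_part.2 ⟨P.2.1, fun z t => ?_⟩
  obtain ⟨x, α⟩ := z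
  obtain ⟨F⟩ := exists_coordFrame (n := n) (mem_chart_source (Model n) x)
  -- Brackets with the positions are the fibre derivatives, so `P` is constant on the fibre over
  -- `x`.
  have hz : ∀ β : Model n →L[ℝ] ℝ, (chartDeriv x P.1 ⟨x, β⟩).comp
      (ContinuousLinearMap.inr ℝ (Model n) (Model n →L[ℝ] ℝ)) = 0 := by
    intro β
    ext ρ
    rw [ContinuousLinearMap.comp_apply, dual_eq_sum ρ, map_sum, map_sum]
    refine Finset.sum_eq_zero fun j _ => ?_
    have h1 := F.br_q P (z := ⟨x, β⟩) F.mem_nhd j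
    rw [h _ (F.q_mem j)] at h1
    rw [map_smul, map_smul, ContinuousLinearMap.inr_apply, ← h1]
    simp
  have hconst := is_const_of_fderiv_eq_zero (𝕜 := ℝ)
    (f := fun α : Model n →L[ℝ] ℝ => P.1 (⟨x, α⟩ : CotangentBundle n M))
    (fun β => (chartDeriv_fibre P.2.1 x β).differentiableAt)
    (fun β => by rw [(chartDeriv_fibre P.2.1 x β).fderiv, hz])
  rw [pow_zero, one_mul]
  exact hconst _ _

lemma hasFDerivAt_onBase {P : rayAlg n M} {x₀ x : M} (hx : x ∈ (chartAt (Model n) x₀).source)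
    (hP : P ∈ (grading n M).part 0) :
    HasFDerivAt (onBase P ∘ (extChartAt (𝓡 n) x₀).symm)
      ((chartDeriv x₀ P.1 ⟨x, 0⟩).comp (ContinuousLinearMap.inl ℝ _ _)) (extChartAt (𝓡 n) x₀ x) := by
  have h1 := P.2.1.hasFDerivAt_chart (x₀ := x₀) (z := ⟨x, 0⟩) hx
  have e : cotChart x₀ (⟨x, 0⟩ : CotangentBundle n M) = (extChartAt (𝓡 n) x₀ x, 0) := by
    rw [cotChart_apply hx]
    exact Prod.ext rfl (ContinuousLinearMap.zero_comp _)
  have h2 : HasFDerivAt (fun q : Model n => (q, (0 : Model n →L[ℝ] ℝ)))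
      (ContinuousLinearMap.inl ℝ (Model n) (Model n →L[ℝ] ℝ)) (extChartAt (𝓡 n) x₀ x) :=
    (hasFDerivAt_id _).prodMk (hasFDerivAt_const _ _)
  rw [e] at h1
  refine ((HasFDerivAt.comp (f := fun q : Model n => (q, (0 : Model n →L[ℝ] ℝ)))
    (extChartAt (𝓡 n) x₀ x) h1 h2)).congr_of_eventuallyEq ?_
  filter_upwards [eventually_mem_target hx] with q hq
  simp only [Function.comp_apply]
  rw [apply_of_mem_zero hP, cotChart_symm_proj (w := (q, 0)) hq]

/-- Elements of `S₀(M)` that commute with `S₁(M)` are constant. -/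
theorem const_of_br_eq_zero [T2Space M] [ConnectedSpace M] {a : rayAlg n M}
    (ha : a ∈ (grading n M).part 0)
    (h : ∀ X ∈ (grading n M).part 1, (grading n M).br X a = 0) :
    ∃ r : ℝ, a = algebraMap ℝ (rayAlg n M) r := by
  -- Brackets with the momenta are, up to sign, the position derivatives; they vanish on a ball in
  -- the chart. Connectedness of `M` makes the local constant global.
  have hloc : IsLocallyConstant (onBase a) := by
    rw [IsLocallyConstant.iff_eventually_eq]
    intro x
    have hx := mem_chart_source (Model n) x
    obtain ⟨F⟩ := exists_coordFrame (n := n) hx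
    have h1 := (eventually_mem_target hx).and (eventually_symm_mem hx (F.isOpen_nhd.mem_nhds F.mem_nhd))
    obtain ⟨ε, hε, hball⟩ := Metric.eventually_nhds_iff_ball.1 h1
    have hd : ∀ q ∈ Metric.ball (extChartAt (𝓡 n) x x) ε,
        HasFDerivAt (onBase a ∘ (extChartAt (𝓡 n) x).symm) (0 : Model n →L[ℝ] ℝ) q := by
      intro q hq
      obtain ⟨hqt, hqF⟩ := hball q hq
      have h2 := hasFDerivAt_onBase (symm_mem_source hqt) ha
      rw [(extChartAt (𝓡 n) x).right_inv hqt] at h2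
      convert h2 using 1
      ext v
      rw [ContinuousLinearMap.comp_apply, model_eq_sum v, map_sum, map_sum, map_sum]
      refine Finset.sum_congr rfl fun j _ => ?_
      have h3 := F.br_p a (z := ⟨(extChartAt (𝓡 n) x).symm q, 0⟩) hqF j
      rw [(grading n M).br_swap, h _ (F.p_mem j)] at h3
      have h4 : chartDeriv x a.1 ⟨(extChartAt (𝓡 n) x).symm q, 0⟩
          (EuclideanSpace.single j 1, 0) = 0 := by
        rw [← neg_eq_zero, ← h3]; simp
      rw [map_smul, map_smul, map_smul, ContinuousLinearMap.inl_apply, h4]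
      simp
    have hcont := continuousAt_extChartAt (I := 𝓡 n) x
    filter_upwards [hcont.eventually (Metric.ball_mem_nhds _ hε),
      (chartAt (Model n) x).open_source.mem_nhds hx] with y hy hys
    have h5 := Metric.isOpen_ball.is_const_of_fderiv_eq_zero (𝕜 := ℝ)
      (convex_ball _ ε).isPreconnected
      (fun q hq => (hd q hq).differentiableAt.differentiableWithinAt)
      (fun q hq => (hd q hq).fderiv) hy (Metric.mem_ball_self hε)
    simpa only [Function.comp_apply, chart_left_inv hx, chart_left_inv hys] using h5
  obtain ⟨x₀⟩ : Nonempty M := inferInstance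
  refine ⟨onBase a x₀, Subtype.ext (funext fun z => ?_)⟩
  rw [apply_of_mem_zero ha, hloc.apply_eq_of_isPreconnected isPreconnected_univ
    (Set.mem_univ z.1) (Set.mem_univ x₀)]
  rfl

/-- The units are `e^f` and `e^(-f)`, and the chain rule gives the bracket formula. They are the
test elements that detect elements outside degree zero. -/
lemma exists_exp {f : rayAlg n M} (hf : f ∈ (grading n M).part 0) :
    ∃ u v : rayAlg n M, u * v = 1 ∧
      ∀ P, (grading n M).br P u = u * (grading n M).br P f := by
  have hs := contMDiff_onBase f
  have h1 : ContMDiff (𝓡 n) 𝓘(ℝ, ℝ) ∞ (fun x => Real.exp (onBase f x)) :=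
    Real.contDiff_exp.contMDiff.comp hs
  have h2 : ContMDiff (𝓡 n) 𝓘(ℝ, ℝ) ∞ (fun x => Real.exp (-onBase f x)) :=
    Real.contDiff_exp.contMDiff.comp hs.neg
  refine ⟨pull _ h1, pull _ h2, Subtype.ext (funext fun z => ?_), fun P =>
    Subtype.ext (funext fun z => ?_)⟩
  · change Real.exp _ * Real.exp _ = 1
    rw [← Real.exp_add, add_neg_cancel, Real.exp_zero]
  · have e : (pull _ h1).1 = fun z => Real.exp (f.1 z) :=
      funext fun z => by rw [apply_of_mem_zero hf]; rfl
    have hd : phaseDeriv (pull _ h1).1 z = Real.exp (f.1 z) • phaseDeriv f.1 z := by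
      rw [(pull _ h1).2.1.phaseDeriv_eq, f.2.1.phaseDeriv_eq, e]
      have := (f.2.1.differentiableAt z).hasFDerivAt.exp.fderiv
      simp only [Function.comp_apply, cotChart_symm_self] at this
      exact this
    rw [br_apply, poisson_apply, hd, pairing_smul_right]
    change _ = (pull _ h1).1 z * poisson P.1 f.1 z
    rw [e]
    rfl

lemma eq_zero_of_ringHom (P : rayAlg n M) (h : ∀ ev : rayAlg n M →+* ℝ, ev P = 0) : P = 0 :=
  Subtype.ext (funext fun z => h ((Pi.evalRingHom (fun _ => ℝ) z).comp (rayAlg n M).subtype))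

lemma br_congr {P Q : rayAlg n M} {U : Set M} (hU : IsOpen U)
    (h : ∀ z : CotangentBundle n M, z.1 ∈ U → P.1 z = Q.1 z) (f : rayAlg n M)
    {z : CotangentBundle n M} (hz : z.1 ∈ U) :
    ((grading n M).br P f).1 z = ((grading n M).br Q f).1 z := by
  have hc : ContinuousAt (fun z : CotangentBundle n M => z.1) z :=
    (FiberBundle.continuous_proj _ _).continuousAt
  have he : P.1 =ᶠ[𝓝 z] Q.1 := by
    filter_upwards [hc.eventually (hU.mem_nhds hz)] with y hy using h y hy
  have hd : phaseDeriv P.1 z = phaseDeriv Q.1 z := he.mfderiv_eq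
  rw [br_apply, br_apply, poisson_apply, poisson_apply, hd]

end Center

/-! ### Locally finite sums in `S(M)`. -/

section LocallyFiniteSums

variable {n : ℕ} {M : Type*} [TopologicalSpace M] [ChartedSpace (Model n) M]
  [IsManifold (𝓡 n) ∞ M]

/-- A locally finite family of subsets of `M`, with chosen neighbourhoods that meet only finitely
many of the sets. -/
structure LocFin {ι : Type*} (S : ι → Set M) where
  nhd : M → Set M
  idx : M → Finset ι
  isOpen_nhd : ∀ x, IsOpen (nhd x)
  mem_nhd : ∀ x, x ∈ nhd x
  notMem : ∀ x, ∀ y ∈ nhd x, ∀ j ∉ idx x, y ∉ S j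

lemma exists_locFin {ι : Type*} {S : ι → Set M} (hS : LocallyFinite S) : Nonempty (LocFin S) := by
  have : ∀ x, ∃ (U : Set M) (J : Finset ι), IsOpen U ∧ x ∈ U ∧ ∀ y ∈ U, ∀ j ∉ J, y ∉ S j := by
    intro x
    obtain ⟨t, ht, hf⟩ := hS x
    obtain ⟨U, hUt, hU, hxU⟩ := mem_nhds_iff.1 ht
    refine ⟨U, hf.toFinset, hU, hxU, fun y hy j hj hyj => hj ?_⟩
    exact hf.mem_toFinset.2 ⟨y, hyj, hUt hy⟩
  choose U J h1 h2 h3 using this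
  exact ⟨⟨U, J, h1, h2, h3⟩⟩

namespace LocFin

variable {ι : Type*} {S : ι → Set M} (L : LocFin S) {P : ι → rayAlg n M}

lemma sum_eq_of_subset (hP : ∀ i z, z.1 ∉ S i → (P i).1 z = 0) {x : M} {J : Finset ι}
    (hJ : L.idx x ⊆ J) {z : CotangentBundle n M} (hz : z.1 ∈ L.nhd x) :
    ∑ j ∈ J, (P j).1 z = ∑ j ∈ L.idx x, (P j).1 z :=
  (Finset.sum_subset hJ fun j _ hj => hP j z (L.notMem x _ hz j hj)).symm

/-- Both index sets are compared with their union, whose extra terms vanish at `z`. Hence a sum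
whose index set varies with the base point is, near `x`, a fixed finite sum. -/
lemma sum_eq_sum (hP : ∀ i z, z.1 ∉ S i → (P i).1 z = 0) {x : M} {z : CotangentBundle n M}
    (hz : z.1 ∈ L.nhd x) :
    ∑ j ∈ L.idx z.1, (P j).1 z = ∑ j ∈ L.idx x, (P j).1 z := by
  classical
  rw [← L.sum_eq_of_subset hP (Finset.subset_union_left (s₂ := L.idx z.1)) hz,
    ← L.sum_eq_of_subset hP (Finset.subset_union_right (s₁ := L.idx x)) (L.mem_nhd z.1)]

lemma coe_sum (J : Finset ι) (z : CotangentBundle n M) :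
    (∑ j ∈ J, P j : rayAlg n M).1 z = ∑ j ∈ J, (P j).1 z := by
  rw [AddSubmonoidClass.coe_finsetSum, Finset.sum_apply]

/-- A locally finite sum of elements of `S_m(M)`. -/
lemma sum_mem (hP : ∀ i z, z.1 ∉ S i → (P i).1 z = 0) {m : ℕ}
    (hm : ∀ i, P i ∈ (grading n M).part m) :
    (fun z => ∑ j ∈ L.idx z.1, (P j).1 z) ∈ homogeneousPart n M m := by
  refine mem_homogeneousPart_iff.2 ⟨fun z => ?_, fun z t => ?_⟩
  · have hc : ContinuousAt (fun z : CotangentBundle n M => z.1) z :=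
      (FiberBundle.continuous_proj _ _).continuousAt
    refine ((∑ j ∈ L.idx z.1, P j : rayAlg n M).2.1 z).congr_of_eventuallyEq ?_
    filter_upwards [hc.eventually ((L.isOpen_nhd z.1).mem_nhds (L.mem_nhd z.1))] with y hy
    rw [L.sum_eq_sum hP hy, ← coe_sum]
  · simp only
    rw [Finset.mul_sum]
    exact Finset.sum_congr rfl fun j _ => (mem_part.1 (hm j)).2 z t

/-- A locally finite sum. -/
def sum (hP : ∀ i z, z.1 ∉ S i → (P i).1 z = 0) {m : ℕ}
    (hm : ∀ i, P i ∈ (grading n M).part m) : rayAlg n M :=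
  ⟨_, mem_rayAlg_of_mem (L.sum_mem hP hm)⟩

lemma sum_mem_part (hP : ∀ i z, z.1 ∉ S i → (P i).1 z = 0) {m : ℕ}
    (hm : ∀ i, P i ∈ (grading n M).part m) : L.sum hP hm ∈ (grading n M).part m :=
  L.sum_mem hP hm

lemma sum_apply (hP : ∀ i z, z.1 ∉ S i → (P i).1 z = 0) {m : ℕ}
    (hm : ∀ i, P i ∈ (grading n M).part m) {x : M} {J : Finset ι} (hJ : L.idx x ⊆ J)
    {z : CotangentBundle n M} (hz : z.1 ∈ L.nhd x) :
    (L.sum hP hm).1 z = (∑ j ∈ J, P j : rayAlg n M).1 z := by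
  rw [coe_sum, L.sum_eq_of_subset hP hJ hz]
  exact L.sum_eq_sum hP hz

lemma br_sum (hP : ∀ i z, z.1 ∉ S i → (P i).1 z = 0) {m : ℕ}
    (hm : ∀ i, P i ∈ (grading n M).part m) {x : M} {J : Finset ι} (hJ : L.idx x ⊆ J)
    (f : rayAlg n M) {z : CotangentBundle n M} (hz : z.1 ∈ L.nhd x) :
    ((grading n M).br (L.sum hP hm) f).1 z = ∑ j ∈ J, ((grading n M).br (P j) f).1 z := by
  rw [br_congr (L.isOpen_nhd x) (fun z hz => L.sum_apply hP hm hJ hz) f hz, map_sum,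
    LinearMap.sum_apply, coe_sum]

end LocFin

end LocallyFiniteSums

/-! ### Cut-off coordinates. -/

section Bump

variable {n : ℕ} {M : Type*} [TopologicalSpace M] [ChartedSpace (Model n) M]
  [IsManifold (𝓡 n) ∞ M] [T2Space M] {c : M} (χ : SmoothBumpFunction (𝓡 n) c)

/-- The momentum `p_k` of the chart at `c`, cut off. -/
def cutP (k : Fin n) : rayAlg n M :=
  ⟨_, mem_rayAlg_of_mem (cutoff_mem χ.contMDiff χ.tsupport_subset_chartAt_source (i := 1)
    (L := fun w => w.2 (EuclideanSpace.single k 1)) (by fun_prop) (by simp))⟩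

/-- The position `q_k` of the chart at `c`, cut off. -/
def cutQ (k : Fin n) : rayAlg n M :=
  ⟨_, mem_rayAlg_of_mem (cutoff_mem χ.contMDiff χ.tsupport_subset_chartAt_source (i := 0)
    (L := fun w => w.1 k) (by fun_prop) (by simp))⟩

lemma cutP_mem (k : Fin n) : cutP χ k ∈ (grading n M).part 1 :=
  cutoff_mem χ.contMDiff χ.tsupport_subset_chartAt_source
    (L := fun w => w.2 (EuclideanSpace.single k 1)) (by fun_prop) (by simp)

lemma cutQ_mem (k : Fin n) : cutQ χ k ∈ (grading n M).part 0 :=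
  cutoff_mem χ.contMDiff χ.tsupport_subset_chartAt_source
    (L := fun w => w.1 k) (by fun_prop) (by simp)

lemma cutP_apply (k : Fin n) (z : CotangentBundle n M) :
    (cutP χ k).1 z = χ z.1 * (cotChart c z).2 (EuclideanSpace.single k 1) := rfl

lemma cutQ_apply (k : Fin n) (z : CotangentBundle n M) :
    (cutQ χ k).1 z = χ z.1 * (cotChart c z).1 k := rfl

/-- A bump function is maximal where it equals one, so its derivative vanishes there and the product
rule leaves `L`. This holds also on the boundary of the closed set where the bump is one. -/
lemma chartDeriv_cutoff {x : M} (hx : χ x = 1) {L : Model n × (Model n →L[ℝ] ℝ) →L[ℝ] ℝ}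
    {P : rayAlg n M} (hP : ∀ z, P.1 z = χ z.1 * L (cotChart c z))
    {z : CotangentBundle n M} (hz : z.1 = x) : chartDeriv c P.1 z = L := by
  subst hz
  have hzs : z.1 ∈ (chartAt (Model n) c).source := χ.support_subset_source (by simp [hx])
  have h1 := (pull χ χ.contMDiff).2.1.hasFDerivAt_chart hzs
  have hmax : IsLocalMax ((pull χ χ.contMDiff).1 ∘ (cotChart c).symm) (cotChart c z) := by
    refine Filter.Eventually.of_forall fun w => ?_
    simp only [Function.comp_apply]
    rw [(cotChart c).left_inv (mem_cotChart_source.2 hzs)]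
    change χ _ ≤ χ z.1
    rw [hx]
    exact χ.le_one
  have h0 : chartDeriv c (pull χ χ.contMDiff).1 z = 0 := hmax.fderiv_eq_zero
  rw [h0] at h1
  have h2 := h1.mul L.hasFDerivAt
  have e : ((pull χ χ.contMDiff).1 ∘ (cotChart c).symm) (cotChart c z) = 1 := by
    simp only [Function.comp_apply]
    rw [(cotChart c).left_inv (mem_cotChart_source.2 hzs)]
    exact hx
  rw [e] at h2
  have h3 := P.2.1.hasFDerivAt_chart hzs
  refine (h3.congr_of_eventuallyEq ?_).unique (h2.congr_fderiv (by simp))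
  have h4 := eventually_mem_target hzs
  rw [← cotChart_apply_fst hzs] at h4
  filter_upwards [continuousAt_fst.eventually h4] with w hw
  simp only [Function.comp_apply, Pi.mul_apply]
  rw [hP, (cotChart c).right_inv (mem_cotChart_target.2 hw)]
  rfl

lemma br_cutP_cutQ {x : M} (hx : χ x = 1) (k l : Fin n) {z : CotangentBundle n M} (hz : z.1 = x) :
    ((grading n M).br (cutP χ k) (cutQ χ l)).1 z = if k = l then 1 else 0 := by
  have hzs : z.1 ∈ (chartAt (Model n) c).source :=
    χ.support_subset_source (by rw [hz]; simp [hx])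
  rw [br_apply, poisson_eq_pairing_of_mem (cutP χ k).2.1 (cutQ χ l).2.1 hzs]
  change pairing (chartDeriv c (cutP χ k).1 z) (chartDeriv c (cutQ χ l).1 z) = _
  rw [chartDeriv_cutoff χ hx (L := (ContinuousLinearMap.apply ℝ ℝ
      (EuclideanSpace.single k (1 : ℝ) : Model n)).comp
      (ContinuousLinearMap.snd ℝ (Model n) (Model n →L[ℝ] ℝ))) (fun _ => rfl) hz,
    chartDeriv_cutoff χ hx (L := (EuclideanSpace.proj l : Model n →L[ℝ] ℝ).comp
      (ContinuousLinearMap.fst ℝ _ _)) (fun _ => rfl) hz, pairing, Finset.sum_eq_single l]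
  · simp [eq_comm]
  · intro i _ hij
    simp [hij]
  · simp

end Bump

/-! ### The unit as a sum of two brackets. -/

section Nonsingular

variable {n : ℕ} {M : Type*} [TopologicalSpace M] [ChartedSpace (Model n) M]
  [IsManifold (𝓡 n) ∞ M] [T2Space M] {ι : Type*} (fs : SmoothBumpCovering ι (𝓡 n) M Set.univ)
  (L : LocFin fun i => Function.support (fs i))

lemma combTerm_eq_zero (a : ι → Fin n → ℝ) (j : ι) (z : CotangentBundle n M)
    (hz : z.1 ∉ Function.support (fs j)) :
    (∑ l, a j l • cutQ (fs j) l : rayAlg n M).1 z = 0 := by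
  rw [LocFin.coe_sum]
  refine Finset.sum_eq_zero fun l _ => ?_
  change a j l * (cutQ (fs j) l).1 z = 0
  rw [cutQ_apply, Function.notMem_support.1 hz, zero_mul, mul_zero]

lemma combTerm_mem (a : ι → Fin n → ℝ) (j : ι) :
    (∑ l, a j l • cutQ (fs j) l : rayAlg n M) ∈ (grading n M).part 0 :=
  Submodule.sum_mem _ fun l _ => Submodule.smul_mem _ _ (cutQ_mem (fs j) l)

/-- The combination with coefficients `a` of the coordinate functions of a bump covering. -/
def comb (a : ι → Fin n → ℝ) : rayAlg n M :=
  L.sum (P := fun j => ∑ l, a j l • cutQ (fs j) l) (combTerm_eq_zero fs a) (combTerm_mem fs a)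

/-- The partial derivatives of two combinations of the coordinate functions, along the cut off
coordinate fields of the `i`-th chart. -/
def combDeriv (i : ι) (c : ι → Fin 2 → Fin n → ℝ) (x : M) (s : Fin 2) (k : Fin n) : ℝ :=
  onBase ((grading n M).br (cutP (fs i) k) (comb fs L fun j => c j s)) x

lemma combDeriv_apply (i : ι) (c : ι → Fin 2 → Fin n → ℝ) {x y : M} {J : Finset ι}
    (hJ : L.idx x ⊆ J) (hy : y ∈ L.nhd x) (s : Fin 2) (k : Fin n) :
    combDeriv fs L i c y s k = ∑ j ∈ J, ∑ l, c j s l *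
      onBase ((grading n M).br (cutP (fs i) k) (cutQ (fs j) l)) y := by
  rw [combDeriv, (grading n M).br_swap]
  change -((grading n M).br _ _).1 _ = _
  rw [comb, L.br_sum _ _ hJ _ hy, ← Finset.sum_neg_distrib]
  refine Finset.sum_congr rfl fun j _ => ?_
  rw [map_sum, LinearMap.sum_apply, LocFin.coe_sum, ← Finset.sum_neg_distrib]
  refine Finset.sum_congr rfl fun l _ => ?_
  rw [map_smul, LinearMap.smul_apply, (grading n M).br_swap (cutQ (fs j) l)]
  change -(_ * -((grading n M).br _ _).1 _) = _
  rw [onBase]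
  ring

lemma continuous_combDeriv (i : ι) :
    Continuous fun w : (ι → Fin 2 → Fin n → ℝ) × M => combDeriv fs L i w.1 w.2 := by
  refine continuous_pi fun s => continuous_pi fun k => continuous_iff_continuousAt.2 fun w₀ => ?_
  have h1 : Continuous fun w : (ι → Fin 2 → Fin n → ℝ) × M => ∑ j ∈ L.idx w₀.2, ∑ l, w.1 j s l *
      onBase ((grading n M).br (cutP (fs i) k) (cutQ (fs j) l)) w.2 := by
    refine continuous_finsetSum _ fun j _ => continuous_finsetSum _ fun l _ => ?_
    refine Continuous.mul (by fun_prop) ((contMDiff_onBase _).continuous.comp continuous_snd)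
  refine h1.continuousAt.congr ?_
  filter_upwards [continuousAt_snd.eventually
    ((L.isOpen_nhd w₀.2).mem_nhds (L.mem_nhd w₀.2))] with w hw
  exact (combDeriv_apply fs L i w.1 subset_rfl hw s k).symm

lemma mem_idx_of_eq_one {i : ι} {x : M} (hx : fs i x = 1) : i ∈ L.idx x := by
  by_contra h
  exact L.notMem x x (L.mem_nhd x) i h (by simp [hx])

/-- Where the `i`-th bump is one, its cut-off coordinates have brackets `δ_{kl}`. The coefficients
of that chart therefore translate the derivative matrix freely, which is the freedom needed for
general position. -/
lemma combDeriv_add_single [DecidableEq ι] (i : ι) (c : ι → Fin 2 → Fin n → ℝ)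
    (d : Fin 2 → Fin n → ℝ) {x : M} (hx : fs i x = 1) :
    combDeriv fs L i (c + Pi.single i d) x = combDeriv fs L i c x + d := by
  ext s k
  rw [Pi.add_apply, Pi.add_apply, combDeriv_apply fs L i _ subset_rfl (L.mem_nhd x),
    combDeriv_apply fs L i _ subset_rfl (L.mem_nhd x)]
  simp only [Pi.add_apply, add_mul, Finset.sum_add_distrib]
  congr 1
  rw [Finset.sum_eq_single i, Finset.sum_eq_single k]
  · rw [onBase, br_cutP_cutQ (fs i) hx k k rfl]
    simp
  · intro l _ hl
    rw [onBase, br_cutP_cutQ (fs i) hx k l rfl, if_neg hl.symm, mul_zero]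
  · simp
  · intro j _ hj
    simp [Pi.single_eq_of_ne hj]
  · exact fun h => (h (mem_idx_of_eq_one fs L hx)).elim

lemma contMDiff_combDeriv (i : ι) (c : ι → Fin 2 → Fin n → ℝ) :
    ContMDiff (𝓡 n) 𝓘(ℝ, Fin 2 → Fin n → ℝ) ∞ (combDeriv fs L i c) :=
  contMDiff_pi_space.2 fun _ => contMDiff_pi_space.2 fun _ => contMDiff_onBase _

/-- The set where the bump is one is compact, and the derivative matrix is jointly continuous in the
coefficients and the point. -/
lemma isOpen_combDeriv_ne (i : ι) :
    IsOpen {c : ι → Fin 2 → Fin n → ℝ | ∀ x ∈ {x | fs i x = 1}, combDeriv fs L i c x ≠ 0} := by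
  have hK : IsCompact {x | fs i x = 1} := by
    refine (fs i).hasCompactSupport.isCompact.of_isClosed_subset
      (isClosed_eq (fs i).continuous continuous_const) fun x hx => subset_tsupport _ ?_
    have : fs i x = 1 := hx
    simp [this]
  refine isOpen_iff_mem_nhds.2 fun c hc => ?_
  refine hK.eventually_forall_of_forall_eventually fun x hx => ?_
  exact (continuous_combDeriv fs L i).continuousAt.eventually_ne (hc x hx)

/-- A `C¹` image of an `n`-dimensional ball cannot contain an open set of `2 × n` matrices, as `n <
2 n`. So a small `d` can be chosen outside the values of minus the derivative matrix, and adding it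
to the `i`-th coefficients keeps that matrix nonzero. One function would not leave room for this
count. -/
lemma dense_combDeriv_ne (hn : 0 < n) (i : ι) :
    Dense {c : ι → Fin 2 → Fin n → ℝ | ∀ x ∈ {x | fs i x = 1}, combDeriv fs L i c x ≠ 0} := by
  classical
  rw [dense_iff_inter_open]
  rintro W hW ⟨c, hc⟩
  have hsm : ContDiffOn ℝ 1 (fun q => -combDeriv fs L i c ((extChartAt (𝓡 n) (fs.c i)).symm q))
      (Metric.ball (extChartAt (𝓡 n) (fs.c i) (fs.c i)) (fs i).rOut) := by
    have h1 := ((contMDiff_combDeriv fs L i c).comp_contMDiffOn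
      (contMDiffOn_extChartAt_symm (n := ∞) (I := 𝓡 n) (fs.c i))).contDiffOn
    refine ((h1.mono ?_).of_le (by simp)).neg
    have h2 := (fs i).ball_subset
    rwa [(𝓡 n).range_eq_univ, Set.inter_univ] at h2
  have hd := hsm.dense_compl_image_of_dimH_lt_finrank (convex_ball _ _) subset_rfl (by
    rw [Real.dimH_of_nonempty_interior (by
      rw [Metric.isOpen_ball.interior_eq]; exact Metric.nonempty_ball.2 (fs i).rOut_pos)]
    rw [Module.finrank_pi_fintype]
    simp
    norm_cast
    omega)
  have hW' : IsOpen ((fun d : Fin 2 → Fin n → ℝ => c + Pi.single i d) ⁻¹' W) :=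
    hW.preimage (continuous_const.add (continuous_single i))
  obtain ⟨d, hdW, hdn⟩ := dense_iff_inter_open.1 hd _ hW' ⟨0, by simpa using hc⟩
  refine ⟨_, hdW, fun x hx h0 => hdn ⟨extChartAt (𝓡 n) (fs.c i) x, ?_, ?_⟩⟩
  · have : x ∈ Function.support (fs i) := by
      have : fs i x = 1 := hx
      simp [this]
    rw [(fs i).support_eq_inter_preimage] at this
    exact this.2
  · rw [combDeriv_add_single fs L i c d hx] at h0
    simp only
    rw [chart_left_inv (fs.mem_chartAt_source_of_eq_one hx)]
    exact neg_eq_of_add_eq_zero_right h0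

/-- Baire: there is one dense open condition for each of countably many bumps. The sets where a bump
equals one cover `M`, so the two combinations have no common critical point. -/
lemma exists_combDeriv_ne [Countable ι] (hn : 0 < n) :
    ∃ c : ι → Fin 2 → Fin n → ℝ, ∀ x, ∃ i, fs i x = 1 ∧ combDeriv fs L i c x ≠ 0 := by
  obtain ⟨c, hc⟩ := (dense_iInter_of_isOpen (isOpen_combDeriv_ne fs L)
    (dense_combDeriv_ne fs L hn)).nonempty
  refine ⟨c, fun x => ⟨fs.ind x trivial, fs.apply_ind x trivial, ?_⟩⟩
  exact Set.mem_iInter.1 hc _ _ (fs.apply_ind x trivial)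

variable (n M) in
/-- The grading of `S(M)` is nonsingular. -/
theorem nonsingular_grading [SecondCountableTopology M] [ConnectedSpace M] :
    (grading n M).Nonsingular := by
  rcases Nat.eq_zero_or_pos n with hn | hn
  · right
    subst hn
    have hbot : ∀ i, (grading 0 M).part (i + 1) = ⊥ := by
      refine fun i => (Submodule.eq_bot_iff _).2 fun P hP => Subtype.ext (funext fun z => ?_)
      have h1 := (mem_part.1 hP).2 z 0
      have h2 : (0 : ℝ) • (show Model 0 →L[ℝ] ℝ from z.2) = z.2 := Subsingleton.elim _ _
      have h3 : P.1 (⟨z.1, (0 : ℝ) • z.2⟩ : CotangentBundle 0 M) = P.1 z :=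
        congrArg (fun β : Model 0 →L[ℝ] ℝ => P.1 (⟨z.1, β⟩ : CotangentBundle 0 M)) h2
      rw [h3] at h1
      rw [h1]
      simp
    refine ⟨hbot, fun f hf => const_of_br_eq_zero hf fun X hX => ?_⟩
    rw [hbot 0, Submodule.mem_bot] at hX
    rw [hX, map_zero, LinearMap.zero_apply]
  · left
    have : LocallyCompactSpace M := ChartedSpace.locallyCompactSpace (Model n) M
    obtain ⟨ι, fs, -⟩ := SmoothBumpCovering.exists_isSubordinate (𝓡 n) (M := M)
      isClosed_univ (U := fun _ => Set.univ) fun _ _ => Filter.univ_mem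
    have : Countable ι := Set.countable_univ_iff.1
      (fs.locallyFinite.countable_univ fun i => (fs i).nonempty_support)
    obtain ⟨L⟩ := exists_locFin fs.locallyFinite
    obtain ⟨c, hc⟩ := exists_combDeriv_ne fs L hn
    let f : Fin 2 → rayAlg n M := fun s => comb fs L fun j => c j s
    have hf : ∀ s, f s ∈ (grading n M).part 0 := fun s =>
      L.sum_mem_part (combTerm_eq_zero fs _) (combTerm_mem fs _)
    -- Gradient-like fields: the coefficients `{p_k, f s}` make `{Y s, f s}` a sum of squares. The
    -- total `a` over both functions is nowhere zero, and dividing the fields by it yields `1`.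
    let T : Fin 2 → ι → rayAlg n M := fun s i =>
      ∑ k, (grading n M).br (cutP (fs i) k) (f s) * cutP (fs i) k
    have hb : ∀ s i k, (grading n M).br (cutP (fs i) k) (f s) ∈ (grading n M).part 0 :=
      fun s i k => (grading n M).br_mem (cutP_mem (fs i) k) (hf s) rfl
    have hT0 : ∀ s i z, z.1 ∉ Function.support (fs i) → (T s i).1 z = 0 := by
      intro s i z hz
      rw [LocFin.coe_sum]
      refine Finset.sum_eq_zero fun k _ => ?_
      change _ * (cutP (fs i) k).1 z = 0
      rw [cutP_apply, Function.notMem_support.1 hz, zero_mul, mul_zero]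
    have hT1 : ∀ s i, T s i ∈ (grading n M).part 1 := fun s i =>
      Submodule.sum_mem _ fun k _ => (grading n M).zero_mul_mem (hb s i k) (cutP_mem (fs i) k)
    let Y : Fin 2 → rayAlg n M := fun s => L.sum (hT0 s) (hT1 s)
    have hY : ∀ s, Y s ∈ (grading n M).part 1 := fun s => L.sum_mem_part (hT0 s) (hT1 s)
    have hYf : ∀ s (z : CotangentBundle n M), ((grading n M).br (Y s) (f s)).1 z =
        ∑ i ∈ L.idx z.1, ∑ k, combDeriv fs L i c z.1 s k ^ 2 := by
      intro s z
      rw [L.br_sum (hT0 s) (hT1 s) subset_rfl (f s) (L.mem_nhd z.1)]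
      refine Finset.sum_congr rfl fun i _ => ?_
      rw [map_sum, LinearMap.sum_apply, LocFin.coe_sum]
      refine Finset.sum_congr rfl fun k _ => ?_
      rw [(grading n M).mul_br, (grading n M).br_zero (hb s i k) (hf s), zero_mul, zero_add]
      change ((grading n M).br (cutP (fs i) k) (f s)).1 z *
        ((grading n M).br (cutP (fs i) k) (f s)).1 z = _
      rw [apply_of_mem_zero (hb s i k), sq]
      rfl
    set a := (grading n M).br (Y 0) (f 0) + (grading n M).br (Y 1) (f 1) with ha
    have ha0 : a ∈ (grading n M).part 0 := Submodule.add_mem _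
      ((grading n M).br_mem (hY 0) (hf 0) rfl) ((grading n M).br_mem (hY 1) (hf 1) rfl)
    have hpos : ∀ x, onBase a x ≠ 0 := by
      intro x h0
      obtain ⟨i, hi1, hi⟩ := hc x
      have h1 : onBase a x = ∑ i ∈ L.idx x, ∑ k, combDeriv fs L i c x 0 k ^ 2 +
          ∑ i ∈ L.idx x, ∑ k, combDeriv fs L i c x 1 k ^ 2 :=
        congrArg₂ (· + ·) (hYf 0 ⟨x, 0⟩) (hYf 1 ⟨x, 0⟩)
      have hnn : ∀ s, ∀ i ∈ L.idx x, 0 ≤ ∑ k, combDeriv fs L i c x s k ^ 2 :=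
        fun s i _ => Finset.sum_nonneg fun k _ => sq_nonneg _
      rw [h0] at h1
      have hz := (add_eq_zero_iff_of_nonneg (Finset.sum_nonneg (hnn 0))
        (Finset.sum_nonneg (hnn 1))).1 h1.symm
      have hs : ∀ s, ∑ i ∈ L.idx x, ∑ k, combDeriv fs L i c x s k ^ 2 = 0 :=
        Fin.forall_fin_two.2 hz
      refine hi (funext fun s => funext fun k => ?_)
      have h2 := (Finset.sum_eq_zero_iff_of_nonneg (hnn s)).1 (hs s) i (mem_idx_of_eq_one fs L hi1)
      exact pow_eq_zero_iff two_ne_zero |>.1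
        ((Finset.sum_eq_zero_iff_of_nonneg fun k _ => sq_nonneg _).1 h2 k (Finset.mem_univ k))
    let b := pull (fun x => (onBase a x)⁻¹) ((contMDiff_onBase a).inv₀ hpos)
    have hb0 : b ∈ (grading n M).part 0 := pull_mem _ _
    have hba : b * a = 1 := by
      refine Subtype.ext (funext fun z => ?_)
      change (onBase a z.1)⁻¹ * a.1 z = 1
      rw [apply_of_mem_zero ha0, inv_mul_cancel₀ (hpos _)]
    refine ⟨b * Y 0, (grading n M).zero_mul_mem hb0 (hY 0), b * Y 1,
      (grading n M).zero_mul_mem hb0 (hY 1), f 0, hf 0, f 1, hf 1, ?_⟩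
    rw [(grading n M).mul_br, (grading n M).mul_br, (grading n M).br_zero hb0 (hf 0),
      (grading n M).br_zero hb0 (hf 1), zero_mul, zero_mul, zero_add, zero_add, ← mul_add, ← ha, hba]

end Nonsingular

/-! ### Multiplicative functionals and diffeomorphisms. -/

section Evaluation

variable {n : ℕ} {M : Type*} [TopologicalSpace M] [ChartedSpace (Model n) M]
  [IsManifold (𝓡 n) ∞ M] [T2Space M]

variable (n M) in
/-- There is a smooth function with compact sublevel sets. -/
lemma exists_exhaustion [SecondCountableTopology M] :
    ∃ h : M → ℝ, ContMDiff (𝓡 n) 𝓘(ℝ, ℝ) ∞ h ∧ ∀ r, IsCompact {x | h x ≤ r} := by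
  have : LocallyCompactSpace M := ChartedSpace.locallyCompactSpace (Model n) M
  let K : CompactExhaustion M := default
  -- A smooth function above the index of the exhaustion. Near `x` the constant `K.find x + 1`
  -- works, since a neighbourhood of `x` lies in the next compact set.
  obtain ⟨g, hg⟩ := exists_contMDiffMap_forall_mem_convex_of_local_const (I := 𝓡 n) (n := (⊤ : ℕ∞))
    (t := fun y : M => Set.Ici (K.find y : ℝ)) (fun y => convex_Ici _) (fun x =>
      ⟨K.find x + 1, by
        have h1 : interior (K (K.find x + 1)) ∈ 𝓝 x :=
          isOpen_interior.mem_nhds (K.subset_interior_succ _ (K.mem_find x))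
        filter_upwards [h1] with y hy
        have h2 : K.find y ≤ K.find x + 1 := K.mem_iff_find_le.1 (interior_subset hy)
        have h3 : ((K.find y : ℕ) : ℝ) ≤ ((K.find x + 1 : ℕ) : ℝ) := Nat.cast_le.2 h2
        rwa [Nat.cast_succ] at h3⟩)
  refine ⟨g, g.contMDiff, fun r => ?_⟩
  refine (K.isCompact ⌊r⌋₊).of_isClosed_subset
    (isClosed_le g.contMDiff.continuous continuous_const) fun x hx => ?_
  exact K.mem_iff_find_le.2 (Nat.le_floor ((hg x).trans hx))

/-- Multiplicative functionals on the smooth functions of `M` are evaluations. -/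
theorem exists_eval [SecondCountableTopology M] (χ : rayAlg n M →ₗ[ℝ] ℝ) (h1 : χ 1 = 1)
    (hmul : ∀ f ∈ (grading n M).part 0, ∀ g ∈ (grading n M).part 0, χ (f * g) = χ f * χ g) :
    ∃ x, ∀ f ∈ (grading n M).part 0, χ f = onBase f x := by
  by_contra! hne
  choose f hf hfx using hne
  obtain ⟨h, hh, hcpt⟩ := exists_exhaustion n M
  let d : rayAlg n M → rayAlg n M := fun g => g - algebraMap ℝ _ (χ g)
  have hconst : ∀ r, algebraMap ℝ (rayAlg n M) r ∈ (grading n M).part 0 := fun r => by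
    rw [Algebra.algebraMap_eq_smul_one]
    exact Submodule.smul_mem _ _ (grading n M).one_mem
  have hd : ∀ g ∈ (grading n M).part 0, d g ∈ (grading n M).part 0 := fun g hg =>
    Submodule.sub_mem _ hg (hconst _)
  have hd0 : ∀ g ∈ (grading n M).part 0, χ (d g * d g) = 0 := fun g hg => by
    rw [hmul _ (hd g hg) _ (hd g hg), map_sub, Algebra.algebraMap_eq_smul_one, map_smul, h1]
    simp
  have hdv : ∀ g x, onBase (d g * d g) x = (onBase g x - χ g) ^ 2 := fun g x => by
    rw [sq]; rfl
  let H := pull h hh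
  have hK : IsCompact {x | h x ≤ χ H} := hcpt _
  obtain ⟨t, -, ht⟩ := hK.elim_nhds_subcover (fun x => {y | onBase (f x) y ≠ χ (f x)})
    fun x _ => ((contMDiff_onBase (f x)).continuous.continuousAt.eventually_ne (hfx x).symm)
  -- A sum of squares of elements of the kernel of `χ`. The exhaustion term vanishes only inside a
  -- compact set, where finitely many of the other terms leave no common zero. So `g` is invertible
  -- although `χ g = 0`.
  let g : rayAlg n M := d H * d H + ∑ x ∈ t, d (f x) * d (f x)
  have hmem : ∀ g ∈ (grading n M).part 0, d g * d g ∈ (grading n M).part 0 := fun g hg =>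
    (grading n M).zero_mul_mem (hd g hg) (hd g hg)
  have hg : g ∈ (grading n M).part 0 := Submodule.add_mem _ (hmem _ (pull_mem _ _))
    (Submodule.sum_mem _ fun x _ => hmem _ (hf x))
  have hgv : ∀ x, onBase g x = (h x - χ H) ^ 2 + ∑ y ∈ t, (onBase (f y) x - χ (f y)) ^ 2 := by
    intro x
    change (d H * d H).1 _ + (∑ x ∈ t, d (f x) * d (f x) : rayAlg n M).1 _ = _
    rw [LocFin.coe_sum]
    exact congrArg₂ (· + ·) (hdv H x) (Finset.sum_congr rfl fun y _ => hdv (f y) x)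
  have hpos : ∀ x, onBase g x ≠ 0 := by
    intro x h0
    rw [hgv] at h0
    have h2 := (add_eq_zero_iff_of_nonneg (sq_nonneg _)
      (Finset.sum_nonneg fun y _ => sq_nonneg _)).1 h0
    have h3 : h x = χ H := sub_eq_zero.1 (pow_eq_zero_iff two_ne_zero |>.1 h2.1)
    obtain ⟨y, hy, hxy⟩ := Set.mem_iUnion₂.1 (ht (show h x ≤ χ H from h3.le))
    exact hxy (sub_eq_zero.1 (pow_eq_zero_iff two_ne_zero |>.1
      ((Finset.sum_eq_zero_iff_of_nonneg fun y _ => sq_nonneg _).1 h2.2 y hy)))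
  let b := pull (fun x => (onBase g x)⁻¹) ((contMDiff_onBase g).inv₀ hpos)
  have hbg : g * b = 1 := Subtype.ext (funext fun z => by
    change g.1 z * (onBase g z.1)⁻¹ = 1
    rw [apply_of_mem_zero hg, mul_inv_cancel₀ (hpos _)])
  have h5 : χ g = 0 := by
    rw [map_add, map_sum, hd0 _ (pull_mem _ _), zero_add]
    exact Finset.sum_eq_zero fun x _ => hd0 _ (hf x)
  have h6 := hmul g hg b (pull_mem _ _)
  rw [hbg, h1, h5, zero_mul] at h6
  exact one_ne_zero h6

variable (n) in
lemma eq_of_onBase_eq {x y : M} (h : ∀ f ∈ (grading n M).part 0, onBase f x = onBase f y) :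
    x = y := by
  by_contra hne
  obtain ⟨χ, hχ, hs, h1⟩ := exists_bump (n := n) (isOpen_ne.mem_nhds hne : {z | z ≠ y} ∈ 𝓝 x)
  have h2 : χ x = χ y := h _ (pull_mem χ hχ)
  rw [h1.eq_of_nhds, image_eq_zero_of_notMem_tsupport fun hy => hs hy rfl] at h2
  exact one_ne_zero h2

/-- A map that pulls smooth functions back to smooth functions is smooth. -/
lemma contMDiff_of_onBase_comp {θ : M → M}
    (h : ∀ f ∈ (grading n M).part 0, ContMDiff (𝓡 n) 𝓘(ℝ, ℝ) ∞ (onBase f ∘ θ)) :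
    ContMDiff (𝓡 n) (𝓡 n) ∞ θ := by
  intro x
  have hcont : ContinuousAt θ x := by
    rw [ContinuousAt, Filter.tendsto_def]
    intro U hU
    -- A bump at `θ x` supported in `U` pulls back to a continuous function that is nonzero at `x`;
    -- near `x` it stays nonzero, so `θ` takes values in `U`.
    obtain ⟨χ, hχ, hs, h1⟩ := exists_bump (n := n) hU
    have h2 : ContinuousAt (χ ∘ θ) x := (h _ (pull_mem χ hχ)).continuous.continuousAt
    have h3 : (χ ∘ θ) x ≠ 0 := by
      rw [Function.comp_apply, h1.eq_of_nhds]
      exact one_ne_zero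
    filter_upwards [h2.eventually_ne h3] with y hy
    by_contra hyU
    have h4 : χ (θ y) = 0 := image_eq_zero_of_notMem_tsupport fun hy' => hyU (hs hy')
    exact hy h4
  refine contMDiffAt_iff_target.2 ⟨hcont, ?_⟩
  obtain ⟨F⟩ := exists_coordFrame (n := n) (mem_chart_source (Model n) (θ x))
  have h1 : ContMDiff (𝓡 n) 𝓘(ℝ, Fin n → ℝ) ∞
      (fun y j => onBase (F.q j) (θ y) + extChartAt (𝓡 n) (θ x) (θ x) j) :=
    contMDiff_pi_space.2 fun j => (h _ (F.q_mem j)).add contMDiff_const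
  refine ((EuclideanSpace.equiv (Fin n) ℝ).symm.contDiff.contMDiff.comp h1 x).congr_of_eventuallyEq ?_
  filter_upwards [hcont.eventually (F.isOpen_nhd.mem_nhds F.mem_nhd)] with y hy
  ext j
  have h2 := F.q_eq j ⟨θ y, 0⟩ hy
  rw [cotChart_apply_fst (z := ⟨θ y, 0⟩) (F.nhd_subset hy)] at h2
  change _ = (F.q j).1 ⟨θ y, 0⟩ + extChartAt (𝓡 n) (θ x) (θ x) j
  rw [h2, sub_add_cancel]
  rfl

/-- An automorphism of the algebra of smooth functions is induced by a diffeomorphism. -/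
theorem exists_diffeomorph [SecondCountableTopology M] (Ψ : rayAlg n M ≃ₗ[ℝ] rayAlg n M)
    (h0 : ∀ f, f ∈ (grading n M).part 0 ↔ Ψ f ∈ (grading n M).part 0) (h1 : Ψ 1 = 1)
    (hmul : ∀ f ∈ (grading n M).part 0, ∀ g ∈ (grading n M).part 0, Ψ (f * g) = Ψ f * Ψ g) :
    ∃ φ : M ≃ₘ^∞⟮𝓡 n, 𝓡 n⟯ M, ∀ f ∈ (grading n M).part 0, ∀ x,
      onBase (Ψ f) x = onBase f (φ.symm x) := by
  let ev : M → rayAlg n M →ₗ[ℝ] ℝ := fun x =>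
    { toFun := fun P => onBase P x
      map_add' := fun _ _ => rfl
      map_smul' := fun _ _ => rfl }
  have key : ∀ Ψ : rayAlg n M ≃ₗ[ℝ] rayAlg n M,
      Ψ 1 = 1 → (∀ f ∈ (grading n M).part 0, ∀ g ∈ (grading n M).part 0,
      Ψ (f * g) = Ψ f * Ψ g) → ∃ θ : M → M, ∀ f ∈ (grading n M).part 0, ∀ x,
      onBase (Ψ f) x = onBase f (θ x) := by
    intro Ψ h1 hmul
    have : ∀ x, ∃ y, ∀ f ∈ (grading n M).part 0, onBase (Ψ f) x = onBase f y := fun x => by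
      refine exists_eval ((ev x).comp Ψ.toLinearMap) ?_ fun f hf g hg => ?_
      · change onBase (Ψ 1) x = 1
        rw [h1]; rfl
      · change onBase (Ψ (f * g)) x = _
        rw [hmul f hf g hg]; rfl
    choose θ hθ using this
    exact ⟨θ, fun f hf x => hθ x f hf⟩
  obtain ⟨θ, hθ⟩ := key Ψ h1 hmul
  have h0' : ∀ f ∈ (grading n M).part 0, Ψ.symm f ∈ (grading n M).part 0 := fun f hf => by
    rw [h0]; simpa using hf
  obtain ⟨θ', hθ'⟩ := key Ψ.symm (by rw [LinearEquiv.symm_apply_eq, h1]) (fun f hf g hg => by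
    rw [LinearEquiv.symm_apply_eq, hmul _ (h0' f hf) _ (h0' g hg)]
    simp)
  have hs : ContMDiff (𝓡 n) (𝓡 n) ∞ θ := contMDiff_of_onBase_comp fun f hf => by
    rw [← (funext (hθ f hf) : onBase (Ψ f) = onBase f ∘ θ)]
    exact contMDiff_onBase _
  have hs' : ContMDiff (𝓡 n) (𝓡 n) ∞ θ' := contMDiff_of_onBase_comp fun f hf => by
    rw [← (funext (hθ' f hf) : onBase (Ψ.symm f) = onBase f ∘ θ')]
    exact contMDiff_onBase _
  -- The phase lift covers `φ⁻¹`, so the map `θ` along which functions are pulled back is the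
  -- inverse of `φ`.
  refine ⟨⟨⟨θ', θ, fun x => ?_, fun x => ?_⟩, hs', hs⟩, hθ⟩
  · refine eq_of_onBase_eq n fun f hf => ?_
    rw [← hθ f hf, ← hθ' _ ((h0 f).1 hf), Ψ.symm_apply_apply]
  · refine eq_of_onBase_eq n fun f hf => ?_
    rw [← hθ' f hf, ← hθ _ (h0' f hf), Ψ.apply_symm_apply]

end Evaluation

/-! ### The normal forms as bracket automorphisms, and their uniqueness. -/

section NormalForm

variable {n : ℕ} {M : Type*} [TopologicalSpace M] [ChartedSpace (Model n) M]
  [IsManifold (𝓡 n) ∞ M]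

lemma phaseLift_apply (φ : M ≃ₘ^∞⟮𝓡 n, 𝓡 n⟯ M) (x : M) (α : Cotangent n M (φ x)) :
    phaseLift φ ⟨φ x, α⟩ = ⟨x, (show TangentSpace (𝓡 n) (φ x) →L[ℝ] ℝ from α).comp
      (mfderiv (𝓡 n) (𝓡 n) φ x)⟩ := by
  have key : ∀ x', x' = x → (⟨x', (show Model n →L[ℝ] ℝ from α).comp
      (show Model n →L[ℝ] Model n from mfderiv (𝓡 n) (𝓡 n) φ x')⟩ : CotangentBundle n M) =
      ⟨x, (show Model n →L[ℝ] ℝ from α).comp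
        (show Model n →L[ℝ] Model n from mfderiv (𝓡 n) (𝓡 n) φ x)⟩ := by
    rintro _ rfl
    rfl
  exact key _ (φ.symm_apply_apply x)

lemma phaseLift_symm_phaseLift (φ : M ≃ₘ^∞⟮𝓡 n, 𝓡 n⟯ M) (z : CotangentBundle n M) :
    phaseLift φ.symm (phaseLift φ z) = z := by
  obtain ⟨y, α⟩ := z
  obtain ⟨x, rfl⟩ : ∃ x, φ x = y := ⟨φ.symm y, φ.apply_symm_apply y⟩
  rw [phaseLift_apply]
  have key : ∀ x' (hx : φ.symm (φ x) = x') (β : Model n →L[ℝ] ℝ),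
      phaseLift φ.symm (⟨x', β⟩ : CotangentBundle n M) = ⟨φ x, β.comp
        (show Model n →L[ℝ] Model n from mfderiv (𝓡 n) (𝓡 n) φ.symm (φ x))⟩ := by
    rintro _ rfl β
    exact phaseLift_apply φ.symm (φ x) β
  refine (key x (φ.symm_apply_apply x) _).trans ?_
  have hφ : MDifferentiableAt (𝓡 n) (𝓡 n) φ (φ.symm (φ x)) :=
    (φ.contMDiff.mdifferentiable (by simp)) _
  have hφ' : MDifferentiableAt (𝓡 n) (𝓡 n) φ.symm (φ x) :=
    (φ.symm.contMDiff.mdifferentiable (by simp)) _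
  have h1 := mfderiv_comp (φ x) hφ hφ'
  have h2 : (φ ∘ φ.symm : M → M) = id := funext φ.apply_symm_apply
  rw [h2, mfderiv_id, φ.symm_apply_apply] at h1
  have h3 : ((show Model n →L[ℝ] ℝ from α).comp
      (show Model n →L[ℝ] Model n from mfderiv (𝓡 n) (𝓡 n) φ x)).comp
      (show Model n →L[ℝ] Model n from mfderiv (𝓡 n) (𝓡 n) φ.symm (φ x)) = α := by
    rw [ContinuousLinearMap.comp_assoc]
    exact (congrArg (fun f : Model n →L[ℝ] Model n =>
      (show Model n →L[ℝ] ℝ from α).comp f) h1.symm).trans (ContinuousLinearMap.comp_id _)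
  exact congrArg (fun a : Model n →L[ℝ] ℝ => (⟨φ x, a⟩ : CotangentBundle n M)) h3

lemma phaseLift_phaseLift_symm (φ : M ≃ₘ^∞⟮𝓡 n, 𝓡 n⟯ M) (z : CotangentBundle n M) :
    phaseLift φ (phaseLift φ.symm z) = z :=
  phaseLift_symm_phaseLift φ.symm z

lemma phaseLift_refl (z : CotangentBundle n M) :
    phaseLift (Diffeomorph.refl (𝓡 n) M ∞) z = z := by
  have h := congrFun (liftMap_refl_zero (n := n) (M := M)) z
  have h2 : translation ((0 : OneForm n M) : (x : M) → _) z = z :=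
    congrArg (fun a : Cotangent n M z.1 => (⟨z.1, a⟩ : CotangentBundle n M)) (add_zero _)
  rw [liftMap, Function.comp_apply, h2] at h
  exact h

lemma translation_neg (η : OneForm n M) (z : CotangentBundle n M) :
    translation ((-η : OneForm n M) : (x : M) → _) (translation η z) = z :=
  congrArg (fun a : Cotangent n M z.1 => (⟨z.1, a⟩ : CotangentBundle n M)) (add_neg_cancel_right _ _)

lemma translation_neg' (η : OneForm n M) (z : CotangentBundle n M) :
    translation η (translation ((-η : OneForm n M) : (x : M) → _) z) = z :=
  congrArg (fun a : Cotangent n M z.1 => (⟨z.1, a⟩ : CotangentBundle n M)) (neg_add_cancel_right _ _)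

lemma rescale_comp_mem_rayAlg {P : CotangentBundle n M → ℝ} (hP : P ∈ rayAlg n M) (κ : ℝ)
    (φ : M ≃ₘ^∞⟮𝓡 n, 𝓡 n⟯ M) (η : OneForm n M) :
    rescale κ P ∘ phaseLift φ ∘ translation η ∈ rayAlg n M :=
  mem_polyFun_iff.1 (rescale_comp_mem (mem_polyFun_iff.2 hP) κ φ η)

lemma translation_zero (z : CotangentBundle n M) :
    translation ((0 : OneForm n M) : (x : M) → _) z = z :=
  congrArg (fun a : Cotangent n M z.1 => (⟨z.1, a⟩ : CotangentBundle n M)) (add_zero _)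

lemma rescale_mem_rayAlg {P : CotangentBundle n M → ℝ} (hP : P ∈ rayAlg n M) (κ : ℝ) :
    rescale κ P ∈ rayAlg n M := by
  have h := rescale_comp_mem_rayAlg hP κ (Diffeomorph.refl (𝓡 n) M ∞) 0
  rwa [(funext fun z => congrArg (rescale κ P) ((phaseLift_refl _).trans (translation_zero z)) :
    rescale κ P ∘ phaseLift (Diffeomorph.refl (𝓡 n) M ∞) ∘
      translation ((0 : OneForm n M) : (x : M) → _) = rescale κ P)] at h

lemma rescale_one (P : CotangentBundle n M → ℝ) : rescale 1 P = P := by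
  funext z
  have : (⟨z.1, (1 : ℝ)⁻¹ • z.2⟩ : CotangentBundle n M) = z := by
    rw [inv_one, one_smul]
  exact (one_mul _).trans (congrArg P this)

lemma comp_mem_rayAlg {P : CotangentBundle n M → ℝ} (hP : P ∈ rayAlg n M)
    (φ : M ≃ₘ^∞⟮𝓡 n, 𝓡 n⟯ M) (η : OneForm n M) :
    P ∘ phaseLift φ ∘ translation η ∈ rayAlg n M := by
  have h := rescale_comp_mem_rayAlg hP 1 φ η
  rwa [rescale_one] at h

lemma rescale_inv_rescale {κ : ℝ} (hκ : κ ≠ 0) (P : CotangentBundle n M → ℝ) :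
    rescale κ⁻¹ (rescale κ P) = P := by
  funext z
  have : (⟨z.1, κ⁻¹ • κ⁻¹⁻¹ • z.2⟩ : CotangentBundle n M) = z := by
    rw [smul_smul, inv_inv, inv_mul_cancel₀ hκ, one_smul]
  change κ⁻¹ * (κ * P ⟨z.1, κ⁻¹ • κ⁻¹⁻¹ • z.2⟩) = P z
  rw [this, ← mul_assoc, inv_mul_cancel₀ hκ, one_mul]

/-- The map `P ↦ U_κ(P) ∘ φ* ∘ Exp(ηᵛ)` as an automorphism of the vector space `S(M)`. -/
def nfEquiv (κ : ℝ) (hκ : κ ≠ 0) (φ : M ≃ₘ^∞⟮𝓡 n, 𝓡 n⟯ M) (η : OneForm n M) :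
    rayAlg n M ≃ₗ[ℝ] rayAlg n M where
  toFun P := ⟨rescale κ P.1 ∘ phaseLift φ ∘ translation η, rescale_comp_mem_rayAlg P.2 κ φ η⟩
  map_add' P Q := Subtype.ext (by
    change rescale κ (P.1 + Q.1) ∘ _ = _
    rw [map_add]; rfl)
  map_smul' r P := Subtype.ext (by
    change rescale κ (r • P.1) ∘ _ = _
    rw [map_smul]; rfl)
  invFun P := ⟨rescale κ⁻¹ (P.1 ∘ translation ((-η : OneForm n M) : (x : M) → _) ∘ phaseLift φ.symm),
    rescale_mem_rayAlg (by
      have h1 := comp_mem_rayAlg P.2 (Diffeomorph.refl (𝓡 n) M ∞) (-η)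
      have h2 := comp_mem_rayAlg h1 φ.symm 0
      convert h2 using 1
      funext z
      simp only [Function.comp_apply, phaseLift_refl, translation_zero]) κ⁻¹⟩
  left_inv P := Subtype.ext (by
    have : (rescale κ P.1 ∘ phaseLift φ ∘ translation η) ∘
        translation ((-η : OneForm n M) : (x : M) → _) ∘ phaseLift φ.symm = rescale κ P.1 := by
      funext z
      simp only [Function.comp_apply, translation_neg', phaseLift_phaseLift_symm]
    simp only [this, rescale_inv_rescale hκ])
  right_inv P := Subtype.ext (by
    have h1 := rescale_inv_rescale (inv_ne_zero hκ)
      (P.1 ∘ translation ((-η : OneForm n M) : (x : M) → _) ∘ phaseLift φ.symm)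
    rw [inv_inv] at h1
    simp only [h1]
    funext z
    simp only [Function.comp_apply, translation_neg, phaseLift_symm_phaseLift])

lemma nfEquiv_apply (κ : ℝ) (hκ : κ ≠ 0) (φ : M ≃ₘ^∞⟮𝓡 n, 𝓡 n⟯ M) (η : OneForm n M)
    (P : rayAlg n M) : (nfEquiv κ hκ φ η P).1 = rescale κ P.1 ∘ phaseLift φ ∘ translation η := rfl

/-- The exponent `1 - i` is additive under a bracket of degree `-1`: `(1 - i) + (1 - j) = 1 - (i + j
- 1)`. -/
lemma poisson_rescale {κ : ℝ} (hκ : κ ≠ 0) (P Q : rayAlg n M) :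
    poisson (rescale κ P.1) (rescale κ Q.1) = rescale κ (poisson P.1 Q.1) := by
  let S : rayAlg n M →ₗ[ℝ] rayAlg n M :=
    { toFun := fun P => ⟨rescale κ P.1, rescale_mem_rayAlg P.2 κ⟩
      map_add' := fun P Q => Subtype.ext (map_add (rescale κ) P.1 Q.1)
      map_smul' := fun r P => Subtype.ext (map_smul (rescale κ) r P.1) }
  have hS : ∀ i, ∀ P ∈ (grading n M).part i, S P = κ ^ (1 - (i : ℤ)) • P := fun i P hP =>
    Subtype.ext (rescale_of_mem hκ hP)
  suffices h : (grading n M).br (S P) (S Q) = S ((grading n M).br P Q) from congrArg Subtype.val h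
  have hP : P ∈ ⨆ i, (grading n M).part i := (grading n M).iSup_part ▸ Submodule.mem_top
  have hQ : Q ∈ ⨆ i, (grading n M).part i := (grading n M).iSup_part ▸ Submodule.mem_top
  induction hP using Submodule.iSup_induction' with
  | zero => simp
  | add P P' _ _ h1 h2 => simp only [map_add, LinearMap.add_apply, h1, h2]
  | mem i P hP =>
    induction hQ using Submodule.iSup_induction' with
    | zero => simp
    | add Q Q' _ _ h1 h2 => simp only [map_add, h1, h2]
    | mem j Q hQ =>
      rw [hS i P hP, hS j Q hQ, map_smul, map_smul, LinearMap.smul_apply, smul_smul]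
      rcases Nat.eq_zero_or_pos (i + j) with h0 | h0
      · obtain ⟨rfl, rfl⟩ := Nat.add_eq_zero_iff.1 h0
        rw [(grading n M).br_zero hP hQ, smul_zero, map_zero]
      · obtain ⟨k, hk⟩ := Nat.exists_eq_succ_of_ne_zero h0.ne'
        rw [hS k _ ((grading n M).br_mem hP hQ hk), ← zpow_add₀ hκ]
        congr 2
        have : (i : ℤ) + j = k + 1 := by exact_mod_cast hk
        omega

lemma nfEquiv_br {κ : ℝ} (hκ : κ ≠ 0) (φ : M ≃ₘ^∞⟮𝓡 n, 𝓡 n⟯ M) {η : OneForm n M}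
    (hη : IsClosedForm η) (P Q : rayAlg n M) :
    nfEquiv κ hκ φ η ((grading n M).br P Q) =
      (grading n M).br (nfEquiv κ hκ φ η P) (nfEquiv κ hκ φ η Q) := by
  refine Subtype.ext (Eq.symm ?_)
  refine (poisson_comp_liftMap (smooth_rescale P.2.1 κ) (smooth_rescale Q.2.1 κ) φ hη).trans ?_
  rw [poisson_rescale hκ]
  rfl

variable [T2Space M]

variable (n) in
-- Functions on `M` separate base points, and local momenta separate covectors over the same point.
lemma eq_of_apply_eq {z w : CotangentBundle n M} (h : ∀ P : rayAlg n M, P.1 z = P.1 w) : z = w := by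
  have hx : z.1 = w.1 := eq_of_onBase_eq n fun f hf => by
    rw [← apply_of_mem_zero hf, ← apply_of_mem_zero hf, h]
  obtain ⟨x, α⟩ := z
  obtain ⟨y, β⟩ := w
  obtain rfl : x = y := hx
  obtain ⟨F⟩ := exists_coordFrame (n := n) (mem_chart_source (Model n) x)
  refine congrArg (fun a : Model n →L[ℝ] ℝ => (⟨x, a⟩ : CotangentBundle n M)) ?_
  rw [dual_eq_sum (show Model n →L[ℝ] ℝ from α), dual_eq_sum (show Model n →L[ℝ] ℝ from β)]
  refine Finset.sum_congr rfl fun j _ => ?_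
  have h1 := h (F.p j)
  rw [F.p_eq j _ F.mem_nhd, F.p_eq j _ F.mem_nhd, cotChart_self_apply (⟨x, α⟩ : CotangentBundle n M),
    cotChart_self_apply (⟨x, β⟩ : CotangentBundle n M)] at h1
  exact congrArg (· • (EuclideanSpace.proj j : Model n →L[ℝ] ℝ)) h1

/-- The data of a normal form are determined by the map. -/
theorem nfEquiv_injective [Nonempty M] {κ κ' : ℝ} (hκ : κ ≠ 0) (hκ' : κ' ≠ 0) {φ φ' : M ≃ₘ^∞⟮𝓡 n, 𝓡 n⟯ M}
    {η η' : OneForm n M} (h : nfEquiv κ hκ φ η = nfEquiv κ' hκ' φ' η') :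
    κ = κ' ∧ φ = φ' ∧ η = η' := by
  have hv : ∀ (P : rayAlg n M) z, rescale κ P.1 (phaseLift φ (translation η z)) =
      rescale κ' P.1 (phaseLift φ' (translation η' z)) := fun P z =>
    congrFun (congrArg Subtype.val (LinearEquiv.congr_fun h P)) z
  have h1 : κ = κ' := by
    obtain ⟨x⟩ : Nonempty M := inferInstance
    have := hv 1 ⟨x, 0⟩
    change κ * 1 = κ' * 1 at this
    simpa using this
  subst h1
  -- Testing on `U_{κ⁻¹} P` removes the rescaling. Then the base points determine `φ`, and
  -- cancelling its phase lift on the zero section determines the form.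
  have h2 : ∀ z, phaseLift φ (translation η z) = phaseLift φ' (translation η' z) := by
    intro z
    refine eq_of_apply_eq n fun P => ?_
    have h3 := hv ⟨_, rescale_mem_rayAlg P.2 κ⁻¹⟩ z
    have h4 := rescale_inv_rescale (inv_ne_zero hκ) P.1
    rw [inv_inv] at h4
    simpa only [h4] using h3
  have h3 : φ.symm = φ'.symm := by
    ext x
    exact congrArg (fun z : CotangentBundle n M => z.1) (h2 ⟨x, 0⟩)
  have h4 : φ = φ' := by
    have := congrArg Diffeomorph.symm h3
    exact this
  subst h4
  refine ⟨rfl, rfl, ?_⟩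
  ext1 x
  have h5 := congrArg (phaseLift φ.symm) (h2 ⟨x, 0⟩)
  rw [phaseLift_symm_phaseLift, phaseLift_symm_phaseLift] at h5
  have h6 : (0 : Cotangent n M x) + η x = 0 + η' x := by
    have := (Bundle.TotalSpace.mk.injEq ..).mp h5
    exact eq_of_heq this.2
  simpa using h6

end NormalForm

/-! ### From function-linear maps on vector fields to closed forms. -/

section Rigidity

variable {n : ℕ} {M : Type*} [TopologicalSpace M] [ChartedSpace (Model n) M]
  [IsManifold (𝓡 n) ∞ M] [T2Space M]

lemma onBase_sum {ι : Type*} (J : Finset ι) (P : ι → rayAlg n M) (x : M) :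
    onBase (∑ j ∈ J, P j) x = ∑ j ∈ J, onBase (P j) x :=
  LocFin.coe_sum J _

/-- The map `c` is linear over `S₀(M)` on `S_i(M)`. -/
def BaseLinear (i : ℕ) (c : rayAlg n M →ₗ[ℝ] rayAlg n M) : Prop :=
  ∀ f ∈ (grading n M).part 0, ∀ P ∈ (grading n M).part i, c (f * P) = f * c P

/-- Maps that are linear over `S₀(M)` are local. -/
lemma BaseLinear.onBase_eq {c : rayAlg n M →ₗ[ℝ] rayAlg n M} {i : ℕ} (hc : BaseLinear i c)
    {P Q : rayAlg n M} (hP : P ∈ (grading n M).part i) (hQ : Q ∈ (grading n M).part i)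
    {U : Set M} (hU : IsOpen U) {x : M} (hx : x ∈ U)
    (h : ∀ z : CotangentBundle n M, z.1 ∈ U → P.1 z = Q.1 z) :
    onBase (c P) x = onBase (c Q) x := by
  obtain ⟨χ, hχ, hs, h1⟩ := exists_bump (n := n) (hU.mem_nhds hx)
  have h2 : pull χ hχ * P = pull χ hχ * Q := by
    refine Subtype.ext (funext fun z => ?_)
    change χ z.1 * P.1 z = χ z.1 * Q.1 z
    by_cases hz : z.1 ∈ U
    · rw [h z hz]
    · rw [image_eq_zero_of_notMem_tsupport fun hz' => hz (hs hz'), zero_mul, zero_mul]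
  have h3 := congrArg c h2
  rw [hc _ (pull_mem _ _) _ hP, hc _ (pull_mem _ _) _ hQ] at h3
  have h4 : χ x * onBase (c P) x = χ x * onBase (c Q) x :=
    congrArg (fun R : rayAlg n M => onBase R x) h3
  have h5 : χ x = 1 := h1.eq_of_nhds
  simpa only [h5, one_mul] using h4

/-- The `1`-form that represents an `S₀(M)`-linear map `c : S₁(M) → S₀(M)`. -/
def formOf (c : rayAlg n M →ₗ[ℝ] rayAlg n M) (x : M) : Cotangent n M x :=
  ∑ j, onBase (c ((exists_coordFrame (n := n) (mem_chart_source (Model n) x)).some.p j)) x •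
    (EuclideanSpace.proj j : Model n →L[ℝ] ℝ)

section FormOf

variable {c : rayAlg n M →ₗ[ℝ] rayAlg n M}

/-- Near `x`, Euler's identity gives `X = ∑ {X, qⱼ} pⱼ`. Locality and linearity over functions
reduce `c X` at `x` to the values of `c` on the momenta, which are the components of the form. -/
lemma apply_formOf (hc : BaseLinear 1 c) {X : rayAlg n M} (hX : X ∈ (grading n M).part 1) (x : M) :
    X.1 ⟨x, formOf c x⟩ = onBase (c X) x := by
  set F := (exists_coordFrame (n := n) (mem_chart_source (Model n) x)).some with hF
  have hb : ∀ j, (grading n M).br X (F.q j) ∈ (grading n M).part 0 := fun j =>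
    (grading n M).br_mem hX (F.q_mem j) rfl
  have h1 : onBase (c X) x = onBase (c (∑ j, (grading n M).br X (F.q j) * F.p j)) x := by
    refine hc.onBase_eq hX (Submodule.sum_mem _ fun j _ =>
      (grading n M).zero_mul_mem (hb j) (F.p_mem j)) F.isOpen_nhd F.mem_nhd fun z hz => ?_
    have := F.euler hX hz
    rw [Nat.cast_one, one_mul] at this
    rw [LocFin.coe_sum, ← this]
    exact Finset.sum_congr rfl fun j _ => mul_comm _ _
  have h2 := F.euler hX (z := ⟨x, formOf c x⟩) F.mem_nhd
  rw [Nat.cast_one, one_mul] at h2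
  rw [← h2, h1, map_sum, onBase_sum]
  refine Finset.sum_congr rfl fun j _ => ?_
  rw [hc _ (hb j) _ (F.p_mem j), F.p_eq j _ F.mem_nhd,
    cotChart_self_apply (⟨x, formOf c x⟩ : CotangentBundle n M), apply_of_mem_zero (hb j)]
  have h3 : (show Model n →L[ℝ] ℝ from formOf c x) (EuclideanSpace.single j 1) =
      onBase (c (F.p j)) x := by
    change (∑ j, onBase (c (F.p j)) x • (EuclideanSpace.proj j : Model n →L[ℝ] ℝ)) _ = _
    rw [sum_apply, Finset.sum_eq_single j]
    · simp
    · intro i _ hij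
      simp [hij]
    · simp
  change (show Model n →L[ℝ] ℝ from formOf c x) (EuclideanSpace.single j 1) * _ =
    onBase ((grading n M).br X (F.q j)) x * onBase (c (F.p j)) x
  rw [h3, mul_comm]

/-- `formOf` chooses a frame separately at each point. This expression in one chart is what allows
the form to be differentiated. -/
lemma cotChart_formOf (hc : BaseLinear 1 c) {x₀ x₁ : M} (F : CoordFrame (n := n) x₀ x₁) {y : M} (hy : y ∈ F.nhd) :
    cotChart x₀ (⟨y, formOf c y⟩ : CotangentBundle n M) = (extChartAt (𝓡 n) x₀ y,
      ∑ j, onBase (c (F.p j)) y • (EuclideanSpace.proj j : Model n →L[ℝ] ℝ)) := by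
  refine Prod.ext (cotChart_apply_fst (z := ⟨y, formOf c y⟩) (F.nhd_subset hy)) ?_
  rw [dual_eq_sum (cotChart x₀ (⟨y, formOf c y⟩ : CotangentBundle n M)).2]
  refine Finset.sum_congr rfl fun j _ => ?_
  rw [← apply_formOf hc (F.p_mem j), F.p_eq j _ hy]

lemma contMDiff_formOf (hc : BaseLinear 1 c) : ContMDiff (𝓡 n) (cotModel n) ∞
    (fun x => (⟨x, formOf c x⟩ : CotangentBundle n M)) := by
  intro x
  have hx := mem_chart_source (Model n) x
  obtain ⟨F⟩ := exists_coordFrame (n := n) hx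
  have h1 : ContMDiffAt (𝓡 n) 𝓘(ℝ, Model n × (Model n →L[ℝ] ℝ)) ∞
      (fun y => (extChartAt (𝓡 n) x y,
        ∑ j, onBase (c (F.p j)) y • (EuclideanSpace.proj j : Model n →L[ℝ] ℝ))) x := by
    refine ContMDiffAt.prodMk_space (contMDiffAt_extChartAt) ?_
    have h3 : ContDiff ℝ ∞ (fun a : Fin n → ℝ =>
        ∑ j, a j • (EuclideanSpace.proj j : Model n →L[ℝ] ℝ)) := by fun_prop
    exact h3.contMDiff.comp (contMDiff_pi_space.2 fun j => contMDiff_onBase (c (F.p j))) x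
  have h2 : ContMDiffAt 𝓘(ℝ, Model n × (Model n →L[ℝ] ℝ)) (cotModel n) ∞
      ((cotChart x).symm : _ → CotangentBundle n M) (extChartAt (𝓡 n) x x,
        ∑ j, onBase (c (F.p j)) x • (EuclideanSpace.proj j : Model n →L[ℝ] ℝ)) := by
    refine (contMDiffOn_cotChart_symm x).contMDiffAt ((isOpen_cotChart_target x).mem_nhds ?_)
    exact mem_cotChart_target.2 (mem_target_of_mem_source hx)
  refine (h2.comp x h1).congr_of_eventuallyEq ?_
  filter_upwards [F.isOpen_nhd.mem_nhds F.mem_nhd] with y hy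
  rw [Function.comp_apply, ← cotChart_formOf hc F hy]
  exact ((cotChart x).left_inv (x := (⟨y, formOf c y⟩ : CotangentBundle n M))
    (mem_cotChart_source.2 (F.nhd_subset hy))).symm

/-- The `1`-form that represents an `S₀(M)`-linear map `c : S₁(M) → S₀(M)`. -/
def oneFormOf (hc : BaseLinear 1 c) : OneForm n M := ⟨formOf c, contMDiff_formOf hc⟩

/-- The components of the form are the functions `c (pⱼ)`. Since `{pᵢ, pⱼ} = 0` near the point, the
cocycle identity becomes `∂ᵢ ηⱼ = ∂ⱼ ηᵢ`. -/
lemma isClosedForm_oneFormOf (hc : BaseLinear 1 c)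
    (h0 : ∀ X ∈ (grading n M).part 1, c X ∈ (grading n M).part 0)
    (hder : ∀ X ∈ (grading n M).part 1, ∀ Y ∈ (grading n M).part 1,
      c ((grading n M).br X Y) = (grading n M).br X (c Y) - (grading n M).br Y (c X)) :
    IsClosedForm (oneFormOf hc) := by
  intro x₀ y hy u v
  have hx := symm_mem_source hy
  set x₁ := (extChartAt (𝓡 n) x₀).symm y with hx₁
  have hxy : extChartAt (𝓡 n) x₀ x₁ = y := (extChartAt (𝓡 n) x₀).right_inv hy
  obtain ⟨F⟩ := exists_coordFrame (n := n) hx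
  let A : Fin n → Model n →L[ℝ] ℝ := fun j =>
    (chartDeriv x₀ (c (F.p j)).1 ⟨x₁, 0⟩).comp (ContinuousLinearMap.inl ℝ _ _)
  have hA : ∀ j, HasFDerivAt (onBase (c (F.p j)) ∘ (extChartAt (𝓡 n) x₀).symm) (A j) y := fun j => by
    have := hasFDerivAt_onBase hx (h0 _ (F.p_mem j))
    rwa [hxy] at this
  have hsymm : ∀ i j, A i (EuclideanSpace.single j 1) = A j (EuclideanSpace.single i 1) := by
    intro i j
    have h1 : onBase (c ((grading n M).br (F.p i) (F.p j))) x₁ = 0 := by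
      rw [← apply_formOf hc ((grading n M).br_mem (F.p_mem i) (F.p_mem j) rfl)]
      exact F.br_p_p (z := ⟨x₁, formOf c x₁⟩) F.mem_nhd i j
    rw [hder _ (F.p_mem i) _ (F.p_mem j), (grading n M).br_swap (F.p i),
      (grading n M).br_swap (F.p j)] at h1
    have h2 := F.br_p (c (F.p j)) (z := ⟨x₁, 0⟩) F.mem_nhd i
    have h3 := F.br_p (c (F.p i)) (z := ⟨x₁, 0⟩) F.mem_nhd j
    change -((grading n M).br (c (F.p j)) (F.p i)).1 ⟨x₁, 0⟩ -
      -((grading n M).br (c (F.p i)) (F.p j)).1 ⟨x₁, 0⟩ = 0 at h1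
    rw [h2, h3, neg_neg, neg_neg] at h1
    exact (sub_eq_zero.1 h1).symm
  have hloc : HasFDerivAt (localForm (oneFormOf hc) x₀)
      (∑ j, (A j).smulRight (EuclideanSpace.proj j : Model n →L[ℝ] ℝ)) y := by
    have h1 : HasFDerivAt (fun q => ∑ j, onBase (c (F.p j)) ((extChartAt (𝓡 n) x₀).symm q) •
        (EuclideanSpace.proj j : Model n →L[ℝ] ℝ))
        (∑ j, (A j).smulRight (EuclideanSpace.proj j : Model n →L[ℝ] ℝ)) y :=
      HasFDerivAt.fun_sum fun j _ => (hA j).smul_const (EuclideanSpace.proj j : Model n →L[ℝ] ℝ)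
    refine h1.congr_of_eventuallyEq ?_
    have h2 := eventually_mem_target hx
    have h3 := eventually_symm_mem hx (F.isOpen_nhd.mem_nhds F.mem_nhd)
    rw [hxy] at h2 h3
    filter_upwards [h2, h3] with q hq hq'
    rw [localForm_eq _ hq, formRep_eq hq]
    exact congrArg Prod.snd (cotChart_formOf hc F hq')
  have hval : ∀ u v, fderiv ℝ (localForm (oneFormOf hc) x₀) y u v = ∑ j, A j u * v j := fun u v => by
    rw [hloc.fderiv, sum_apply, sum_apply]
    rfl
  have hexp : ∀ u v : Model n, ∑ j, A j u * v j =
      ∑ j, ∑ i, u i * v j * A j (EuclideanSpace.single i 1) := fun u v => by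
    refine Finset.sum_congr rfl fun j _ => ?_
    conv_lhs => rw [model_eq_sum u, map_sum, Finset.sum_mul]
    refine Finset.sum_congr rfl fun i _ => ?_
    rw [map_smul, smul_eq_mul]
    ring
  rw [hval, hval, hexp, hexp, Finset.sum_comm]
  refine Finset.sum_congr rfl fun j _ => Finset.sum_congr rfl fun i _ => ?_
  rw [hsymm]
  ring

end FormOf

end Rigidity

/-! ### Reduction of an automorphism to normal form. -/

section Automorphisms

variable {n : ℕ} {M : Type*} [TopologicalSpace M] [ChartedSpace (Model n) M]
  [IsManifold (𝓡 n) ∞ M] [T2Space M]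

/-- The linear automorphism `Φ` preserves the Poisson bracket. -/
def PreservesBracket (Φ : rayAlg n M ≃ₗ[ℝ] rayAlg n M) : Prop :=
  ∀ P Q, Φ ((grading n M).br P Q) = (grading n M).br (Φ P) (Φ Q)

lemma PreservesBracket.symm {Φ : rayAlg n M ≃ₗ[ℝ] rayAlg n M} (h : PreservesBracket Φ) :
    PreservesBracket Φ.symm := fun P Q => by
  rw [LinearEquiv.symm_apply_eq, h, Φ.apply_symm_apply, Φ.apply_symm_apply]

lemma PreservesBracket.trans {Φ Ψ : rayAlg n M ≃ₗ[ℝ] rayAlg n M} (h : PreservesBracket Φ)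
    (h' : PreservesBracket Ψ) : PreservesBracket (Φ.trans Ψ) := fun P Q => by
  simp only [LinearEquiv.trans_apply, h P Q, h' (Φ P) (Φ Q)]

lemma PreservesBracket.mem_zero_iff {Φ : rayAlg n M ≃ₗ[ℝ] rayAlg n M} (h : PreservesBracket Φ)
    (f : rayAlg n M) : f ∈ (grading n M).part 0 ↔ Φ f ∈ (grading n M).part 0 :=
  (grading n M).map_mem_part_zero mem_part_zero_of_br_eq_zero (fun _ hf => exists_exp hf)
    eq_zero_of_ringHom Φ h f

lemma fibre_add {X : rayAlg n M} (hX : X ∈ (grading n M).part 1) (x : M)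
    (α β : Cotangent n M x) : X.1 ⟨x, α + β⟩ = X.1 ⟨x, α⟩ + X.1 ⟨x, β⟩ := by
  obtain ⟨c, hc⟩ := (Submodule.mem_comap.1 hX).2 x
  have hu : ∀ γ : Cotangent n M x, (fun _ : Fin 1 => γ) = Function.update (fun _ => 0) 0 γ := fun γ => by
    funext i
    rw [Subsingleton.elim i 0, Function.update_self]
  have h := c.map_update_add (fun _ => 0) 0 α β
  rw [← hu, ← hu, ← hu, ← hc, ← hc, ← hc] at h
  exact h

section IdOnFunctions

variable {Ψ : rayAlg n M ≃ₗ[ℝ] rayAlg n M}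

/-- `{Ψ P - P, f} = Ψ {P, f} - {P, f} = 0`, because `{P, f}` has degree `i`; now use the centralizer
of `S₀`. -/
lemma sub_mem_zero (hΨ : PreservesBracket Ψ) (hid : ∀ f ∈ (grading n M).part 0, Ψ f = f) {i : ℕ}
    (hi : ∀ P ∈ (grading n M).part i, Ψ P = P) {P : rayAlg n M}
    (hP : P ∈ (grading n M).part (i + 1)) : Ψ P - P ∈ (grading n M).part 0 := by
  refine mem_part_zero_of_br_eq_zero _ fun f hf => ?_
  have h := hΨ P f
  rw [hid f hf, hi _ ((grading n M).br_mem hP hf rfl)] at h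
  rw [map_sub, LinearMap.sub_apply, ← h, sub_self]

/-- On brackets with functions, `Ψ - id` sends `{P, f}` to `{Ψ P - P, f}`, which is the hypothesis
of `map_mul_of_derivation`. -/
lemma baseLinear_sub [SecondCountableTopology M] [ConnectedSpace M] (hΨ : PreservesBracket Ψ)
    (hid : ∀ f ∈ (grading n M).part 0, Ψ f = f) (i : ℕ) :
    BaseLinear i (Ψ.toLinearMap - LinearMap.id) := fun g hg Q hQ => by
  refine (grading n M).map_mul_of_derivation (nonsingular_grading n M) _ i (fun P _ => ?_) hg hQ
  refine ⟨Ψ P - P, fun f hf => ?_⟩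
  change Ψ _ - _ = _
  rw [hΨ, hid f hf, map_sub, LinearMap.sub_apply]
  rfl

/-- The difference `c = Ψ - id` maps `S₁` to `S₀` linearly over functions, so it is evaluation on a
form. Expanding `{X + c X, Y + c Y}`, where `{c X, c Y} = 0`, gives the cocycle identity and hence
closedness. -/
lemma exists_oneForm [SecondCountableTopology M] [ConnectedSpace M] (hΨ : PreservesBracket Ψ)
    (hid : ∀ f ∈ (grading n M).part 0, Ψ f = f) :
    ∃ η : OneForm n M, IsClosedForm η ∧ ∀ X ∈ (grading n M).part 1,
      Ψ X = nfEquiv 1 one_ne_zero (Diffeomorph.refl (𝓡 n) M ∞) η X := by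
  have hlin := baseLinear_sub hΨ hid 1
  have h0 : ∀ X ∈ (grading n M).part 1, Ψ X - X ∈ (grading n M).part 0 := fun X hX =>
    sub_mem_zero hΨ hid hid hX
  refine ⟨oneFormOf hlin, isClosedForm_oneFormOf hlin h0 fun X hX Y hY => ?_, fun X hX => ?_⟩
  · change Ψ _ - _ = (grading n M).br X (Ψ Y - Y) - (grading n M).br Y (Ψ X - X)
    have h1 := (grading n M).br_zero (h0 X hX) (h0 Y hY)
    rw [hΨ, (grading n M).br_swap Y]
    simp only [map_sub, LinearMap.sub_apply] at h1 ⊢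
    linear_combination h1
  · refine Subtype.ext (funext fun z => ?_)
    have h1 := apply_of_mem_zero (h0 X hX) z
    have h2 : X.1 ⟨z.1, formOf (Ψ.toLinearMap - LinearMap.id) z.1⟩ = onBase (Ψ X - X) z.1 :=
      apply_formOf hlin hX z.1
    have h3 := fibre_add hX z.1 z.2 (formOf (Ψ.toLinearMap - LinearMap.id) z.1)
    rw [nfEquiv_apply, rescale_one, Function.comp_apply, Function.comp_apply, phaseLift_refl]
    refine Eq.trans ?_ h3.symm
    rw [h2, ← h1]
    change _ = X.1 z + ((Ψ X).1 z - X.1 z)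
    ring

/-- Induct on the degree and put `c = Ψ - id`, which maps `S_{i+1}` to `S₀` linearly over functions.
The field `X = ∑ qⱼ pⱼ`, with `qⱼ = 0` at `x`, is fixed by `Ψ`, so `c {X, P} = {X, c P}`, and this
vanishes at `x`. But near `x` one has `{X, P} = ∑ qⱼ {pⱼ, P} - (i + 1) P`, so the left side at `x`
is `-(i + 1) c P`. Hence `c P` vanishes at `x`. -/
lemma eq_id [SecondCountableTopology M] [ConnectedSpace M] (hΨ : PreservesBracket Ψ)
    (hid : ∀ f ∈ (grading n M).part 0, Ψ f = f) (hid1 : ∀ X ∈ (grading n M).part 1, Ψ X = X)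
    (P : rayAlg n M) : Ψ P = P := by
  have key : ∀ i, ∀ P ∈ (grading n M).part i, Ψ P = P := by
    intro i
    induction i with
    | zero => exact hid
    | succ i ih =>
      intro P hP
      rcases Nat.eq_zero_or_pos i with rfl | hi
      · exact hid1 P hP
      set c : rayAlg n M →ₗ[ℝ] rayAlg n M := Ψ.toLinearMap - LinearMap.id with hc
      have hlin : BaseLinear (i + 1) c := baseLinear_sub hΨ hid (i + 1)
      have hc0 : ∀ P ∈ (grading n M).part (i + 1), c P ∈ (grading n M).part 0 := fun P hP =>
        sub_mem_zero hΨ hid ih hP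
      suffices h : c P = 0 from sub_eq_zero.1 h
      rw [eq_pull_onBase (hc0 P hP)]
      refine Subtype.ext (funext fun z => ?_)
      change onBase (c P) z.1 = 0
      set x := z.1
      obtain ⟨F⟩ := exists_coordFrame (n := n) (mem_chart_source (Model n) x)
      let X : rayAlg n M := ∑ j, F.q j * F.p j
      have hX : X ∈ (grading n M).part 1 :=
        Submodule.sum_mem _ fun j _ => (grading n M).zero_mul_mem (F.q_mem j) (F.p_mem j)
      have hpP : ∀ j, (grading n M).br (F.p j) P ∈ (grading n M).part (i + 1) := fun j =>
        (grading n M).br_mem (F.p_mem j) hP (add_comm _ _)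
      have hXP : (grading n M).br X P ∈ (grading n M).part (i + 1) :=
        (grading n M).br_mem hX hP (add_comm _ _)
      have hbr : ∀ R, (grading n M).br X R =
          ∑ j, F.q j * (grading n M).br (F.p j) R - ∑ j, F.p j * (grading n M).br R (F.q j) := by
        intro R
        rw [map_sum, LinearMap.sum_apply, ← Finset.sum_sub_distrib]
        refine Finset.sum_congr rfl fun j _ => ?_
        rw [(grading n M).mul_br, (grading n M).br_swap (F.q j)]
        ring
      have hq : ∀ j, onBase (F.q j) x = 0 := by
        intro j
        have h1 := F.q_eq j ⟨x, 0⟩ F.mem_nhd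
        rw [cotChart_apply_fst (z := ⟨x, 0⟩) (F.nhd_subset F.mem_nhd), sub_self] at h1
        exact h1
      have h1 : onBase (c ((grading n M).br X P)) x = 0 := by
        have h2 : c ((grading n M).br X P) = (grading n M).br X (c P) := by
          change Ψ _ - _ = (grading n M).br X (Ψ P - P)
          rw [hΨ, hid1 X hX, map_sub]
          rfl
        rw [h2, hbr]
        have h3 : ∑ j, F.p j * (grading n M).br (c P) (F.q j) = 0 :=
          Finset.sum_eq_zero fun j _ => by
            rw [(grading n M).br_zero (hc0 P hP) (F.q_mem j), mul_zero]
        rw [h3, sub_zero, onBase_sum]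
        refine Finset.sum_eq_zero fun j _ => ?_
        change onBase (F.q j) x * _ = 0
        rw [hq, zero_mul]
      have hS : ∑ j, F.q j * (grading n M).br (F.p j) P ∈ (grading n M).part (i + 1) :=
        Submodule.sum_mem _ fun j _ => (grading n M).zero_mul_mem (F.q_mem j) (hpP j)
      have h4 : onBase (c ((grading n M).br X P)) x =
          onBase (c (∑ j, F.q j * (grading n M).br (F.p j) P - ((i + 1 : ℕ) : ℝ) • P)) x := by
        refine hlin.onBase_eq hXP (Submodule.sub_mem _ hS (Submodule.smul_mem _ _ hP))
          F.isOpen_nhd F.mem_nhd fun w hw => ?_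
        have h5 := F.euler hP hw
        have h6 : (∑ j, F.p j * (grading n M).br P (F.q j) : rayAlg n M).1 w =
            ((i + 1 : ℕ) : ℝ) * P.1 w := (LocFin.coe_sum _ _).trans h5
        rw [hbr]
        change _ - (∑ j, F.p j * (grading n M).br P (F.q j) : rayAlg n M).1 w = _ - _ * P.1 w
        rw [h6]
      have h7 : onBase (c (∑ j, F.q j * (grading n M).br (F.p j) P)) x = 0 := by
        rw [map_sum, onBase_sum]
        refine Finset.sum_eq_zero fun j _ => ?_
        rw [hlin _ (F.q_mem j) _ (hpP j)]
        change onBase (F.q j) x * _ = 0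
        rw [hq, zero_mul]
      rw [h4, map_sub, map_smul] at h1
      change onBase (c (∑ j, F.q j * (grading n M).br (F.p j) P)) x -
        ((i + 1 : ℕ) : ℝ) * onBase (c P) x = 0 at h1
      rw [h7, zero_sub, neg_eq_zero, mul_eq_zero] at h1
      exact h1.resolve_left (Nat.cast_ne_zero.2 (Nat.succ_ne_zero i))
  have hP : P ∈ ⨆ i, (grading n M).part i := (grading n M).iSup_part ▸ Submodule.mem_top
  induction hP using Submodule.iSup_induction' with
  | zero => exact map_zero Ψ
  | add P P' _ _ h1 h2 => rw [map_add, h1, h2]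
  | mem i P hP => exact key i P hP

end IdOnFunctions

variable [SecondCountableTopology M] [ConnectedSpace M]

/-- The image of `1` under an automorphism is a nonzero constant. -/
lemma exists_const {Φ : rayAlg n M ≃ₗ[ℝ] rayAlg n M} (hΦ : PreservesBracket Φ) :
    ∃ κ : ℝ, κ ≠ 0 ∧ Φ 1 = algebraMap ℝ _ κ := by
  -- `1` is central, hence so is its image, which moreover lies in `S₀`.
  obtain ⟨κ, hκ⟩ := const_of_br_eq_zero ((hΦ.mem_zero_iff 1).1 (grading n M).one_mem) fun X _ => by
    have h := hΦ (Φ.symm X) 1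
    rw [(grading n M).br_one, map_zero, Φ.apply_symm_apply] at h
    exact h.symm
  refine ⟨κ, fun h0 => ?_, hκ⟩
  rw [h0, map_zero] at hκ
  have h1 : (1 : rayAlg n M) = 0 := Φ.injective (hκ.trans (map_zero Φ).symm)
  obtain ⟨x⟩ : Nonempty M := inferInstance
  have h2 : (1 : ℝ) = 0 := congrArg (fun R : rayAlg n M => onBase R x) h1
  exact one_ne_zero h2

/-- Every automorphism of `S(M)` has the normal form. -/
theorem exists_eq_nfEquiv {Φ : rayAlg n M ≃ₗ[ℝ] rayAlg n M} (hΦ : PreservesBracket Φ) :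
    ∃ (κ : ℝ) (hκ : κ ≠ 0) (φ : M ≃ₘ^∞⟮𝓡 n, 𝓡 n⟯ M) (η : OneForm n M),
      IsClosedForm η ∧ Φ = nfEquiv κ hκ φ η := by
  obtain ⟨κ, hκ, h1⟩ := exists_const hΦ
  have hmul : ∀ f ∈ (grading n M).part 0, ∀ g ∈ (grading n M).part 0,
      κ • Φ (f * g) = Φ f * Φ g := fun f hf g hg => by
    rw [← (grading n M).map_mul_of_lieEquiv (nonsingular_grading n M) Φ hΦ hΦ.mem_zero_iff hf hg,
      h1, mul_comm (Φ _), Algebra.smul_def]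
  -- Dividing by `κ = Φ 1` turns the twisted product rule into multiplicativity on `S₀`.
  let Ψ := Φ.trans (LinearEquiv.smulOfNeZero ℝ (rayAlg n M) κ⁻¹ (inv_ne_zero hκ))
  have hΨ : ∀ f, Ψ f = κ⁻¹ • Φ f := fun f => rfl
  obtain ⟨φ, hφ⟩ := exists_diffeomorph Ψ (fun f => by
      rw [hΦ.mem_zero_iff, hΨ, Submodule.smul_mem_iff _ (inv_ne_zero hκ)])
    (by rw [hΨ, h1, Algebra.algebraMap_eq_smul_one, inv_smul_smul₀ hκ])
    (fun f hf g hg => by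
      rw [hΨ, hΨ, hΨ, smul_mul_smul_comm, ← hmul f hf g hg, smul_smul, mul_assoc,
        inv_mul_cancel₀ hκ, mul_one])
  set N := nfEquiv κ hκ φ (0 : OneForm n M) with hN
  have hNb : PreservesBracket N := nfEquiv_br hκ φ isClosedForm_zero
  have hN0 : ∀ f ∈ (grading n M).part 0, N f = Φ f := by
    intro f hf
    refine Subtype.ext (funext fun z => ?_)
    have h2 := hφ f hf z.1
    have h3 : onBase (Ψ f) z.1 = κ⁻¹ * onBase (Φ f) z.1 := rfl
    rw [apply_of_mem_zero ((hΦ.mem_zero_iff f).1 hf), ← mul_inv_cancel_left₀ hκ (onBase (Φ f) z.1),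
      ← h3, h2]
    change κ * f.1 _ = _
    rw [apply_of_mem_zero hf]
    rfl
  -- Precomposing with the inverse of `N = φ* ∘ U_κ` (acting by pullback) leaves an automorphism
  -- that fixes every function on `M`.
  have hΦ₁ : PreservesBracket (N.symm.trans Φ) := hNb.symm.trans hΦ
  have hid : ∀ f ∈ (grading n M).part 0, (N.symm.trans Φ) f = f := by
    intro f hf
    rw [LinearEquiv.trans_apply, ← hN0 _ ((hNb.symm.mem_zero_iff f).1 hf), N.apply_symm_apply]
  obtain ⟨η, hη, hη1⟩ := exists_oneForm hΦ₁ hid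
  set T := nfEquiv 1 one_ne_zero (Diffeomorph.refl (𝓡 n) M ∞) η with hT
  have hTb : PreservesBracket T := nfEquiv_br one_ne_zero _ hη
  have hT0 : ∀ f ∈ (grading n M).part 0, T f = f := by
    intro f hf
    refine Subtype.ext (funext fun z => ?_)
    rw [hT, nfEquiv_apply, rescale_one, Function.comp_apply, Function.comp_apply, phaseLift_refl,
      apply_of_mem_zero hf, apply_of_mem_zero hf]
    rfl
  -- The remaining map `T⁻¹ ∘ Φ ∘ N⁻¹` fixes `S₀` and `S₁`, so it is the identity and `Φ = T ∘ N`.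
  have hfin := eq_id (hΦ₁.trans hTb.symm)
    (fun f hf => by rw [LinearEquiv.trans_apply, hid f hf, LinearEquiv.symm_apply_eq, hT0 f hf])
    (fun X hX => by rw [LinearEquiv.trans_apply, hη1 X hX, T.symm_apply_apply])
  refine ⟨κ, hκ, φ, η, hη, LinearEquiv.ext fun P => ?_⟩
  have h4 := hfin (N P)
  rw [LinearEquiv.trans_apply, LinearEquiv.trans_apply, N.symm_apply_apply,
    LinearEquiv.symm_apply_eq] at h4
  rw [h4]
  refine Subtype.ext (funext fun z => ?_)
  rw [hT, nfEquiv_apply, rescale_one, hN, nfEquiv_apply, nfEquiv_apply]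
  simp only [Function.comp_apply, phaseLift_refl, translation_zero]

end Automorphisms

/-! ### Transfer from the algebra of ray polynomials to `S(M)`. -/

section Transfer

variable {n : ℕ} {M : Type*} [TopologicalSpace M] [ChartedSpace (Model n) M]
  [IsManifold (𝓡 n) ∞ M]

variable (n M) in
/-- `S(M)` as an algebra. -/
def polyEquiv : PolyFun n M ≃ₗ[ℝ] rayAlg n M where
  toFun P := ⟨P.1, mem_polyFun_iff.1 P.2⟩
  map_add' _ _ := rfl
  map_smul' _ _ := rfl
  invFun P := ⟨P.1, mem_polyFun_iff.2 P.2⟩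
  left_inv _ := rfl
  right_inv _ := rfl

lemma hasNormalForm_iff {Φ : PolyFun n M →ₗ[ℝ] PolyFun n M} {κ : ℝ} (hκ : κ ≠ 0)
    {φ : M ≃ₘ^∞⟮𝓡 n, 𝓡 n⟯ M} {η : OneForm n M} : HasNormalForm Φ κ φ η ↔
      ∀ P, polyEquiv n M (Φ P) = nfEquiv κ hκ φ η (polyEquiv n M P) :=
  forall_congr' fun P => (Subtype.ext_iff (a1 := polyEquiv n M (Φ P))
    (a2 := nfEquiv κ hκ φ η (polyEquiv n M P))).symm

lemma isLieAutomorphism_of_hasNormalForm {Φ : PolyFun n M →ₗ[ℝ] PolyFun n M} {κ : ℝ} (hκ : κ ≠ 0)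
    {φ : M ≃ₘ^∞⟮𝓡 n, 𝓡 n⟯ M} {η : OneForm n M} (hη : IsClosedForm η)
    (h : HasNormalForm Φ κ φ η) : IsLieAutomorphism Φ := by
  have h1 := (hasNormalForm_iff hκ).1 h
  refine ⟨?_, fun P Q R hR => ?_⟩
  · have h2 : (Φ : PolyFun n M → PolyFun n M) =
        (((polyEquiv n M).trans (nfEquiv κ hκ φ η)).trans (polyEquiv n M).symm) :=
      funext fun P => by
        rw [LinearEquiv.trans_apply, LinearEquiv.trans_apply, ← h1, LinearEquiv.symm_apply_apply]
    rw [h2]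
    exact LinearEquiv.bijective _
  · have h3 : polyEquiv n M R = (grading n M).br (polyEquiv n M P) (polyEquiv n M Q) :=
      Subtype.ext hR
    have h4 := h1 R
    rw [h3, nfEquiv_br hκ φ hη, ← h1, ← h1] at h4
    exact congrArg Subtype.val h4

lemma exists_hasNormalForm [T2Space M] [SecondCountableTopology M] [ConnectedSpace M]
    {Φ : PolyFun n M →ₗ[ℝ] PolyFun n M} (h : IsLieAutomorphism Φ) :
    ∃ (κ : ℝ) (φ : M ≃ₘ^∞⟮𝓡 n, 𝓡 n⟯ M) (η : OneForm n M),
      κ ≠ 0 ∧ IsClosedForm η ∧ HasNormalForm Φ κ φ η := by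
  let Φ' : rayAlg n M ≃ₗ[ℝ] rayAlg n M :=
    ((polyEquiv n M).symm.trans (LinearEquiv.ofBijective Φ h.1)).trans (polyEquiv n M)
  have hΦ' : PreservesBracket Φ' := fun P Q => Subtype.ext
    (h.2 ((polyEquiv n M).symm P) ((polyEquiv n M).symm Q)
      ((polyEquiv n M).symm ((grading n M).br P Q)) rfl)
  obtain ⟨κ, hκ, φ, η, hη, he⟩ := exists_eq_nfEquiv hΦ'
  refine ⟨κ, φ, η, hκ, hη, (hasNormalForm_iff hκ).2 fun P => ?_⟩
  rw [← he]
  rfl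

end Transfer

end PolyPoisson

end

open PolyPoisson in
theorem mainTheorem6 (n : ℕ) (M : Type*) [TopologicalSpace M] [T2Space M]
    [SecondCountableTopology M] [ConnectedSpace M]
    [ChartedSpace (Model n) M] [IsManifold (𝓡 n) ∞ M] :
    -- `S(M)` is closed under the canonical Poisson bracket
    (∀ P ∈ PolyFun n M, ∀ Q ∈ PolyFun n M, poisson P Q ∈ PolyFun n M) ∧
    -- the automorphisms are exactly the maps of the stated form
    (∀ Φ : PolyFun n M →ₗ[ℝ] PolyFun n M,
      IsLieAutomorphism Φ ↔
        ∃ (κ : ℝ) (φ : M ≃ₘ^∞⟮𝓡 n, 𝓡 n⟯ M) (η : OneForm n M),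
          κ ≠ 0 ∧ IsClosedForm η ∧ HasNormalForm Φ κ φ η) ∧
    -- all data `κ, φ, η` occur
    (∀ (κ : ℝ) (φ : M ≃ₘ^∞⟮𝓡 n, 𝓡 n⟯ M) (η : OneForm n M),
      κ ≠ 0 → IsClosedForm η →
        ∃ Φ : PolyFun n M →ₗ[ℝ] PolyFun n M, HasNormalForm Φ κ φ η) ∧
    -- the data are uniquely determined by the map
    (∀ (Φ : PolyFun n M →ₗ[ℝ] PolyFun n M)
      (κ κ' : ℝ) (φ φ' : M ≃ₘ^∞⟮𝓡 n, 𝓡 n⟯ M) (η η' : OneForm n M),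
      κ ≠ 0 → κ' ≠ 0 → IsClosedForm η → IsClosedForm η' →
        HasNormalForm Φ κ φ η → HasNormalForm Φ κ' φ' η' →
          κ = κ' ∧ φ = φ' ∧ η = η') := by
  refine ⟨fun P hP Q hQ => poisson_mem_polyFun hP hQ, fun Φ => ⟨exists_hasNormalForm, ?_⟩,
    fun κ φ η hκ _ => ?_, fun Φ κ κ' φ φ' η η' hκ hκ' _ _ h h' => ?_⟩
  · rintro ⟨κ, φ, η, hκ, hη, h⟩
    exact isLieAutomorphism_of_hasNormalForm hκ hη h
  · exact ⟨(((polyEquiv n M).trans (nfEquiv κ hκ φ η)).trans (polyEquiv n M).symm).toLinearMap,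
      fun _ => rfl⟩
  · rw [hasNormalForm_iff hκ] at h
    rw [hasNormalForm_iff hκ'] at h'
    refine nfEquiv_injective hκ hκ' (LinearEquiv.ext fun P => ?_)
    obtain ⟨P, rfl⟩ := (polyEquiv n M).surjective P
    rw [← h, ← h']
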